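/- Let $K$ be a field of characteristic $0$ and let $\rho,\xi,\delta\in K$ be nonzero with $\delta(\xi-1)=\rho-1$ (so $\delta=\frac{\rho-1}{\xi-1}$ if $\xi\ne1$). For $n\ge 0$ let $Br_n=Br_n(\rho,\xi)$ be the $q$-Brauer algebra: the unital $K$-algebra with generators $g_1,\dots,g_{n-1}$ and, if $n\ge 2$, $e$, and relations - $g_ig_{i+1}g_i=g_{i+1}g_ig_{i+1}$, $\ g_ig_j=g_jg_i$ for $|i-j|>1$, $\ g_i^2=(\xi-1)g_i+\xi$; - $e^2=\delta e$, $\ eg_i=g_ie$ for $i>2$, $\ eg_1=g_1e=\xi e$, $\ eg_2e=\rho e$, $\ eg_2^{-1}e=\xi^{-1}e$; - $g_2g_3g_1^{-1}g_2^{-1}e_{(2)}=e_{(2)}=e_{(2)}g_2g_3g_1^{-1}g_2^{-1}$, where $e_{(2)}=e\,(g_2g_3g_1^{-1}g_2^{-1})\,e$. Let $\iota_n:Br_n\to Br_{n+1}$ be the homomorphism with $g_i\mapsto g_i$, $e\mapsto e$, and let $H_n\subset Br_n$ be the subalgebra generated by $g_1,\dots,g_{n-1}$. Put $e_{(0)}=1$,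 $e_{(k+1)}=e\,(g_2g_3\cdots g_{2k+1})(g_1^{-1}g_2^{-1}\cdots g_{2k}^{-1})\,e_{(k)}$ and $\bar e_{(k)}=\delta^{-k}e_{(k)}$ (for $2k\le n$). The algebra $\bar e_{(k)}Br_n\bar e_{(k)}$ is identified with $Br_{n-2k}$ so that $g_i\in Br_{n-2k}$ corresponds to $\bar e_{(k)}g_{i+2k}$ and $\delta^{-1}e\in Br_{n-2k}$ to $\bar e_{(k+1)}$; let $\Phi_k(h)\in Br_{n-2k}$ be the element that corresponds to $\bar e_{(k)}h\bar e_{(k)}$, for $h\in Br_n$. There is exactly one family of linear functionals $tr:Br_n\to K$ $(n\ge0)$ such that - $tr(1)=1$, and $tr(xy)=tr(yx)$ for all $x,y\in Br_n$; - $tr(\iota_n(h))=tr(h)$ and, for $n\ge 1$, $tr(g_n\iota_n(h))=\frac{\rho}{\delta}\,tr(h)$, for all $h\in H_n$; - $tr(a\,\bar e_{(k)}\,b)=\left(\frac{\rho\,\xi^{-1}}{\delta^2}\right)^{k}tr(\Phi_k(ba))$ for all $a,b\in H_n$ and $0\le 2k\le n$. For this $tr$, let $Ann_n=\{a\in Br_n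 : tr(ab)=0\text{ for all }b\in Br_n\}$, a two-sided ideal of $Br_n$. Then, for all $n\ge0$, $\iota_n(Ann_n)\subset Ann_{n+1}$, and $\iota_n$ induces an injective algebra homomorphism $Br_n/Ann_n\to Br_{n+1}/Ann_{n+1}$. -/

import Mathlib

namespace QBrauer

universe u

/-- The generators of the `q`-Brauer algebra on `n` strands: `g i` for `1 ≤ i < n`, and `e`,
which is present only if there are at least two strands. -/
inductive Gen (n : ℕ) : Type
  | g (i : ℕ) (h : 1 ≤ i ∧ i < n) : Gen n
  | e (h : 2 ≤ n) : Gen n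

section Relations

variable {K : Type u} [Field K]

/-- The free generator `g i` (only used for `1 ≤ i < n`; it is `0` outside this range). -/
def gFree (K : Type u) [Field K] (n i : ℕ) : FreeAlgebra K (Gen n) :=
  if h : 1 ≤ i ∧ i < n then FreeAlgebra.ι K (Gen.g i h) else 0

/-- The free generator `e` (only used for `2 ≤ n`; it is `0` otherwise). -/
def eFree (K : Type u) [Field K] (n : ℕ) : FreeAlgebra K (Gen n) :=
  if h : 2 ≤ n then FreeAlgebra.ι K (Gen.e h) else 0

/-- The expression `q⁻¹ g i + (q⁻¹ - 1)`, which represents the inverse of `g i`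
(see `g_mul_gInv` and `gInv_mul_g` below). -/
def gInvFree (q : K) (n i : ℕ) : FreeAlgebra K (Gen n) :=
  q⁻¹ • gFree K n i + (q⁻¹ - 1) • 1

/-- The word `g₂ g₃ g₁⁻¹ g₂⁻¹`. -/
def wFree (q : K) (n : ℕ) : FreeAlgebra K (Gen n) :=
  gFree K n 2 * gFree K n 3 * gInvFree q n 1 * gInvFree q n 2

/-- The word `e₍₂₎ = e (g₂ g₃ g₁⁻¹ g₂⁻¹) e`. -/
def eTwoFree (q : K) (n : ℕ) : FreeAlgebra K (Gen n) :=
  eFree K n * wFree q n * eFree K n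

/-- The defining relations of the `q`-Brauer algebra; `δ` is the value of `(r - 1) / (q - 1)`. -/
inductive Rel (q r δ : K) (n : ℕ) : FreeAlgebra K (Gen n) → FreeAlgebra K (Gen n) → Prop
  | hecke_sq (i : ℕ) (h1 : 1 ≤ i) (h2 : i < n) :
      Rel q r δ n (gFree K n i * gFree K n i) ((q - 1) • gFree K n i + q • 1)
  | hecke_braid (i : ℕ) (h1 : 1 ≤ i) (h2 : i + 1 < n) :
      Rel q r δ n (gFree K n i * gFree K n (i + 1) * gFree K n i)
        (gFree K n (i + 1) * gFree K n i * gFree K n (i + 1))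
  | hecke_comm (i j : ℕ) (h1 : 1 ≤ i) (h2 : i + 1 < j) (h3 : j < n) :
      Rel q r δ n (gFree K n i * gFree K n j) (gFree K n j * gFree K n i)
  | e_sq (h : 2 ≤ n) :
      Rel q r δ n (eFree K n * eFree K n) (δ • eFree K n)
  | e_comm (i : ℕ) (h1 : 2 < i) (h2 : i < n) :
      Rel q r δ n (eFree K n * gFree K n i) (gFree K n i * eFree K n)
  | e_g1 (h : 2 ≤ n) :
      Rel q r δ n (eFree K n * gFree K n 1) (q • eFree K n)
  | g1_e (h : 2 ≤ n) :
      Rel q r δ n (gFree K n 1 * eFree K n) (q • eFree K n)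
  | e_g2_e (h : 3 ≤ n) :
      Rel q r δ n (eFree K n * gFree K n 2 * eFree K n) (r • eFree K n)
  | e_g2Inv_e (h : 3 ≤ n) :
      Rel q r δ n (eFree K n * gInvFree q n 2 * eFree K n) (q⁻¹ • eFree K n)
  | w_eTwo (h : 4 ≤ n) :
      Rel q r δ n (wFree q n * eTwoFree q n) (eTwoFree q n)
  | eTwo_w (h : 4 ≤ n) :
      Rel q r δ n (eTwoFree q n * wFree q n) (eTwoFree q n)

end Relations

/-- The `q`-Brauer algebra `Br_n(r, q)` over the field `K`, where `δ` is the value of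
`(r - 1) / (q - 1)`. -/
abbrev Br {K : Type u} [Field K] (q r δ : K) (n : ℕ) : Type u :=
  RingQuot (Rel q r δ n)

section Elements

variable {K : Type u} [Field K] (q r δ : K) (n : ℕ)

/-- The quotient map from the free algebra. -/
noncomputable def toBr : FreeAlgebra K (Gen n) →ₐ[K] Br q r δ n :=
  RingQuot.mkAlgHom K (Rel q r δ n)

/-- The generator `g_i` of `Br_n`, for `1 ≤ i < n`. -/
noncomputable def g (i : ℕ) : Br q r δ n := toBr q r δ n (gFree K n i)

/-- The inverse of `g_i` in `Br_n`, for `1 ≤ i < n`. -/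
noncomputable def gInv (i : ℕ) : Br q r δ n := toBr q r δ n (gInvFree q n i)

/-- The generator `e` of `Br_n`, for `2 ≤ n`. -/
noncomputable def e : Br q r δ n := toBr q r δ n (eFree K n)

variable {q r δ n}

theorem toBr_rel {x y : FreeAlgebra K (Gen n)} (h : Rel q r δ n x y) :
    toBr q r δ n x = toBr q r δ n y :=
  RingQuot.mkAlgHom_rel K h

theorem gInv_eq (i : ℕ) : gInv q r δ n i = q⁻¹ • g q r δ n i + (q⁻¹ - 1) • 1 := by
  simp [gInv, gInvFree, g, map_add, map_smul]

theorem g_sq {i : ℕ} (h1 : 1 ≤ i) (h2 : i < n) :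
    g q r δ n i * g q r δ n i = (q - 1) • g q r δ n i + q • 1 := by
  have h := toBr_rel (Rel.hecke_sq (q := q) (r := r) (δ := δ) i h1 h2)
  simpa [g, map_add, map_mul, map_smul] using h

theorem g_mul_gInv (hq : q ≠ 0) {i : ℕ} (h1 : 1 ≤ i) (h2 : i < n) :
    g q r δ n i * gInv q r δ n i = 1 := by
  rw [gInv_eq, mul_add, mul_smul_comm, mul_smul_comm, g_sq h1 h2, mul_one]
  have hc : q⁻¹ * (q - 1) + (q⁻¹ - 1) = 0 := by field_simp; ring
  rw [smul_add, smul_smul, smul_smul, inv_mul_cancel₀ hq, one_smul, add_right_comm, ← add_smul,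
    hc, zero_smul, zero_add]

theorem gInv_mul_g (hq : q ≠ 0) {i : ℕ} (h1 : 1 ≤ i) (h2 : i < n) :
    gInv q r δ n i * g q r δ n i = 1 := by
  rw [← g_mul_gInv (r := r) (δ := δ) hq h1 h2, gInv_eq]
  simp [mul_add, add_mul]

/-- The images in `Br_{n+1}` of the generators of `Br_n`. -/
noncomputable def inclGen (q r δ : K) (n : ℕ) : Gen n → Br q r δ (n + 1)
  | .g i _ => g q r δ (n + 1) i
  | .e _ => e q r δ (n + 1)

theorem lift_inclGen_g {i : ℕ} (h1 : 1 ≤ i) (h2 : i < n) :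
    FreeAlgebra.lift K (inclGen q r δ n) (gFree K n i) = toBr q r δ (n + 1) (gFree K (n + 1) i) := by
  rw [gFree, dif_pos ⟨h1, h2⟩, FreeAlgebra.lift_ι_apply]
  rfl

theorem lift_inclGen_e (h : 2 ≤ n) :
    FreeAlgebra.lift K (inclGen q r δ n) (eFree K n) = toBr q r δ (n + 1) (eFree K (n + 1)) := by
  rw [eFree, dif_pos h, FreeAlgebra.lift_ι_apply]
  rfl

theorem lift_inclGen_gInv {i : ℕ} (h1 : 1 ≤ i) (h2 : i < n) :
    FreeAlgebra.lift K (inclGen q r δ n) (gInvFree q n i) =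
      toBr q r δ (n + 1) (gInvFree q (n + 1) i) := by
  simp [gInvFree, lift_inclGen_g h1 h2]

theorem lift_inclGen_w (h : 4 ≤ n) :
    FreeAlgebra.lift K (inclGen q r δ n) (wFree q n) = toBr q r δ (n + 1) (wFree q (n + 1)) := by
  simp only [wFree, map_mul]
  rw [lift_inclGen_g (by omega) (by omega), lift_inclGen_g (by omega) (by omega),
    lift_inclGen_gInv (by omega) (by omega), lift_inclGen_gInv (by omega) (by omega)]

theorem lift_inclGen_eTwo (h : 4 ≤ n) :
    FreeAlgebra.lift K (inclGen q r δ n) (eTwoFree q n) =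
      toBr q r δ (n + 1) (eTwoFree q (n + 1)) := by
  simp only [eTwoFree, map_mul]
  rw [lift_inclGen_w h, lift_inclGen_e (by omega)]

theorem lift_inclGen_rel {x y : FreeAlgebra K (Gen n)} (h : Rel q r δ n x y) :
    FreeAlgebra.lift K (inclGen q r δ n) x = FreeAlgebra.lift K (inclGen q r δ n) y := by
  cases h with
  | hecke_sq i h1 h2 =>
    have h := toBr_rel (Rel.hecke_sq (q := q) (r := r) (δ := δ) (n := n + 1) i h1 (by omega))
    simpa [lift_inclGen_g h1 h2] using h
  | hecke_braid i h1 h2 =>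
    have h := toBr_rel (Rel.hecke_braid (q := q) (r := r) (δ := δ) (n := n + 1) i h1 (by omega))
    simpa [lift_inclGen_g h1 (by omega : i < n),
      lift_inclGen_g (by omega : 1 ≤ i + 1) h2] using h
  | hecke_comm i j h1 h2 h3 =>
    have h := toBr_rel
      (Rel.hecke_comm (q := q) (r := r) (δ := δ) (n := n + 1) i j h1 h2 (by omega))
    simpa [lift_inclGen_g h1 (by omega : i < n), lift_inclGen_g (by omega : 1 ≤ j) h3] using h
  | e_sq h =>
    have h' := toBr_rel (Rel.e_sq (q := q) (r := r) (δ := δ) (n := n + 1) (by omega))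
    simpa [lift_inclGen_e h] using h'
  | e_comm i h1 h2 =>
    have h := toBr_rel (Rel.e_comm (q := q) (r := r) (δ := δ) (n := n + 1) i h1 (by omega))
    simpa [lift_inclGen_e (by omega : 2 ≤ n), lift_inclGen_g (by omega : 1 ≤ i) h2] using h
  | e_g1 h =>
    have h' := toBr_rel (Rel.e_g1 (q := q) (r := r) (δ := δ) (n := n + 1) (by omega))
    simpa [lift_inclGen_e h, lift_inclGen_g le_rfl (by omega : 1 < n)] using h'
  | g1_e h =>
    have h' := toBr_rel (Rel.g1_e (q := q) (r := r) (δ := δ) (n := n + 1) (by omega))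
    simpa [lift_inclGen_e h, lift_inclGen_g le_rfl (by omega : 1 < n)] using h'
  | e_g2_e h =>
    have h' := toBr_rel (Rel.e_g2_e (q := q) (r := r) (δ := δ) (n := n + 1) (by omega))
    simpa [lift_inclGen_e (by omega : 2 ≤ n),
      lift_inclGen_g (by omega : 1 ≤ 2) (by omega : 2 < n)] using h'
  | e_g2Inv_e h =>
    have h' := toBr_rel (Rel.e_g2Inv_e (q := q) (r := r) (δ := δ) (n := n + 1) (by omega))
    simpa [lift_inclGen_e (by omega : 2 ≤ n),
      lift_inclGen_gInv (by omega : 1 ≤ 2) (by omega : 2 < n)] using h'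
  | w_eTwo h =>
    have h' := toBr_rel (Rel.w_eTwo (q := q) (r := r) (δ := δ) (n := n + 1) (by omega))
    simpa [lift_inclGen_w h, lift_inclGen_eTwo h] using h'
  | eTwo_w h =>
    have h' := toBr_rel (Rel.eTwo_w (q := q) (r := r) (δ := δ) (n := n + 1) (by omega))
    simpa [lift_inclGen_w h, lift_inclGen_eTwo h] using h'

/-- The standard homomorphism `Br_n → Br_{n+1}`, `g_i ↦ g_i`, `e ↦ e`. -/
noncomputable def incl (q r δ : K) (n : ℕ) : Br q r δ n →ₐ[K] Br q r δ (n + 1) :=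
  RingQuot.liftAlgHom K ⟨FreeAlgebra.lift K (inclGen q r δ n), fun _ _ h => lift_inclGen_rel h⟩

theorem incl_g {i : ℕ} (h1 : 1 ≤ i) (h2 : i < n) :
    incl q r δ n (g q r δ n i) = g q r δ (n + 1) i := by
  rw [incl, g, toBr, RingQuot.liftAlgHom_mkAlgHom_apply, lift_inclGen_g h1 h2]
  rfl

theorem incl_e (h : 2 ≤ n) : incl q r δ n (e q r δ n) = e q r δ (n + 1) := by
  rw [incl, e, toBr, RingQuot.liftAlgHom_mkAlgHom_apply, lift_inclGen_e h]
  rfl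

variable (q r δ n)

/-- The subalgebra `H_n` of `Br_n` generated by `g_1, …, g_{n-1}`. -/
noncomputable def hecke : Subalgebra K (Br q r δ n) :=
  Algebra.adjoin K {x | ∃ i, 1 ≤ i ∧ i < n ∧ x = g q r δ n i}

/-- The elements `e_(k)` of `Br_n` (used for `2 k ≤ n`): `e_(0) = 1`, `e_(1) = e` and
`e_(k+1) = e (g_2 g_3 ⋯ g_{2k+1}) (g_1⁻¹ g_2⁻¹ ⋯ g_{2k}⁻¹) e_(k)`. -/
noncomputable def ek : ℕ → Br q r δ n
  | 0 => 1
  | k + 1 =>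
      e q r δ n * ((List.range' 2 (2 * k)).map (g q r δ n)).prod *
        ((List.range' 1 (2 * k)).map (gInv q r δ n)).prod * ek k

/-- The idempotents `δ⁻ᵏ e_(k)`. -/
noncomputable def ekBar (k : ℕ) : Br q r δ n := (δ⁻¹) ^ k • ek q r δ n k

/-- The homomorphism from the free algebra on the generators of `Br_n` to `Br_{n+2k}` with
`g_i ↦ g_{i+2k}` and `e ↦ δ ē_(k+1)`. Multiplied by `ē_(k)`, it induces the isomorphism
`Br_n ≅ ē_(k) Br_{n+2k} ē_(k)` given by `g_i ↦ ē_(k) g_{i+2k}` and `δ⁻¹ e ↦ ē_(k+1)`. -/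
noncomputable def shift (k : ℕ) : FreeAlgebra K (Gen n) →ₐ[K] Br q r δ (n + 2 * k) :=
  FreeAlgebra.lift K fun
    | .g i _ => g q r δ (n + 2 * k) (i + 2 * k)
    | .e _ => δ • ekBar q r δ (n + 2 * k) (k + 1)

end Elements

/-- The Markov trace on the tower of `q`-Brauer algebras: a family of linear functionals
`tr` on `Br_n` with the trace property, which extends the Markov trace of the Hecke algebras
and satisfies `tr(a ē_(k) b) = (r q⁻¹ / δ²)ᵏ tr(Φ_k(b a))` for `a, b` in the Hecke algebra. Here
`Φ_k(h) ∈ Br_n`, for `h ∈ Br_{n+2k}`, is the element that corresponds to `ē_(k) h ē_(k)` under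
the isomorphism `Br_n ≅ ē_(k) Br_{n+2k} ē_(k)`; it is the class of any `x` with
`ē_(k) h ē_(k) = ē_(k) (shift x) ē_(k)`. -/
structure MarkovTrace {K : Type u} [Field K] (q r δ : K) where
  tr : ∀ n : ℕ, Br q r δ n →ₗ[K] K
  tr_one : ∀ n, tr n 1 = 1
  tr_comm : ∀ n (x y : Br q r δ n), tr n (x * y) = tr n (y * x)
  tr_hecke_incl : ∀ n, ∀ h ∈ hecke q r δ n, tr (n + 1) (incl q r δ n h) = tr n h
  tr_hecke_markov : ∀ n, 1 ≤ n → ∀ h ∈ hecke q r δ n,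
    tr (n + 1) (g q r δ (n + 1) n * incl q r δ n h) = r / δ * tr n h
  tr_ekBar : ∀ n k, ∀ a ∈ hecke q r δ (n + 2 * k), ∀ b ∈ hecke q r δ (n + 2 * k),
    ∀ x : FreeAlgebra K (Gen n),
      ekBar q r δ (n + 2 * k) k * (b * a) * ekBar q r δ (n + 2 * k) k =
        ekBar q r δ (n + 2 * k) k * shift q r δ n k x * ekBar q r δ (n + 2 * k) k →
      tr (n + 2 * k) (a * ekBar q r δ (n + 2 * k) k * b) =
        (r * q⁻¹ / δ ^ 2) ^ k * tr n (toBr q r δ n x)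

/-- The annihilator ideal `Ann_n = {a ∈ Br_n | tr(a b) = 0 for all b ∈ Br_n}`. -/
def MarkovTrace.ann {K : Type u} [Field K] {q r δ : K} (T : MarkovTrace q r δ) (n : ℕ) :
    Ideal (Br q r δ n) where
  carrier := {a | ∀ b, T.tr n (a * b) = 0}
  zero_mem' := fun b => by rw [zero_mul, map_zero]
  add_mem' := fun {x y} hx hy b => by rw [add_mul, map_add, hx b, hy b, add_zero]
  smul_mem' := fun c x hx b => by
    rw [smul_eq_mul, mul_assoc, T.tr_comm, mul_assoc]
    exact hx (b * c)

instance {K : Type u} [Field K] {q r δ : K} (T : MarkovTrace q r δ) (n : ℕ) :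
    (T.ann n).IsTwoSided where
  mul_mem_of_left := fun {a} c ha b => by
    rw [mul_assoc]
    exact ha (c * b)

end QBrauer

/-! The conclusion rests on a decomposition of Br_{n+1} and on a trace adapted to it. For n ≥ 1 let
A be the image of Br_n in Br_{n+1} and c_n = g_n⁻¹⋯g_2⁻¹ e g_2⋯g_n. Then Br_{n+1} is spanned by A, A
g_n A and A c_n A (`Tuple.mem_stepSpan`). A `TowerTrace` is a family of traces with tr(ι y) = tr(y),
tr(ιy g_n ιz) = (ρ/δ) tr(yz) and tr(ιy c_n ιz) = (ρξ⁻¹/δ) tr(yz). If a ∈ Ann_n, these rules make b ↦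
tr(ι(a) b) vanish on all three pieces, so ι(a) ∈ Ann_{n+1}. Conversely tr ∘ ι = tr puts the preimage
of Ann_{n+1} inside Ann_n, which is injectivity on the quotients.

A tower trace is a Markov trace. The corner of ē_(k) in Br_{n+2k} contains generators satisfying the
relations on n strands (`Tuple.corner`), and induction on k and n, checked on the three pieces,
shows that the trace there is (ρξ⁻¹/δ²)^k times the trace of Br_n (`TowerTrace.tr_ebar_mul`). The
Markov trace is unique because Br_n is spanned by the sets H_n e_(k) H_n
(`Tuple.mem_span_hecke_eprod_hecke`) and the corners are generated by the expected elements
(`Tuple.exists_eprod_brauerSub_eprod`): the third axiom reduces k ≥ 1 to fewer strands, and on H_n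
the Markov property determines the trace.

Existence of a tower trace comes from tensor space. For q = t², r = q^(N+1) and δ = 1 + q + ⋯ + q^N
the generators act on functions of sequences in N + 1 letters (`Model.tuple`), and the weighted
partial traces over one tensor factor are bimodule maps with scalar values at 1, g_n and c_n
(`Model.condExp`). Composing them gives traces. Such parameters are special, but the points (q, δ)
are Zariski dense, so the Laurent polynomials ℤ[q^±1, δ^±1] embed in the product of all models
(`genHom_injective`), and the subalgebras A_n generated there over this ring carry traces with
Laurent polynomial values (`CondExp.exists_trace`). Extending scalars to K by q ↦ ξ, δ ↦ δ and
pulling back along Br_n → K ⊗ A_n (`nonempty_towerTrace`) yields the tower trace for arbitrary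
nonzero ξ and δ. Neither a basis of Br_n nor faithfulness of the model is needed. -/

namespace QBrauer

/-! ### Ascending and descending words in braid-like generators. -/

section Words

variable {B : Type*} [Monoid B]

/-- The ascending product `x a * x (a + 1) * ⋯ * x (a + l - 1)`. -/
def up (x : ℕ → B) (a l : ℕ) : B := ((List.range' a l).map x).prod

/-- The descending product `x (a + l - 1) * ⋯ * x (a + 1) * x a`. -/
def dn (x : ℕ → B) (a : ℕ) : ℕ → B
  | 0 => 1
  | l + 1 => x (a + l) * dn x a l

@[simp] theorem up_zero (x : ℕ → B) (a : ℕ) : up x a 0 = 1 := rfl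

@[simp] theorem dn_zero (x : ℕ → B) (a : ℕ) : dn x a 0 = 1 := rfl

theorem up_succ (x : ℕ → B) (a l : ℕ) : up x a (l + 1) = x a * up x (a + 1) l := by
  simp [up, List.range'_succ]

theorem up_succ' (x : ℕ → B) (a l : ℕ) : up x a (l + 1) = up x a l * x (a + l) := by
  simp [up, List.range'_concat]

theorem dn_succ (x : ℕ → B) (a l : ℕ) : dn x a (l + 1) = x (a + l) * dn x a l := rfl

theorem dn_succ' (x : ℕ → B) (a l : ℕ) : dn x a (l + 1) = dn x (a + 1) l * x a := by
  induction l with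
  | zero => simp [dn]
  | succ l ih =>
    rw [dn_succ, ih, dn_succ, mul_assoc, show a + (l + 1) = a + 1 + l by omega]

theorem up_add (x : ℕ → B) (a l m : ℕ) : up x a (l + m) = up x a l * up x (a + l) m := by
  induction m with
  | zero => simp
  | succ m ih =>
    rw [← add_assoc, up_succ', ih, up_succ', mul_assoc, add_assoc]

theorem dn_add (x : ℕ → B) (a l m : ℕ) : dn x a (l + m) = dn x (a + l) m * dn x a l := by
  induction m with
  | zero => simp
  | succ m ih =>
    rw [← add_assoc, dn_succ, ih, dn_succ, mul_assoc, add_assoc]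

theorem commute_up {x : ℕ → B} {y : B} {a l : ℕ}
    (h : ∀ i, a ≤ i → i < a + l → Commute y (x i)) : Commute y (up x a l) := by
  induction l with
  | zero => exact Commute.one_right y
  | succ l ih =>
    rw [up_succ']
    exact (ih fun i h1 h2 => h i h1 (by omega)).mul_right (h _ (by omega) (by omega))

theorem commute_dn {x : ℕ → B} {y : B} {a l : ℕ}
    (h : ∀ i, a ≤ i → i < a + l → Commute y (x i)) : Commute y (dn x a l) := by
  induction l with
  | zero => exact Commute.one_right y
  | succ l ih =>
    rw [dn_succ]
    exact (h _ (by omega) (by omega)).mul_right (ih fun i h1 h2 => h i h1 (by omega))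

theorem up_mul_dn {x y : ℕ → B} {a l : ℕ} (h : ∀ i, a ≤ i → i < a + l → x i * y i = 1) :
    up x a l * dn y a l = 1 := by
  induction l with
  | zero => simp
  | succ l ih =>
    rw [up_succ', dn_succ, mul_assoc, ← mul_assoc (x _), h _ (by omega) (by omega), one_mul,
      ih fun i h1 h2 => h i h1 (by omega)]

theorem dn_mul_up {x y : ℕ → B} {a l : ℕ} (h : ∀ i, a ≤ i → i < a + l → y i * x i = 1) :
    dn y a l * up x a l = 1 := by
  induction l generalizing a with
  | zero => simp
  | succ l ih =>
    rw [up_succ, dn_succ', mul_assoc, ← mul_assoc (y _), h _ (by omega) (by omega), one_mul,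
      ih fun i h1 h2 => h i (by omega) (by omega)]

/-- Only the two letters `x i` and `x (i + 1)` of the word fail to commute past; splitting the word
around them reduces the claim to the local braid relation. The second family `y` allows every
mixture of generators and inverses. -/
theorem up_shift {x y : ℕ → B} {a l i : ℕ}
    (hc : ∀ j k, a ≤ j → j < a + l → a ≤ k → k < a + l → (j + 1 < k ∨ k + 1 < j) →
      Commute (x j) (y k))
    (hb : ∀ j, a ≤ j → j + 1 < a + l → x j * x (j + 1) * y j = y (j + 1) * (x j * x (j + 1)))
    (h1 : a ≤ i) (h2 : i + 1 < a + l) : up x a l * y i = y (i + 1) * up x a l := by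
  obtain ⟨p, rfl⟩ : ∃ p, i = a + p := ⟨i - a, by omega⟩
  obtain ⟨m, rfl⟩ : ∃ m, l = p + 1 + 1 + m := ⟨l - p - 2, by omega⟩
  have e1 : up x a (p + 1 + 1 + m) =
      up x a p * (x (a + p) * x (a + p + 1)) * up x (a + p + 1 + 1) m := by
    rw [up_add, up_succ', up_succ']; simp only [mul_assoc, add_assoc]
  have c1 : Commute (y (a + p)) (up x (a + p + 1 + 1) m) :=
    commute_up fun j _ _ => (hc j (a + p) (by omega) (by omega) (by omega) (by omega)
      (by omega)).symm
  have c2 : Commute (y (a + p + 1)) (up x a p) :=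
    commute_up fun j _ _ => (hc j (a + p + 1) (by omega) (by omega) (by omega) (by omega)
      (by omega)).symm
  rw [e1, mul_assoc, ← c1.eq, mul_assoc, ← mul_assoc (x (a + p) * x (a + p + 1)),
    hb _ (by omega) (by omega), ← mul_assoc, ← mul_assoc, ← mul_assoc, ← mul_assoc, ← c2.eq]
  simp only [mul_assoc]

theorem dn_shift {x y : ℕ → B} {a l i : ℕ}
    (hc : ∀ j k, a ≤ j → j < a + l → a ≤ k → k < a + l → (j + 1 < k ∨ k + 1 < j) →
      Commute (x j) (y k))
    (hb : ∀ j, a ≤ j → j + 1 < a + l → x (j + 1) * x j * y (j + 1) = y j * (x (j + 1) * x j))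
    (h1 : a ≤ i) (h2 : i + 1 < a + l) : dn x a l * y (i + 1) = y i * dn x a l := by
  obtain ⟨p, rfl⟩ : ∃ p, i = a + p := ⟨i - a, by omega⟩
  obtain ⟨m, rfl⟩ : ∃ m, l = p + 1 + 1 + m := ⟨l - p - 2, by omega⟩
  have e1 : dn x a (p + 1 + 1 + m) =
      dn x (a + p + 1 + 1) m * (x (a + p + 1) * x (a + p)) * dn x a p := by
    rw [dn_add, dn_succ, dn_succ]; simp only [mul_assoc, add_assoc]
  have c1 : Commute (y (a + p)) (dn x (a + p + 1 + 1) m) :=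
    commute_dn fun j _ _ => (hc j (a + p) (by omega) (by omega) (by omega) (by omega)
      (by omega)).symm
  have c2 : Commute (y (a + p + 1)) (dn x a p) :=
    commute_dn fun j _ _ => (hc j (a + p + 1) (by omega) (by omega) (by omega) (by omega)
      (by omega)).symm
  rw [e1, mul_assoc, ← c2.eq, mul_assoc, ← mul_assoc (x (a + p + 1) * x (a + p)),
    hb _ (by omega) (by omega), ← mul_assoc, ← mul_assoc, ← mul_assoc, ← mul_assoc, ← c1.eq]
  simp only [mul_assoc]

theorem map_up {C F : Type*} [Monoid C] [FunLike F B C] [MonoidHomClass F B C] (f : F)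
    (x : ℕ → B) (y : ℕ → C) {a l : ℕ} (h : ∀ i, a ≤ i → i < a + l → f (x i) = y i) :
    f (up x a l) = up y a l := by
  induction l with
  | zero => simp
  | succ l ih =>
    rw [up_succ', up_succ', map_mul, ih fun i h1 h2 => h i h1 (by omega),
      h _ (by omega) (by omega)]

theorem map_dn {C F : Type*} [Monoid C] [FunLike F B C] [MonoidHomClass F B C] (f : F)
    (x : ℕ → B) (y : ℕ → C) {a l : ℕ} (h : ∀ i, a ≤ i → i < a + l → f (x i) = y i) :
    f (dn x a l) = dn y a l := by
  induction l with
  | zero => simp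
  | succ l ih =>
    rw [dn_succ, dn_succ, map_mul, ih fun i h1 h2 => h i h1 (by omega),
      h _ (by omega) (by omega)]

section Inverses

variable {x x' y y' : B}

theorem braid_inv_inv_self (hx : x * x' = 1) (hx' : x' * x = 1) (hy : y * y' = 1)
    (hy' : y' * y = 1) (b : x * y * x = y * x * y) : x' * y' * x = y * (x' * y') := by
  calc x' * y' * x = x' * y' * (x * y * x) * x' * y' := by
        simp only [mul_assoc]; rw [← mul_assoc x x', hx, one_mul, hy, mul_one]
    _ = (x' * (y' * y) * x) * y * x' * y' := by rw [b]; simp only [mul_assoc]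
    _ = y * (x' * y') := by rw [hy', mul_one, hx', one_mul, mul_assoc]

theorem braid_self_self_inv (hx : x * x' = 1) (hy' : y' * y = 1)
    (b : x * y * x = y * x * y) : x * y * x' = y' * (x * y) := by
  calc x * y * x' = (y' * y) * x * y * x' := by rw [hy', one_mul]
    _ = y' * (y * x * y) * x' := by simp only [mul_assoc]
    _ = y' * (x * y) * (x * x') := by rw [← b]; simp only [mul_assoc]
    _ = y' * (x * y) := by rw [hx, mul_one]

end Inverses

end Words

end QBrauer

/-! ### The relations over a commutative ring, and the crossings `wd` of pairs of strands. -/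

namespace QBrauer

/-- Elements `g i` (for `1 ≤ i < n`) and `e` (for `2 ≤ n`) of an `R`-algebra that satisfy the
relations of the `q`-Brauer algebra on `n` strands; `h i` is the inverse of `g i`. -/
structure Tuple {R B : Type*} [CommRing R] [Ring B] [Algebra R B] (q q' r d d' : R) (n : ℕ)
    (g h : ℕ → B) (e : B) : Prop where
  qq : q * q' = 1
  dd : d * d' = 1
  dq : d * (q - 1) = r - 1
  h_eq : ∀ i, h i = q' • g i + (q' - 1) • (1 : B)
  sq : ∀ i, 1 ≤ i → i < n → g i * g i = (q - 1) • g i + q • (1 : B)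
  braid : ∀ i, 1 ≤ i → i + 1 < n → g i * g (i + 1) * g i = g (i + 1) * g i * g (i + 1)
  comm : ∀ i j, 1 ≤ i → i + 1 < j → j < n → g i * g j = g j * g i
  e_sq : 2 ≤ n → e * e = d • e
  e_comm : ∀ i, 2 < i → i < n → e * g i = g i * e
  e_g1 : 2 ≤ n → e * g 1 = q • e
  g1_e : 2 ≤ n → g 1 * e = q • e
  e_g2_e : 3 ≤ n → e * g 2 * e = r • e
  w_eTwo : 4 ≤ n → g 2 * g 3 * h 1 * h 2 * (e * (g 2 * g 3 * h 1 * h 2) * e) =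
    e * (g 2 * g 3 * h 1 * h 2) * e
  eTwo_w : 4 ≤ n → e * (g 2 * g 3 * h 1 * h 2) * e * (g 2 * g 3 * h 1 * h 2) =
    e * (g 2 * g 3 * h 1 * h 2) * e

section Elements

variable {B : Type*} [Monoid B]

/-- The elements `e₍ₖ₎` for a general tuple. -/
def eprod (g h : ℕ → B) (e : B) : ℕ → B
  | 0 => 1
  | k + 1 => e * up g 2 (2 * k) * up h 1 (2 * k) * eprod g h e k

/-- The word `g₂ g₃ g₁⁻¹ g₂⁻¹` shifted by `2 l`. -/
def wd (g h : ℕ → B) (l : ℕ) : B :=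
  g (2 * l + 2) * g (2 * l + 3) * h (2 * l + 1) * h (2 * l + 2)

end Elements

namespace Tuple

variable {R B : Type*} [CommRing R] [Ring B] [Algebra R B] {q q' r d d' : R} {n : ℕ}
  {g h : ℕ → B} {e : B}

variable (T : Tuple q q' r d d' n g h e)
include T

theorem gh {i : ℕ} (h1 : 1 ≤ i) (h2 : i < n) : g i * h i = 1 := by
  have hc : q' * (q - 1) + (q' - 1) = 0 := by linear_combination T.qq
  rw [T.h_eq, mul_add, mul_smul_comm, mul_smul_comm, T.sq i h1 h2, mul_one, smul_add, smul_smul,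
    smul_smul, mul_comm q' q, T.qq, one_smul, add_right_comm, ← add_smul, hc, zero_smul, zero_add]

theorem hg {i : ℕ} (h1 : 1 ≤ i) (h2 : i < n) : h i * g i = 1 := by
  rw [← T.gh h1 h2, T.h_eq]
  simp [mul_add, add_mul]

theorem g_eq (i : ℕ) : g i = q • h i + (q - 1) • (1 : B) := by
  rw [T.h_eq, smul_add, smul_smul, smul_smul, T.qq, one_smul, add_assoc, ← add_smul,
    show q * (q' - 1) + (q - 1) = 0 by linear_combination T.qq, zero_smul, add_zero]

theorem commute_h {x : B} {i : ℕ} (hx : Commute x (g i)) : Commute x (h i) := by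
  rw [T.h_eq]
  exact (hx.smul_right _).add_right ((Commute.one_right x).smul_right _)

theorem cgg {i j : ℕ} (h1 : 1 ≤ i) (h2 : i < n) (h3 : 1 ≤ j) (h4 : j < n)
    (hij : i + 1 < j ∨ j + 1 < i) : Commute (g i) (g j) := by
  rcases hij with hij | hij
  · exact T.comm i j h1 hij h4
  · exact (T.comm j i h3 hij h2).symm

theorem cgh {i j : ℕ} (h1 : 1 ≤ i) (h2 : i < n) (h3 : 1 ≤ j) (h4 : j < n)
    (hij : i + 1 < j ∨ j + 1 < i) : Commute (g i) (h j) :=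
  T.commute_h (T.cgg h1 h2 h3 h4 hij)

theorem chg {i j : ℕ} (h1 : 1 ≤ i) (h2 : i < n) (h3 : 1 ≤ j) (h4 : j < n)
    (hij : i + 1 < j ∨ j + 1 < i) : Commute (h i) (g j) :=
  (T.cgh h3 h4 h1 h2 hij.symm).symm

theorem chh {i j : ℕ} (h1 : 1 ≤ i) (h2 : i < n) (h3 : 1 ≤ j) (h4 : j < n)
    (hij : i + 1 < j ∨ j + 1 < i) : Commute (h i) (h j) :=
  T.commute_h (T.chg h1 h2 h3 h4 hij)

theorem ceg {i : ℕ} (h1 : 3 ≤ i) (h2 : i < n) : Commute e (g i) := T.e_comm i h1 h2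

theorem ceh {i : ℕ} (h1 : 3 ≤ i) (h2 : i < n) : Commute e (h i) := T.commute_h (T.ceg h1 h2)

theorem hhg {i : ℕ} (h1 : 1 ≤ i) (h2 : i + 1 < n) :
    h i * h (i + 1) * g i = g (i + 1) * (h i * h (i + 1)) :=
  braid_inv_inv_self (T.gh h1 (by omega)) (T.hg h1 (by omega)) (T.gh (by omega) h2)
    (T.hg (by omega) h2) (T.braid i h1 h2)

theorem hhg' {i : ℕ} (h1 : 1 ≤ i) (h2 : i + 1 < n) :
    h (i + 1) * h i * g (i + 1) = g i * (h (i + 1) * h i) :=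
  braid_inv_inv_self (T.gh (by omega) h2) (T.hg (by omega) h2) (T.gh h1 (by omega))
    (T.hg h1 (by omega)) (T.braid i h1 h2).symm

theorem ggh {i : ℕ} (h1 : 1 ≤ i) (h2 : i + 1 < n) :
    g i * g (i + 1) * h i = h (i + 1) * (g i * g (i + 1)) :=
  braid_self_self_inv (T.gh h1 (by omega)) (T.hg (by omega) h2) (T.braid i h1 h2)

theorem ggg {i : ℕ} (h1 : 1 ≤ i) (h2 : i + 1 < n) :
    g i * g (i + 1) * g i = g (i + 1) * (g i * g (i + 1)) := by
  rw [T.braid i h1 h2, mul_assoc]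

theorem up_g_g {a l i : ℕ} (ha : 1 ≤ a) (hl : a + l ≤ n) (h1 : a ≤ i) (h2 : i + 1 < a + l) :
    up g a l * g i = g (i + 1) * up g a l :=
  up_shift (fun _ _ _ _ _ _ hjk => T.cgg (by omega) (by omega) (by omega) (by omega) hjk)
    (fun _ _ _ => T.ggg (by omega) (by omega)) h1 h2

theorem up_h_g {a l i : ℕ} (ha : 1 ≤ a) (hl : a + l ≤ n) (h1 : a ≤ i) (h2 : i + 1 < a + l) :
    up h a l * g i = g (i + 1) * up h a l :=
  up_shift (fun _ _ _ _ _ _ hjk => T.chg (by omega) (by omega) (by omega) (by omega) hjk)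
    (fun _ _ _ => T.hhg (by omega) (by omega)) h1 h2

theorem dn_h_g {a l i : ℕ} (ha : 1 ≤ a) (hl : a + l ≤ n) (h1 : a ≤ i) (h2 : i + 1 < a + l) :
    dn h a l * g (i + 1) = g i * dn h a l :=
  dn_shift (fun _ _ _ _ _ _ hjk => T.chg (by omega) (by omega) (by omega) (by omega) hjk)
    (fun _ _ _ => T.hhg' (by omega) (by omega)) h1 h2

/-- This defining relation is not a field of `Tuple` because it follows from the one for `g 2`: the
scalar is q⁻¹r + (q⁻¹ - 1)δ, and δ(q - 1) = r - 1 turns it into q⁻¹. -/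
theorem e_h2_e (hn : 3 ≤ n) : e * h 2 * e = q' • e := by
  rw [T.h_eq, mul_add, add_mul, mul_smul_comm, mul_smul_comm, mul_one, smul_mul_assoc,
    smul_mul_assoc, T.e_g2_e hn, T.e_sq (by omega), smul_smul, smul_smul, ← add_smul]
  congr 1
  linear_combination (-q') * T.dq + d * T.qq

/-- The product `g₂ ⋯ g_{2k+1} g₁⁻¹ ⋯ g_{2k}⁻¹` is the product of the first `k` words `wd`. -/
theorem up_up_succ {k : ℕ} (hk : 2 * k + 3 < n) :
    up g 2 (2 * (k + 1)) * up h 1 (2 * (k + 1)) =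
      up g 2 (2 * k) * up h 1 (2 * k) * wd g h k := by
  have c1 : Commute (g (2 * k + 2)) (up h 1 (2 * k)) := commute_up fun j _ _ =>
    T.cgh (by omega) (by omega) (by omega) (by omega) (by omega)
  have c2 : Commute (g (2 * k + 3)) (up h 1 (2 * k)) := commute_up fun j _ _ =>
    T.cgh (by omega) (by omega) (by omega) (by omega) (by omega)
  rw [show 2 * (k + 1) = 2 * k + 1 + 1 by ring, up_succ', up_succ', up_succ', up_succ',
    show 2 + 2 * k = 2 * k + 2 by ring, show 2 + (2 * k + 1) = 2 * k + 3 by ring,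
    show 1 + 2 * k = 2 * k + 1 by ring, show 1 + (2 * k + 1) = 2 * k + 2 by ring, wd]
  calc _ = up g 2 (2 * k) * (g (2 * k + 2) * (g (2 * k + 3) * up h 1 (2 * k)))
        * h (2 * k + 1) * h (2 * k + 2) := by simp only [mul_assoc]
    _ = _ := by rw [c2.eq, ← mul_assoc (g (2 * k + 2)), c1.eq]; simp only [mul_assoc]

/-- Each of the two ascending words raises the index by one, so their product translates by one pair
of strands. -/
theorem up_up_g {k i : ℕ} (hk : 2 * k + 1 < n) (h1 : 1 ≤ i) (h2 : i + 1 ≤ 2 * k) :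
    up g 2 (2 * k) * up h 1 (2 * k) * g i = g (i + 2) * (up g 2 (2 * k) * up h 1 (2 * k)) := by
  rw [mul_assoc, T.up_h_g le_rfl (by omega) h1 (by omega), ← mul_assoc,
    T.up_g_g (by omega) (by omega) (by omega) (by omega), mul_assoc]

theorem up_up_h {k i : ℕ} (hk : 2 * k + 1 < n) (h1 : 1 ≤ i) (h2 : i + 1 ≤ 2 * k) :
    up g 2 (2 * k) * up h 1 (2 * k) * h i = h (i + 2) * (up g 2 (2 * k) * up h 1 (2 * k)) := by
  rw [T.h_eq, T.h_eq, mul_add, add_mul, mul_smul_comm, mul_smul_comm, smul_mul_assoc,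
    smul_mul_assoc, T.up_up_g hk h1 h2, mul_one, one_mul]

theorem up_up_wd {k l : ℕ} (hk : 2 * k + 1 < n) (hl : l + 1 < k) :
    up g 2 (2 * k) * up h 1 (2 * k) * wd g h l =
      wd g h (l + 1) * (up g 2 (2 * k) * up h 1 (2 * k)) := by
  generalize hG : up g 2 (2 * k) * up h 1 (2 * k) = G
  have hg := fun i h1 h2 => hG ▸ T.up_up_g (i := i) hk h1 h2
  have hh := fun i h1 h2 => hG ▸ T.up_up_h (i := i) hk h1 h2
  simp only [wd, ← mul_assoc]
  rw [hg _ (by omega) (by omega), mul_assoc (g _) G, hg _ (by omega) (by omega),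
    mul_assoc _ (_ * G), mul_assoc _ G, hh _ (by omega) (by omega),
    mul_assoc (g _), mul_assoc (g _), mul_assoc _ G, hh _ (by omega) (by omega)]
  rw [show 2 * (l + 1) + 2 = 2 * l + 2 + 2 by ring, show 2 * (l + 1) + 3 = 2 * l + 3 + 2 by ring,
    show 2 * (l + 1) + 1 = 2 * l + 1 + 2 by ring]
  simp only [mul_assoc]

/-- The inverse of `wd l`. -/
theorem wd_mul_inv {l : ℕ} (hl : 2 * l + 3 < n) :
    wd g h l * (g (2 * l + 2) * g (2 * l + 1) * h (2 * l + 3) * h (2 * l + 2)) = 1 := by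
  have c := T.cgh (i := 2 * l + 1) (j := 2 * l + 3) (by omega) (by omega) (by omega) (by omega)
    (by omega)
  simp only [wd, mul_assoc]
  rw [← mul_assoc (h (2 * l + 2)) (g (2 * l + 2)), T.hg (by omega) (by omega), one_mul,
    ← mul_assoc (h (2 * l + 1)), T.hg (by omega) (by omega), one_mul,
    ← mul_assoc (g (2 * l + 3)), T.gh (by omega) (by omega), one_mul, T.gh (by omega) (by omega)]

theorem commute_wd {x : B} {l : ℕ} (h1 : Commute x (g (2 * l + 1)))
    (h2 : Commute x (g (2 * l + 2))) (h3 : Commute x (g (2 * l + 3))) :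
    Commute x (wd g h l) :=
  ((h2.mul_right h3).mul_right (T.commute_h h1)).mul_right (T.commute_h h2)

/-- Write G_k for the word with `k` crossings, so G_{l+2} = G_l w_l w_{l+1}. Translation gives
G_{l+2} w_l = w_{l+1} G_{l+2}. Since w_{l+1} commutes with G_l, cancelling the invertible G_l leaves
the braid relation. -/
theorem wd_braid {l : ℕ} (hl : 2 * l + 5 < n) :
    wd g h l * wd g h (l + 1) * wd g h l = wd g h (l + 1) * wd g h l * wd g h (l + 1) := by
  have hw : ∀ k, 2 * k + 1 < n → ∀ x y : B,
      up g 2 (2 * k) * up h 1 (2 * k) * x = up g 2 (2 * k) * up h 1 (2 * k) * y → x = y := by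
    intro k hk x y hxy
    have e1 : dn g 1 (2 * k) * dn h 2 (2 * k) * (up g 2 (2 * k) * up h 1 (2 * k)) = 1 := by
      rw [mul_assoc, ← mul_assoc (dn h _ _), dn_mul_up fun i _ _ => T.hg (by omega) (by omega),
        one_mul, dn_mul_up fun i _ _ => T.gh (by omega) (by omega)]
    have e2 := congrArg (fun z => dn g 1 (2 * k) * dn h 2 (2 * k) * z) hxy
    simp only [← mul_assoc] at e1 e2
    rwa [e1, one_mul, one_mul] at e2
  have c : Commute (up g 2 (2 * l) * up h 1 (2 * l)) (wd g h (l + 1)) :=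
    T.commute_wd
      (Commute.mul_left
        (commute_up fun i _ _ => T.cgg (by omega) (by omega) (by omega) (by omega) (by omega)).symm
        (commute_up fun i _ _ => T.cgh (by omega) (by omega) (by omega) (by omega) (by omega)).symm)
      (Commute.mul_left
        (commute_up fun i _ _ => T.cgg (by omega) (by omega) (by omega) (by omega) (by omega)).symm
        (commute_up fun i _ _ => T.cgh (by omega) (by omega) (by omega) (by omega) (by omega)).symm)
      (Commute.mul_left
        (commute_up fun i _ _ => T.cgg (by omega) (by omega) (by omega) (by omega) (by omega)).symm
        (commute_up fun i _ _ => T.cgh (by omega) (by omega) (by omega) (by omega) (by omega)).symm)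
  apply hw l (by omega)
  have e2 := T.up_up_wd (k := l + 2) (l := l) (by omega) (by omega)
  rw [T.up_up_succ (k := l + 1) (by omega), T.up_up_succ (k := l) (by omega)] at e2
  calc _ = up g 2 (2 * l) * up h 1 (2 * l) * wd g h l * wd g h (l + 1) * wd g h l := by
        simp only [mul_assoc]
    _ = _ := by rw [e2]; simp only [← mul_assoc]; rw [mul_assoc (wd g h (l + 1)), ← c.eq]

end Tuple

end QBrauer

/-! ### Products and absorption rules for the elements e_(k). -/

namespace QBrauer

namespace Tuple

variable {R B : Type*} [CommRing R] [Ring B] [Algebra R B] {q q' r d d' : R} {n : ℕ}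
  {g h : ℕ → B} {e : B}

variable (T : Tuple q q' r d d' n g h e)
include T

theorem d_smul_cancel {x y : B} (hxy : d • x = d • y) : x = y := by
  rw [← one_smul R x, ← one_smul R y, ← T.dd, mul_comm, mul_smul, hxy, mul_smul]

theorem pow_d_smul_cancel (k : ℕ) {x y : B} (hxy : d ^ k • x = d ^ k • y) : x = y := by
  induction k with
  | zero => simpa using hxy
  | succ k ih =>
    rw [pow_succ', mul_smul, mul_smul] at hxy
    exact ih (T.d_smul_cancel hxy)

theorem eprod_succ (k : ℕ) : eprod g h e (k + 1) =
    e * (up g 2 (2 * k) * up h 1 (2 * k)) * eprod g h e k := by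
  rw [eprod, mul_assoc e]

omit T in
theorem eprod_one : eprod g h e 1 = e := by simp [eprod]

theorem commute_eprod {x : B} {k : ℕ} (he : 1 ≤ k → Commute x e)
    (hx : ∀ i, 1 ≤ i → i < 2 * k → Commute x (g i)) : Commute x (eprod g h e k) := by
  induction k with
  | zero => exact Commute.one_right x
  | succ k ih =>
    rw [T.eprod_succ]
    exact (((he (by omega)).mul_right (Commute.mul_right
      (commute_up fun i _ _ => hx i (by omega) (by omega))
      (commute_up fun i _ _ => T.commute_h (hx i (by omega) (by omega)))))).mul_right
      (ih (fun _ => he (by omega)) fun i h1 h2 => hx i h1 (by omega))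

theorem commute_eprod_g {k i : ℕ} (h1 : 2 * k < i) (h2 : i < n) :
    Commute (eprod g h e k) (g i) :=
  (T.commute_eprod (fun hk => (T.ceg (by omega) h2).symm)
    fun j _ _ => T.cgg (by omega) h2 (by omega) (by omega) (by omega)).symm

theorem commute_eprod_h {k i : ℕ} (h1 : 2 * k < i) (h2 : i < n) :
    Commute (eprod g h e k) (h i) := T.commute_h (T.commute_eprod_g h1 h2)

theorem commute_eprod_wd {k l : ℕ} (h1 : k ≤ l) (h2 : 2 * l + 3 < n) :
    Commute (eprod g h e k) (wd g h l) :=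
  T.commute_wd (T.commute_eprod_g (by omega) (by omega)) (T.commute_eprod_g (by omega) (by omega))
    (T.commute_eprod_g (by omega) (by omega))

theorem e_eprod {k : ℕ} (h1 : 1 ≤ k) (h2 : 2 * k ≤ n) :
    e * eprod g h e k = d • eprod g h e k := by
  obtain ⟨k, rfl⟩ : ∃ m, k = m + 1 := ⟨k - 1, by omega⟩
  rw [T.eprod_succ, mul_assoc, ← mul_assoc, T.e_sq (by omega), smul_mul_assoc]

/-- For `l > 0` the generator commutes with the leading `e`, and the word then lowers its index by
two, so that it meets e_(k-1). The case `l = 0` is the relation g_1 e = q e. -/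
theorem g_eprod {k l : ℕ} (h1 : l < k) (h2 : 2 * k ≤ n) :
    g (2 * l + 1) * eprod g h e k = q • eprod g h e k := by
  induction k generalizing l with
  | zero => omega
  | succ k ih =>
    rw [T.eprod_succ]
    cases l with
    | zero =>
      rw [mul_zero, zero_add, mul_assoc, ← mul_assoc, T.g1_e (by omega), smul_mul_assoc]
    | succ m =>
      rw [← mul_assoc, ← mul_assoc, ← (T.ceg (by omega) (by omega)).eq, mul_assoc e,
        show 2 * (m + 1) + 1 = 2 * m + 1 + 2 by ring, ← T.up_up_g (by omega) (by omega) (by omega),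
        mul_assoc, mul_assoc, ih (by omega) (by omega)]
      simp only [mul_smul_comm, mul_assoc]

/-- The witness is w_1 ⋯ w_{k-1}, whose letters all have index at least 3. -/
theorem exists_up_up_eq {k : ℕ} (h1 : 1 ≤ k) (h2 : 2 * k + 1 < n) :
    ∃ x, up g 2 (2 * k) * up h 1 (2 * k) = wd g h 0 * x ∧ Commute e x := by
  induction k, h1 using Nat.le_induction with
  | base =>
    refine ⟨1, ?_, Commute.one_right e⟩
    have := T.up_up_succ (k := 0) (by omega)
    simpa using this
  | succ k hk ih =>
    obtain ⟨x, hx, hc⟩ := ih (by omega)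
    refine ⟨x * wd g h k, ?_, hc.mul_right (T.commute_wd (T.ceg (by omega) (by omega))
      (T.ceg (by omega) (by omega)) (T.ceg (by omega) (by omega)))⟩
    rw [T.up_up_succ (by omega), hx, mul_assoc]

/-- For `l = 0`, doubling an `e` (at the cost of a factor `d`) exposes e w_0 e = e_(2) inside e_(k),
and the relation w_0 e_(2) = e_(2) applies. Larger `l` are translated down to e_(k-1). -/
theorem wd_eprod {k l : ℕ} (h1 : l + 1 < k) (h2 : 2 * k ≤ n) :
    wd g h l * eprod g h e k = eprod g h e k := by
  induction k generalizing l with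
  | zero => omega
  | succ k ih =>
    rw [T.eprod_succ]
    cases l with
    | zero =>
      obtain ⟨x, hx, hc⟩ := T.exists_up_up_eq (k := k) (by omega) (by omega)
      have key : wd g h 0 * e * wd g h 0 * e = e * wd g h 0 * e := by
        have := T.w_eTwo (by omega)
        simpa only [wd, mul_zero, zero_add, mul_assoc] using this
      apply T.d_smul_cancel
      rw [← mul_smul_comm, ← mul_smul_comm, ← T.e_eprod (by omega) (by omega), hx]
      calc _ = wd g h 0 * e * wd g h 0 * (x * e) * eprod g h e k := by simp only [mul_assoc]
        _ = wd g h 0 * e * wd g h 0 * e * x * eprod g h e k := by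
          rw [← hc.eq]; simp only [mul_assoc]
        _ = e * wd g h 0 * (e * x) * eprod g h e k := by rw [key]; simp only [mul_assoc]
        _ = _ := by rw [hc.eq]; simp only [mul_assoc]
    | succ m =>
      have hc : Commute e (wd g h (m + 1)) := T.commute_wd (T.ceg (by omega) (by omega))
        (T.ceg (by omega) (by omega)) (T.ceg (by omega) (by omega))
      rw [← mul_assoc, ← mul_assoc, ← hc.eq, mul_assoc e, ← T.up_up_wd (by omega) (by omega),
        mul_assoc, mul_assoc, ih (by omega) (by omega)]
      simp only [mul_assoc]

theorem up_up_eprod {j k : ℕ} (h1 : j < k) (h2 : 2 * k ≤ n) :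
    up g 2 (2 * j) * up h 1 (2 * j) * eprod g h e k = eprod g h e k := by
  induction j with
  | zero => simp
  | succ j ih =>
    rw [T.up_up_succ (by omega), mul_assoc, T.wd_eprod h1 h2, ih (by omega)]

/-- Each stage of the recursion for e_(j) contributes crossings, which e_(k) absorbs, and one `e`,
which contributes `d`. -/
theorem eprod_mul_eprod {j k : ℕ} (h1 : j ≤ k) (h2 : 2 * k ≤ n) :
    eprod g h e j * eprod g h e k = d ^ j • eprod g h e k := by
  induction j with
  | zero => simp [eprod]
  | succ j ih =>
    rw [T.eprod_succ, mul_assoc, ih (by omega), mul_smul_comm, mul_assoc,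
      T.up_up_eprod (by omega) h2, T.e_eprod (by omega) h2, smul_smul, pow_succ]

theorem eprod_mul_eprod' {j k : ℕ} (h1 : j ≤ k) (h2 : 2 * k ≤ n) :
    eprod g h e k * eprod g h e j = d ^ j • eprod g h e k := by
  induction k generalizing j with
  | zero =>
    obtain rfl : j = 0 := by omega
    simp [eprod]
  | succ k ih =>
    rcases Nat.lt_or_ge k j with hj | hj
    · obtain rfl : j = k + 1 := by omega
      exact T.eprod_mul_eprod le_rfl h2
    · rw [T.eprod_succ, mul_assoc, ih hj (by omega), mul_smul_comm]

/-- Unfolding the left factor once leaves an inner e_(k), which commutes with w_k and is absorbed by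
the right factor. This gives a form of e_(k+2) that is symmetric in left and right. -/
theorem eprod_wd_eprod {k : ℕ} (hk : 2 * k + 3 < n) :
    eprod g h e (k + 1) * wd g h k * eprod g h e (k + 1) = d ^ k • eprod g h e (k + 2) := by
  nth_rewrite 1 [T.eprod_succ]
  rw [T.eprod_succ (k + 1), T.up_up_succ hk, mul_assoc _ (eprod g h e k),
    (T.commute_eprod_wd le_rfl hk).eq]
  calc _ = e * (up g 2 (2 * k) * up h 1 (2 * k)) * wd g h k *
        (eprod g h e k * eprod g h e (k + 1)) := by simp only [mul_assoc]
    _ = _ := by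
      rw [T.eprod_mul_eprod (by omega) (by omega), mul_smul_comm]; simp only [mul_assoc]

/-- The recursion builds e_(k) from the left, so this is not the mirror image of `wd_eprod`. In the
top case e_(k) is written, up to powers of `d`, as E₂W₂(E₁W₁E₁). Then E₁ commutes with W₂, the braid
relation changes W₂W₁W₂ into W₁W₂W₁, and E₂ absorbs the new leading W₁ by induction. -/
theorem eprod_wd {k l : ℕ} (h1 : l + 1 < k) (h2 : 2 * k ≤ n) :
    eprod g h e k * wd g h l = eprod g h e k := by
  induction k generalizing l with
  | zero => omega
  | succ k ih =>
    rcases Nat.lt_or_ge (l + 1) k with hl | hl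
    · rw [T.eprod_succ, mul_assoc, ih hl (by omega)]
    obtain rfl : k = l + 1 := by omega
    cases l with
    | zero =>
      have := T.eTwo_w (by omega)
      rw [T.eprod_succ, T.up_up_succ (by omega), eprod_one]
      simpa [wd] using this
    | succ m =>
      apply T.pow_d_smul_cancel (m + 1)
      rw [← smul_mul_assoc, ← T.eprod_wd_eprod (by omega)]
      apply T.pow_d_smul_cancel m
      have hf := T.eprod_wd_eprod (k := m) (by omega)
      rw [← smul_mul_assoc, ← mul_smul_comm, ← hf]
      have hc := T.commute_eprod_wd (k := m + 1) (l := m + 1) le_rfl (by omega)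
      have hd := T.eprod_mul_eprod' (j := m + 1) (k := m + 2) (by omega) (by omega)
      have hw := ih (l := m) (by omega) (by omega)
      have hb := T.wd_braid (l := m) (by omega)
      generalize hE2 : eprod g h e (m + 1 + 1) = E2 at *
      generalize hE1 : eprod g h e (m + 1) = E1 at *
      generalize hW2 : wd g h (m + 1) = W2 at *
      generalize hW1 : wd g h m = W1 at *
      calc E2 * W2 * (E1 * W1 * E1) * W2 = E2 * (W2 * E1) * W1 * (E1 * W2) := by
            simp only [mul_assoc]
        _ = E2 * (E1 * W2) * W1 * (W2 * E1) := by rw [hc.eq]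
        _ = E2 * E1 * (W2 * W1 * W2) * E1 := by simp only [mul_assoc]
        _ = d ^ (m + 1) • (E2 * W1) * (W2 * W1 * E1) := by
          rw [← hb, hd]; simp only [mul_assoc, smul_mul_assoc]
        _ = (E2 * E1) * W2 * W1 * E1 := by
          rw [hw, hd]; simp only [mul_assoc]
        _ = _ := by rw [mul_assoc E2, hc.eq]; simp only [mul_assoc]

theorem wd_g {l : ℕ} (hl : 2 * l + 3 < n) :
    wd g h l * g (2 * l + 1) = g (2 * l + 3) * wd g h l := by
  have e1 : wd g h l = up g (2 * l + 2) 2 * up h (2 * l + 1) 2 := by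
    simp [up_succ, wd, mul_assoc]
  rw [e1, mul_assoc, T.up_h_g (by omega) (by omega) le_rfl (by omega), ← mul_assoc,
    T.up_g_g (by omega) (by omega) (by omega) (by omega), mul_assoc]

/-- The top index is reached by conjugation: the crossing w_m carries g_{2m+1} to g_{2m+3}, and
e_(k) absorbs w_m and its inverse on the right. -/
theorem eprod_g {k l : ℕ} (h1 : l < k) (h2 : 2 * k ≤ n) :
    eprod g h e k * g (2 * l + 1) = q • eprod g h e k := by
  induction k generalizing l with
  | zero => omega
  | succ k ih =>
    rcases Nat.lt_or_ge l k with hl | hl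
    · rw [T.eprod_succ, mul_assoc, ih hl (by omega), mul_smul_comm]
    obtain rfl : l = k := by omega
    cases l with
    | zero =>
      rw [eprod_one]
      exact T.e_g1 (by omega)
    | succ m =>
      have hg : eprod g h e (m + 1 + 1) * g (2 * m + 1) = q • eprod g h e (m + 1 + 1) := by
        rw [T.eprod_succ, mul_assoc, ih (by omega) (by omega), mul_smul_comm]
      have hw := T.eprod_wd (k := m + 1 + 1) (l := m) (by omega) h2
      rw [← hw, show 2 * (m + 1) + 1 = 2 * m + 3 by ring]
      have hi := T.wd_mul_inv (l := m) (by omega)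
      generalize g (2 * m + 2) * g (2 * m + 1) * h (2 * m + 3) * h (2 * m + 2) = v at hi
      have hv : eprod g h e (m + 1 + 1) * v = eprod g h e (m + 1 + 1) := by
        nth_rewrite 1 [← hw]
        rw [mul_assoc, hi, mul_one]
      have h3 := congrArg (fun z => eprod g h e (m + 1 + 1) * z * v) (T.wd_g (l := m) (by omega))
      simp only [← mul_assoc] at h3
      rw [hw, hg, mul_assoc _ (wd g h m), hi, mul_one, smul_mul_assoc, hv] at h3
      rw [hw, ← h3]

theorem h_eprod {k l : ℕ} (h1 : l < k) (h2 : 2 * k ≤ n) :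
    h (2 * l + 1) * eprod g h e k = q' • eprod g h e k := by
  rw [T.h_eq, add_mul, smul_mul_assoc, smul_mul_assoc, T.g_eprod h1 h2, one_mul, smul_smul,
    ← add_smul]
  congr 1; linear_combination T.qq

theorem eprod_h {k l : ℕ} (h1 : l < k) (h2 : 2 * k ≤ n) :
    eprod g h e k * h (2 * l + 1) = q' • eprod g h e k := by
  rw [T.h_eq, mul_add, mul_smul_comm, mul_smul_comm, T.eprod_g h1 h2, mul_one, smul_smul,
    ← add_smul]
  congr 1; linear_combination T.qq

theorem up_g_h {a l i : ℕ} (ha : 1 ≤ a) (hl : a + l ≤ n) (h1 : a ≤ i) (h2 : i + 1 < a + l) :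
    up g a l * h i = h (i + 1) * up g a l :=
  up_shift (fun _ _ _ _ _ _ hjk => T.cgh (by omega) (by omega) (by omega) (by omega) hjk)
    (fun _ _ _ => T.ggh (by omega) (by omega)) h1 h2

theorem up_mul_dn_shift {a m l : ℕ} (ha : 1 ≤ a) (hm : a + m < n) (hl : l ≤ m) :
    up g a (m + 1) * dn h a l = dn h (a + 1) l * up g a (m + 1) := by
  induction l with
  | zero => simp
  | succ l ih =>
    rw [dn_succ, dn_succ, ← mul_assoc, T.up_g_h ha (by omega) (by omega) (by omega), mul_assoc,
      ih (by omega), show a + 1 + l = a + l + 1 by ring, mul_assoc]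

/-- Since e_(k+1) absorbs the word of crossings and its inverse, g_{2k+2} can be replaced by a
conjugate whose only letter not commuting with `e` is g_2; then e g_2 e = r e finishes. -/
theorem eprod_g_eprod {k : ℕ} (hk : 2 * k + 2 < n) :
    eprod g h e (k + 1) * g (2 * k + 2) * eprod g h e (k + 1) =
      (r * d ^ k) • eprod g h e (k + 1) := by
  have hG := T.up_up_eprod (j := k) (k := k + 1) (by omega) (by omega)
  set E := eprod g h e (k + 1) with hE
  have hinv : dn g 1 (2 * k) * dn h 2 (2 * k) * E = E := by
    nth_rewrite 1 [← hG]
    rw [mul_assoc, mul_assoc (up g _ _), ← mul_assoc (dn h _ _),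
      dn_mul_up fun i _ _ => T.hg (by omega) (by omega), one_mul, ← mul_assoc,
      dn_mul_up fun i _ _ => T.gh (by omega) (by omega), one_mul]
  have hc1 : Commute (g (2 * k + 2)) (dn g 1 (2 * k)) := commute_dn fun i _ _ =>
    T.cgg (by omega) (by omega) (by omega) (by omega) (by omega)
  have hc2 : Commute e (dn h 3 (2 * k)) := commute_dn fun i _ _ => T.ceh (by omega) (by omega)
  have hc3 : Commute e (up g 3 (2 * k)) := commute_up fun i _ _ => T.ceg (by omega) (by omega)
  have hconj : up g 2 (2 * k) * up h 1 (2 * k) * g (2 * k + 2) * E =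
      dn h 3 (2 * k) * (g 2 * up g 3 (2 * k)) * E := by
    nth_rewrite 1 [← hinv]
    calc _ = up g 2 (2 * k) * up h 1 (2 * k) * (g (2 * k + 2) * dn g 1 (2 * k)) *
          dn h 2 (2 * k) * E := by simp only [mul_assoc]
      _ = up g 2 (2 * k) * (up h 1 (2 * k) * dn g 1 (2 * k)) * g (2 * k + 2) *
          dn h 2 (2 * k) * E := by rw [hc1.eq]; simp only [mul_assoc]
      _ = up g 2 (2 * k + 1) * dn h 2 (2 * k) * E := by
        rw [up_mul_dn fun i _ _ => T.hg (by omega) (by omega), mul_one, up_succ',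
          show 2 + 2 * k = 2 * k + 2 by ring]
      _ = _ := by rw [T.up_mul_dn_shift (by omega) (by omega) le_rfl, up_succ]
  have he := T.e_eprod (k := k + 1) (by omega) (by omega)
  rw [← hE] at he
  nth_rewrite 1 [hE, T.eprod_succ]
  have e1 : e * (up g 2 (2 * k) * up h 1 (2 * k)) * eprod g h e k * g (2 * k + 2) * E =
      (r * d ^ k) • E ↔ e * (up g 2 (2 * k) * up h 1 (2 * k) * g (2 * k + 2) * (d ^ k • E)) =
      (r * d ^ k) • E := by
    rw [mul_assoc _ (eprod g h e k), (T.commute_eprod_g (by omega) (by omega)).eq,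
      ← T.eprod_mul_eprod (j := k) (k := k + 1) (by omega) (by omega)]
    simp only [mul_assoc, ← hE]
  rw [e1, mul_smul_comm, hconj, mul_smul_comm, mul_comm r, mul_smul]
  congr 1
  apply T.d_smul_cancel
  rw [← mul_smul_comm, ← mul_smul_comm, ← he]
  calc _ = (e * dn h 3 (2 * k)) * g 2 * (up g 3 (2 * k) * e) * E := by simp only [mul_assoc]
    _ = dn h 3 (2 * k) * (e * g 2 * e) * up g 3 (2 * k) * E := by
      rw [hc2.eq, ← hc3.eq]; simp only [mul_assoc]
    _ = r • (dn h 3 (2 * k) * (e * up g 3 (2 * k)) * E) := by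
      rw [T.e_g2_e (by omega)]; simp only [mul_assoc, mul_smul_comm, smul_mul_assoc]
    _ = r • ((dn h 3 (2 * k) * up g 3 (2 * k)) * (e * E)) := by
      rw [hc3.eq]; simp only [mul_assoc]
    _ = _ := by
      rw [dn_mul_up fun i _ _ => T.hg (by omega) (by omega), one_mul, he, smul_comm]

theorem eprod_h_eprod {k : ℕ} (hk : 2 * k + 2 < n) :
    eprod g h e (k + 1) * h (2 * k + 2) * eprod g h e (k + 1) =
      (q' * d ^ k) • eprod g h e (k + 1) := by
  rw [T.h_eq, mul_add, add_mul, mul_smul_comm, mul_smul_comm, mul_one, smul_mul_assoc,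
    smul_mul_assoc, T.eprod_g_eprod hk, T.eprod_mul_eprod le_rfl (by omega), smul_smul, smul_smul,
    ← add_smul]
  congr 1
  linear_combination (-q' * d ^ k) * T.dq + d * d ^ k * T.qq

end Tuple

end QBrauer

/-! ### Span bookkeeping, the relevant subalgebras and Hecke coset decompositions. -/

namespace QBrauer

section Span

variable {R B : Type*} [CommRing R] [Ring B] [Algebra R B]

theorem mul_mul_mem_of_mem_span {s : Set B} {M : Submodule R B} {a b : B}
    (hs : ∀ y ∈ s, a * y * b ∈ M) {x : B} (hx : x ∈ Submodule.span R s) : a * x * b ∈ M := by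
  have : Submodule.span R s ≤
      M.comap (LinearMap.mulRight R b ∘ₗ LinearMap.mulLeft R a) :=
    Submodule.span_le.mpr fun y hy => hs y hy
  exact this hx

theorem mul_mem_of_mem_span {s : Set B} {M : Submodule R B} {a : B}
    (hs : ∀ y ∈ s, a * y ∈ M) {x : B} (hx : x ∈ Submodule.span R s) : a * x ∈ M := by
  simpa using mul_mul_mem_of_mem_span (b := 1) (fun y hy => by simpa using hs y hy) hx

theorem mem_mul_of_mem_span {s : Set B} {M : Submodule R B} {b : B}
    (hs : ∀ y ∈ s, y * b ∈ M) {x : B} (hx : x ∈ Submodule.span R s) : x * b ∈ M := by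
  simpa using mul_mul_mem_of_mem_span (a := 1) (fun y hy => by simpa using hs y hy) hx

theorem adjoin_mul_mem {s : Set B} {M : Submodule R B} (hs : ∀ y ∈ s, ∀ x ∈ M, y * x ∈ M)
    {a x : B} (ha : a ∈ Algebra.adjoin R s) (hx : x ∈ M) : a * x ∈ M := by
  induction ha using Algebra.adjoin_induction generalizing x with
  | mem y hy => exact hs y hy x hx
  | algebraMap r => rw [← Algebra.smul_def]; exact M.smul_mem r hx
  | add y z _ _ hy hz => rw [add_mul]; exact M.add_mem (hy hx) (hz hx)
  | mul y z _ _ hy hz => rw [mul_assoc]; exact hy (hz hx)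

theorem mul_adjoin_mem {s : Set B} {M : Submodule R B} (hs : ∀ y ∈ s, ∀ x ∈ M, x * y ∈ M)
    {a x : B} (ha : a ∈ Algebra.adjoin R s) (hx : x ∈ M) : x * a ∈ M := by
  induction ha using Algebra.adjoin_induction generalizing x with
  | mem y hy => exact hs y hy x hx
  | algebraMap r => rw [← Algebra.commutes, ← Algebra.smul_def]; exact M.smul_mem r hx
  | add y z _ _ hy hz => rw [mul_add]; exact M.add_mem (hy hx) (hz hx)
  | mul y z _ _ hy hz => rw [← mul_assoc]; exact hz (hy hx)

theorem commute_of_mem_adjoin {s : Set B} {x : B} (hs : ∀ y ∈ s, Commute x y) {a : B}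
    (ha : a ∈ Algebra.adjoin R s) : Commute x a := by
  induction ha using Algebra.adjoin_induction with
  | mem y hy => exact hs y hy
  | algebraMap r => exact (Algebra.commutes r x).symm
  | add y z _ _ hy hz => exact hy.add_right hz
  | mul y z _ _ hy hz => exact hy.mul_right hz

end Span

section Subalgebras

variable (R : Type*) {B : Type*} [CommRing R] [Ring B] [Algebra R B]

/-- The subalgebra generated by the `g i` with `a ≤ i < b`. -/
def heckeSub (g : ℕ → B) (a b : ℕ) : Subalgebra R B :=
  Algebra.adjoin R {x | ∃ i, a ≤ i ∧ i < b ∧ x = g i}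

/-- The subalgebra generated by the `g i` with `1 ≤ i < n` and, if `n ≥ 2`, by `e`. -/
def brauerSub (g : ℕ → B) (e : B) (n : ℕ) : Subalgebra R B :=
  Algebra.adjoin R ({x | ∃ i, 1 ≤ i ∧ i < n ∧ x = g i} ∪ {x | 2 ≤ n ∧ x = e})

/-- The subalgebra generated by the `g i` with `2 k < i < n` and by `e₍ₖ₊₁₎`. -/
def cornerSub (g h : ℕ → B) (e : B) (n k : ℕ) : Subalgebra R B :=
  Algebra.adjoin R ({x | ∃ i, 2 * k + 1 ≤ i ∧ i < n ∧ x = g i} ∪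
    {x | 2 * k + 2 ≤ n ∧ x = eprod g h e (k + 1)})

variable {R}

theorem g_mem_heckeSub {g : ℕ → B} {a b i : ℕ} (h1 : a ≤ i) (h2 : i < b) :
    g i ∈ heckeSub R g a b := Algebra.subset_adjoin ⟨i, h1, h2, rfl⟩

theorem heckeSub_mono {g : ℕ → B} {a b a' b' : ℕ} (h1 : a' ≤ a) (h2 : b ≤ b') :
    heckeSub R g a b ≤ heckeSub R g a' b' :=
  Algebra.adjoin_mono fun _ ⟨i, hi, hi', hx⟩ => ⟨i, by omega, by omega, hx⟩

theorem brauerSub_mono {g : ℕ → B} {e : B} {m n : ℕ} (hmn : m ≤ n) :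
    brauerSub R g e m ≤ brauerSub R g e n :=
  Algebra.adjoin_mono (Set.union_subset_union
    (fun _ ⟨i, hi, hi', hx⟩ => ⟨i, hi, by omega, hx⟩) fun _ ⟨hi, hx⟩ => ⟨by omega, hx⟩)

theorem heckeSub_le_brauerSub {g : ℕ → B} {e : B} {n a b : ℕ} (ha : 1 ≤ a) (hb : b ≤ n) :
    heckeSub R g a b ≤ brauerSub R g e n :=
  Algebra.adjoin_mono fun _ ⟨i, hi, hi', hx⟩ => Or.inl ⟨i, by omega, by omega, hx⟩

theorem heckeSub_le_cornerSub {g h : ℕ → B} {e : B} {n k a b : ℕ} (ha : 2 * k + 1 ≤ a)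
    (hb : b ≤ n) : heckeSub R g a b ≤ cornerSub R g h e n k :=
  Algebra.adjoin_mono fun _ ⟨i, hi, hi', hx⟩ => Or.inl ⟨i, by omega, by omega, hx⟩

theorem e_mem_brauerSub {g : ℕ → B} {e : B} {n : ℕ} (hn : 2 ≤ n) : e ∈ brauerSub R g e n :=
  Algebra.subset_adjoin (Or.inr ⟨hn, rfl⟩)

theorem cornerSub_zero {g h : ℕ → B} {e : B} {n : ℕ} :
    cornerSub R g h e n 0 = brauerSub R g e n := by
  simp [cornerSub, brauerSub, eprod]

theorem up_mem {S : Subalgebra R B} {x : ℕ → B} {a l : ℕ}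
    (hx : ∀ i, a ≤ i → i < a + l → x i ∈ S) : up x a l ∈ S := by
  induction l with
  | zero => exact S.one_mem
  | succ l ih =>
    rw [up_succ']
    exact S.mul_mem (ih fun i h1 h2 => hx i h1 (by omega)) (hx _ (by omega) (by omega))

theorem dn_mem {S : Subalgebra R B} {x : ℕ → B} {a l : ℕ}
    (hx : ∀ i, a ≤ i → i < a + l → x i ∈ S) : dn x a l ∈ S := by
  induction l with
  | zero => exact S.one_mem
  | succ l ih =>
    rw [dn_succ]
    exact S.mul_mem (hx _ (by omega) (by omega)) (ih fun i h1 h2 => hx i h1 (by omega))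

end Subalgebras

namespace Tuple

variable {R B : Type*} [CommRing R] [Ring B] [Algebra R B] {q q' r d d' : R} {n : ℕ}
  {g h : ℕ → B} {e : B}

variable (T : Tuple q q' r d d' n g h e)
include T

theorem h_mem {S : Subalgebra R B} {i : ℕ} (hg : g i ∈ S) : h i ∈ S := by
  rw [T.h_eq]
  exact S.add_mem (S.smul_mem hg _) (S.smul_mem S.one_mem _)

theorem commute_heckeSub {x : B} {a b : ℕ} (hx : ∀ i, a ≤ i → i < b → Commute x (g i)) {u : B}
    (hu : u ∈ heckeSub R g a b) : Commute x u :=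
  commute_of_mem_adjoin (by rintro _ ⟨i, h1, h2, rfl⟩; exact hx i h1 h2) hu

theorem eprod_mem_brauerSub {k : ℕ} {m : ℕ} (hk : 2 * k ≤ m) :
    eprod g h e k ∈ brauerSub R g e m := by
  induction k with
  | zero => exact Subalgebra.one_mem _
  | succ k ih =>
    rw [T.eprod_succ]
    refine Subalgebra.mul_mem _ (Subalgebra.mul_mem _ (e_mem_brauerSub (by omega))
      (Subalgebra.mul_mem _ (up_mem fun i _ _ => ?_) (up_mem fun i _ _ => T.h_mem ?_)))
      (ih (by omega)) <;>
    exact heckeSub_le_brauerSub le_rfl le_rfl (g_mem_heckeSub (by omega) (by omega))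

/-- Right coset decomposition of the Hecke algebra, with `x = g` or `x = h`. -/
theorem mem_span_mul_up {x : ℕ → B} {α β γ ε : R}
    (hx1 : ∀ i, g i = α • x i + β • (1 : B))
    (hx2 : ∀ i, 1 ≤ i → i < n → x i * g i = γ • x i + ε • (1 : B))
    (hxb : ∀ a l i, 1 ≤ a → a + l ≤ n → a ≤ i → i + 1 < a + l →
      up x a l * g i = g (i + 1) * up x a l)
    (hxc : ∀ y i, Commute y (g i) → Commute y (x i))
    {a b : ℕ} (ha : 1 ≤ a) (hb : b ≤ n) (hab : a ≤ b) {u : B} (hu : u ∈ heckeSub R g a b) :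
    u ∈ Submodule.span R {y | ∃ v ∈ heckeSub R g (a + 1) b, ∃ l, a + l ≤ b ∧
      y = v * up x a l} := by
  set M := Submodule.span R {y | ∃ v ∈ heckeSub R g (a + 1) b, ∃ l, a + l ≤ b ∧
      y = v * up x a l} with hM
  have mem : ∀ v ∈ heckeSub R g (a + 1) b, ∀ l, a + l ≤ b → v * up x a l ∈ M :=
    fun v hv l hl => Submodule.subset_span ⟨v, hv, l, hl, rfl⟩
  have h1 : (1 : B) ∈ M := by simpa using mem 1 (Subalgebra.one_mem _) 0 (by omega)
  rw [← one_mul u]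
  refine mul_adjoin_mem ?_ hu h1
  rintro _ ⟨m, hm1, hm2, rfl⟩ z hz
  refine mem_mul_of_mem_span ?_ hz
  rintro _ ⟨v, hv, l, hl, rfl⟩
  rw [mul_assoc]
  -- The letter `g m` is shifted into the coset factor, meets the last letter (quadratic relation or
  -- cancellation), prolongs the word, or commutes with it.
  rcases lt_trichotomy m (a + l) with hml | rfl | hml
  · rcases Nat.lt_or_ge (m + 1) (a + l) with hml' | hml'
    · rw [hxb a l m ha (by omega) hm1 hml', ← mul_assoc]
      exact mem _ (Subalgebra.mul_mem _ hv (g_mem_heckeSub (by omega) (by omega))) l hl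
    · obtain ⟨p, rfl⟩ : ∃ p, l = p + 1 := ⟨l - 1, by omega⟩
      obtain rfl : m = a + p := by omega
      rw [up_succ', mul_assoc, hx2 _ (by omega) (by omega), mul_add, mul_smul_comm, mul_smul_comm,
        mul_one, ← up_succ', mul_add, mul_smul_comm, mul_smul_comm]
      exact M.add_mem (M.smul_mem _ (mem v hv _ hl)) (M.smul_mem _ (mem v hv _ (by omega)))
  · rw [hx1, mul_add, mul_smul_comm, mul_smul_comm, mul_one, ← up_succ', mul_add, mul_smul_comm,
      mul_smul_comm]
    exact M.add_mem (M.smul_mem _ (mem v hv _ (by omega))) (M.smul_mem _ (mem v hv _ hl))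
  · have hc : Commute (g m) (up x a l) := commute_up fun i _ _ => hxc _ _
      (T.cgg (by omega) (by omega) (by omega) (by omega) (by omega))
    rw [← hc.eq, ← mul_assoc]
    exact mem _ (Subalgebra.mul_mem _ hv (g_mem_heckeSub (by omega) (by omega))) l hl

theorem mem_span_mul_up_g {a b : ℕ} (ha : 1 ≤ a) (hb : b ≤ n) (hab : a ≤ b) {u : B}
    (hu : u ∈ heckeSub R g a b) :
    u ∈ Submodule.span R {y | ∃ v ∈ heckeSub R g (a + 1) b, ∃ l, a + l ≤ b ∧
      y = v * up g a l} :=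
  T.mem_span_mul_up (α := 1) (β := 0) (by simp) T.sq (fun _ _ _ => T.up_g_g) (fun _ _ hy => hy)
    ha hb hab hu

theorem mem_span_mul_up_h {a b : ℕ} (ha : 1 ≤ a) (hb : b ≤ n) (hab : a ≤ b) {u : B}
    (hu : u ∈ heckeSub R g a b) :
    u ∈ Submodule.span R {y | ∃ v ∈ heckeSub R g (a + 1) b, ∃ l, a + l ≤ b ∧
      y = v * up h a l} :=
  T.mem_span_mul_up (γ := 0) (ε := 1) T.g_eq (fun i h1 h2 => by simp [T.hg h1 h2])
    (fun _ _ _ => T.up_h_g) (fun _ _ hy => T.commute_h hy) ha hb hab hu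

/-- Right coset decomposition of the Hecke algebra on one more strand. -/
theorem mem_span_mul_dn_h {b : ℕ} (hb : b < n) (hb1 : 1 ≤ b) {u : B}
    (hu : u ∈ heckeSub R g 1 (b + 1)) :
    u ∈ Submodule.span R {y | ∃ v ∈ heckeSub R g 1 b, ∃ i l, 1 ≤ i ∧ i + l = b + 1 ∧
      y = v * dn h i l} := by
  set M := Submodule.span R {y | ∃ v ∈ heckeSub R g 1 b, ∃ i l, 1 ≤ i ∧ i + l = b + 1 ∧
      y = v * dn h i l} with hM
  have mem : ∀ v ∈ heckeSub R g 1 b, ∀ i l, 1 ≤ i → i + l = b + 1 → v * dn h i l ∈ M :=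
    fun v hv i l hi hl => Submodule.subset_span ⟨v, hv, i, l, hi, hl, rfl⟩
  have h1 : (1 : B) ∈ M := by simpa using mem 1 (Subalgebra.one_mem _) (b + 1) 0 (by omega)
  rw [← one_mul u]
  refine mul_adjoin_mem ?_ hu h1
  rintro _ ⟨m, hm1, hm2, rfl⟩ z hz
  refine mem_mul_of_mem_span ?_ hz
  rintro _ ⟨v, hv, i, l, hi, hl, rfl⟩
  rw [mul_assoc]
  rcases lt_trichotomy m i with hml | rfl | hml
  · rcases Nat.lt_or_ge (m + 1) i with hml' | hml'
    · have hc : Commute (g m) (dn h i l) := commute_dn fun j _ _ =>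
        T.cgh (by omega) (by omega) (by omega) (by omega) (by omega)
      rw [← hc.eq, ← mul_assoc]
      exact mem _ (Subalgebra.mul_mem _ hv (g_mem_heckeSub (by omega) (by omega))) i l hi hl
    · obtain rfl : i = m + 1 := by omega
      rw [T.g_eq, mul_add, mul_smul_comm, mul_smul_comm, mul_one, ← dn_succ', mul_add,
        mul_smul_comm, mul_smul_comm]
      exact M.add_mem (M.smul_mem _ (mem v hv _ _ hm1 (by omega)))
        (M.smul_mem _ (mem v hv _ _ hi hl))
  · obtain ⟨p, rfl⟩ : ∃ p, l = p + 1 := ⟨l - 1, by omega⟩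
    rw [dn_succ', mul_assoc, T.hg (by omega) (by omega), mul_one]
    exact mem v hv _ _ (by omega) (by omega)
  · obtain ⟨p, rfl⟩ : ∃ p, m = p + 1 := ⟨m - 1, by omega⟩
    rw [T.dn_h_g (by omega) (by omega) (by omega) (by omega), ← mul_assoc]
    exact mem _ (Subalgebra.mul_mem _ hv (g_mem_heckeSub (by omega) (by omega))) i l hi hl

/-- Left coset decomposition of the Hecke algebra on one more strand. -/
theorem mem_span_up_g_mul {b : ℕ} (hb : b < n) (hb1 : 1 ≤ b) {u : B}
    (hu : u ∈ heckeSub R g 1 (b + 1)) :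
    u ∈ Submodule.span R {y | ∃ v ∈ heckeSub R g 1 b, ∃ i l, 1 ≤ i ∧ i + l = b + 1 ∧
      y = up g i l * v} := by
  set M := Submodule.span R {y | ∃ v ∈ heckeSub R g 1 b, ∃ i l, 1 ≤ i ∧ i + l = b + 1 ∧
      y = up g i l * v} with hM
  have mem : ∀ v ∈ heckeSub R g 1 b, ∀ i l, 1 ≤ i → i + l = b + 1 → up g i l * v ∈ M :=
    fun v hv i l hi hl => Submodule.subset_span ⟨v, hv, i, l, hi, hl, rfl⟩
  have h1 : (1 : B) ∈ M := by simpa using mem 1 (Subalgebra.one_mem _) (b + 1) 0 (by omega)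
  rw [← mul_one u]
  refine adjoin_mul_mem ?_ hu h1
  rintro _ ⟨m, hm1, hm2, rfl⟩ z hz
  refine mul_mem_of_mem_span ?_ hz
  rintro _ ⟨v, hv, i, l, hi, hl, rfl⟩
  rw [← mul_assoc]
  rcases lt_trichotomy m i with hml | rfl | hml
  · rcases Nat.lt_or_ge (m + 1) i with hml' | hml'
    · have hc : Commute (g m) (up g i l) := commute_up fun j _ _ =>
        T.cgg (by omega) (by omega) (by omega) (by omega) (by omega)
      rw [hc.eq, mul_assoc]
      exact mem _ (Subalgebra.mul_mem _ (g_mem_heckeSub (by omega) (by omega)) hv) i l hi hl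
    · obtain rfl : i = m + 1 := by omega
      rw [← up_succ]
      exact mem v hv _ _ hm1 (by omega)
  · obtain ⟨p, rfl⟩ : ∃ p, l = p + 1 := ⟨l - 1, by omega⟩
    rw [up_succ, ← mul_assoc, T.sq _ (by omega) (by omega), add_mul, smul_mul_assoc,
      smul_mul_assoc, one_mul, ← up_succ, add_mul, smul_mul_assoc, smul_mul_assoc]
    exact M.add_mem (M.smul_mem _ (mem v hv _ _ hm1 (by omega)))
      (M.smul_mem _ (mem v hv _ _ (by omega) (by omega)))
  · obtain ⟨p, rfl⟩ : ∃ p, m = p + 1 := ⟨m - 1, by omega⟩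
    rw [← T.up_g_g (by omega) (by omega) (by omega) (by omega), mul_assoc]
    exact mem _ (Subalgebra.mul_mem _ (g_mem_heckeSub (by omega) (by omega)) hv) i l hi hl

end Tuple

end QBrauer

/-! ### Spanning by H e_(k) H, and generators of the corners. -/

namespace QBrauer

namespace Tuple

variable {R B : Type*} [CommRing R] [Ring B] [Algebra R B] {q q' r d d' : R} {n : ℕ}
  {g h : ℕ → B} {e : B}

variable (R) in
/-- The span of the elements `u e₍ₖ₎` and `u e₍ₖ₊₁₎ v` with `u`, `v` in the Hecke algebra on the
strands that are not joined by `e₍ₖ₎`. -/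
def sandwich (g h : ℕ → B) (e : B) (n k : ℕ) : Submodule R B :=
  Submodule.span R ({y | ∃ u ∈ heckeSub R g (2 * k + 1) n, y = u * eprod g h e k} ∪
    {y | 2 * k + 2 ≤ n ∧ ∃ u ∈ heckeSub R g (2 * k + 1) n, ∃ v ∈ heckeSub R g (2 * k + 1) n,
      y = u * eprod g h e (k + 1) * v})

variable (T : Tuple q q' r d d' n g h e)
include T

theorem commute_eprod_heckeSub {k : ℕ} {u : B} (hu : u ∈ heckeSub R g (2 * k + 1) n) :
    Commute (eprod g h e k) u :=
  T.commute_heckeSub (fun _ _ h2 => T.commute_eprod_g (by omega) h2) hu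

theorem mul_mem_sandwich {k : ℕ} {u x : B} (hu : u ∈ heckeSub R g (2 * k + 1) n)
    (hx : x ∈ sandwich R g h e n k) : u * x ∈ sandwich R g h e n k := by
  refine mul_mem_of_mem_span ?_ hx
  rintro _ (⟨v, hv, rfl⟩ | ⟨hk, v, hv, w, hw, rfl⟩)
  · rw [← mul_assoc]
    exact Submodule.subset_span (Or.inl ⟨_, Subalgebra.mul_mem _ hu hv, rfl⟩)
  · rw [← mul_assoc, ← mul_assoc]
    exact Submodule.subset_span (Or.inr ⟨hk, _, Subalgebra.mul_mem _ hu hv, w, hw, rfl⟩)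

theorem sandwich_mul_mem {k : ℕ} {u x : B} (hu : u ∈ heckeSub R g (2 * k + 1) n)
    (hx : x ∈ sandwich R g h e n k) : x * u ∈ sandwich R g h e n k := by
  refine mem_mul_of_mem_span ?_ hx
  rintro _ (⟨v, hv, rfl⟩ | ⟨hk, v, hv, w, hw, rfl⟩)
  · rw [mul_assoc, (T.commute_eprod_heckeSub hu).eq, ← mul_assoc]
    exact Submodule.subset_span (Or.inl ⟨_, Subalgebra.mul_mem _ hv hu, rfl⟩)
  · rw [mul_assoc _ w]
    exact Submodule.subset_span (Or.inr ⟨hk, v, hv, _, Subalgebra.mul_mem _ hw hu, rfl⟩)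

theorem eprod_mem_sandwich (k : ℕ) : eprod g h e k ∈ sandwich R g h e n k :=
  Submodule.subset_span (Or.inl ⟨1, Subalgebra.one_mem _, (one_mul _).symm⟩)

/-- Only the first letter g_{2k+2} fails to commute with e_(k+1), and compressing it gives a scalar.
-/
theorem eprod_mul_up_mul_eprod_mem {k l : ℕ} (hk : 2 * k + 2 ≤ n) (hl : 2 * k + 2 + l ≤ n) :
    eprod g h e (k + 1) * up g (2 * k + 2) l * eprod g h e (k + 1) ∈
      sandwich R g h e n (k + 1) := by
  cases l with
  | zero =>
    rw [up_zero, mul_one, T.eprod_mul_eprod le_rfl hk]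
    exact Submodule.smul_mem _ _ (T.eprod_mem_sandwich _)
  | succ l =>
    have hu : up g (2 * k + 3) l ∈ heckeSub R g (2 * (k + 1) + 1) n :=
      up_mem fun i h1 h2 => g_mem_heckeSub (by omega) (by omega)
    rw [up_succ, ← mul_assoc, mul_assoc _ (up g _ _), ← (T.commute_eprod_heckeSub hu).eq,
      ← mul_assoc, T.eprod_g_eprod (by omega)]
    exact T.sandwich_mul_mem hu (Submodule.smul_mem _ _ (T.eprod_mem_sandwich _))

/-- Letters of high index move out through e_(k+1), and odd letters next to it are absorbed. The
only remaining core that is not a scalar compression is g_{2k+2} g_{2k+3} g_{2k+1}⁻¹ g_{2k+2}⁻¹,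
which produces e_(k+2). -/
theorem eprod_mul_up_mul_up_mul_eprod_mem {k l m : ℕ} (hk : 2 * k + 2 ≤ n)
    (hl : 2 * k + 2 + l ≤ n) (hm : 2 * k + 1 + m ≤ n) :
    eprod g h e (k + 1) * (up g (2 * k + 2) l * up h (2 * k + 1) m) * eprod g h e (k + 1) ∈
      sandwich R g h e n (k + 1) := by
  rcases m with _ | _ | m
  · rw [up_zero, mul_one]
    exact T.eprod_mul_up_mul_eprod_mem hk hl
  · rw [up_succ, up_zero, mul_one, mul_assoc, mul_assoc, T.h_eprod (by omega) hk, mul_smul_comm,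
      mul_smul_comm, ← mul_assoc]
    exact Submodule.smul_mem _ _ (T.eprod_mul_up_mul_eprod_mem hk hl)
  have hu : up h (2 * k + 3) m ∈ heckeSub R g (2 * (k + 1) + 1) n :=
    up_mem fun i h1 h2 => T.h_mem (g_mem_heckeSub (by omega) (by omega))
  rw [up_succ, up_succ, ← mul_assoc (h _), ← mul_assoc (up g _ _), ← mul_assoc (eprod _ _ _ _),
    mul_assoc _ (up h _ _), ← (T.commute_eprod_heckeSub hu).eq, ← mul_assoc]
  refine T.sandwich_mul_mem hu ?_
  have hh : eprod g h e (k + 1) * h (2 * k + 2) * eprod g h e (k + 1) ∈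
      sandwich R g h e n (k + 1) := by
    rw [T.eprod_h_eprod (by omega)]
    exact Submodule.smul_mem _ _ (T.eprod_mem_sandwich _)
  rcases l with _ | _ | l
  · rw [up_zero, one_mul, ← mul_assoc, T.eprod_h (by omega) hk, smul_mul_assoc, smul_mul_assoc]
    exact Submodule.smul_mem _ _ hh
  · have := T.hhg (i := 2 * k + 1) (by omega) (by omega)
    rw [up_succ, up_zero, mul_one, show 2 * k + 1 + 1 = 2 * k + 2 by ring] at *
    rw [← this, ← mul_assoc, ← mul_assoc, T.eprod_h (by omega) hk, mul_assoc _ (g _),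
      T.g_eprod (by omega) hk, mul_smul_comm, smul_mul_assoc, smul_mul_assoc]
    exact Submodule.smul_mem _ _ (Submodule.smul_mem _ _ hh)
  · have hu' : up g (2 * k + 4) l ∈ heckeSub R g (2 * (k + 1) + 1) n :=
      up_mem fun i h1 h2 => g_mem_heckeSub (by omega) (by omega)
    have hc : Commute (h (2 * k + 1) * h (2 * k + 2)) (up g (2 * k + 4) l) :=
      commute_up fun i _ _ =>
        (T.chg (by omega) (by omega) (by omega) (by omega) (by omega)).mul_left
          (T.chg (by omega) (by omega) (by omega) (by omega) (by omega))
    have e1 : eprod g h e (k + 1) * (up g (2 * k + 2) (l + 1 + 1) *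
          (h (2 * k + 1) * h (2 * k + 2))) * eprod g h e (k + 1) =
        eprod g h e (k + 1) * wd g h k * eprod g h e (k + 1) * up g (2 * k + 4) l := by
      rw [mul_assoc _ (eprod g h e (k + 1)), (T.commute_eprod_heckeSub hu').eq, up_succ, up_succ,
        wd]
      calc _ = eprod g h e (k + 1) * (g (2 * k + 2) * g (2 * k + 3) *
            (up g (2 * k + 4) l * (h (2 * k + 1) * h (2 * k + 2)))) * eprod g h e (k + 1) := by
            simp only [mul_assoc, add_assoc, Nat.reduceAdd]
        _ = _ := by rw [← hc.eq]; simp only [mul_assoc]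
    rw [show 2 * k + 1 + 1 = 2 * k + 2 by ring, e1, T.eprod_wd_eprod (by omega), smul_mul_assoc]
    refine Submodule.smul_mem _ _ (Submodule.subset_span (Or.inr ⟨by omega, 1,
      Subalgebra.one_mem _, _, hu', by rw [one_mul]⟩))

/-- Two coset decompositions peel off strands 2k+1 and 2k+2, leaving a factor that commutes with
e_(k+1). The first uses inverses and the second generators, so that the representatives have the
shape of the word defining e_(k+2). -/
theorem eprod_mul_eprod_mem_sandwich {k : ℕ} (hk : 2 * k + 2 ≤ n) {x : B}
    (hx : x ∈ heckeSub R g (2 * k + 1) n) :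
    eprod g h e (k + 1) * x * eprod g h e (k + 1) ∈ sandwich R g h e n (k + 1) := by
  refine mul_mul_mem_of_mem_span ?_ (T.mem_span_mul_up_h (by omega) le_rfl (by omega) hx)
  rintro _ ⟨v, hv, m, hm, rfl⟩
  rw [mul_assoc, mul_assoc]
  have key : eprod g h e (k + 1) * v * (up h (2 * k + 1) m * eprod g h e (k + 1)) ∈
      sandwich R g h e n (k + 1) := by
    refine mul_mul_mem_of_mem_span ?_ (T.mem_span_mul_up_g (by omega) le_rfl (by omega) hv)
    rintro _ ⟨u, hu, l, hl, rfl⟩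
    have e1 : eprod g h e (k + 1) * (u * up g (2 * k + 1 + 1) l) *
        (up h (2 * k + 1) m * eprod g h e (k + 1)) = u * (eprod g h e (k + 1) *
        (up g (2 * k + 2) l * up h (2 * k + 1) m) * eprod g h e (k + 1)) := by
      rw [← mul_assoc _ u, (T.commute_eprod_heckeSub (k := k + 1) hu).eq]
      simp only [mul_assoc]
    rw [e1]
    exact T.mul_mem_sandwich hu (T.eprod_mul_up_mul_up_mul_eprod_mem hk (by omega) hm)
  rwa [mul_assoc] at key

/-- The `q`-Brauer algebra is spanned by the elements `u e₍ₖ₎ v` with `u`, `v` in the Hecke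
algebra. -/
theorem mem_span_hecke_eprod_hecke {x : B} (hx : x ∈ brauerSub R g e n) :
    x ∈ Submodule.span R {y | ∃ k u v, 2 * k ≤ n ∧ u ∈ heckeSub R g 1 n ∧
      v ∈ heckeSub R g 1 n ∧ y = u * eprod g h e k * v} := by
  set M := Submodule.span R {y | ∃ k u v, 2 * k ≤ n ∧ u ∈ heckeSub R g 1 n ∧
      v ∈ heckeSub R g 1 n ∧ y = u * eprod g h e k * v} with hM
  have mem : ∀ k u v, 2 * k ≤ n → u ∈ heckeSub R g 1 n → v ∈ heckeSub R g 1 n →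
      u * eprod g h e k * v ∈ M :=
    fun k u v hk hu hv => Submodule.subset_span ⟨k, u, v, hk, hu, hv, rfl⟩
  have hone := Subalgebra.one_mem (heckeSub R g 1 n)
  have hl : ∀ u ∈ heckeSub R g 1 n, ∀ z ∈ M, u * z ∈ M := by
    intro u hu z hz
    refine mul_mem_of_mem_span ?_ hz
    rintro _ ⟨k, v, w, hk, hv, hw, rfl⟩
    rw [← mul_assoc, ← mul_assoc]
    exact mem k _ w hk (Subalgebra.mul_mem _ hu hv) hw
  have hr : ∀ u ∈ heckeSub R g 1 n, ∀ z ∈ M, z * u ∈ M := by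
    intro u hu z hz
    refine mem_mul_of_mem_span ?_ hz
    rintro _ ⟨k, v, w, hk, hv, hw, rfl⟩
    rw [mul_assoc _ w]
    exact mem k v _ hk hv (Subalgebra.mul_mem _ hw hu)
  have hsand : ∀ k, 2 * k ≤ n → sandwich R g h e n k ≤ M := by
    intro k hk
    refine Submodule.span_le.mpr ?_
    rintro _ (⟨v, hv, rfl⟩ | ⟨hk, v, hv, w, hw, rfl⟩)
    · simpa using mem k v 1 hk (heckeSub_mono (by omega) le_rfl hv) hone
    · exact mem (k + 1) v w (by omega) (heckeSub_mono (by omega) le_rfl hv)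
        (heckeSub_mono (by omega) le_rfl hw)
  -- Induction on the gap `m`: an extra e_(j+1) is split off the larger factor, and the compression
  -- of `z` by e_(j+1) is either absorbed or contains e_(j+2), which narrows the gap.
  have claim : ∀ m j, 2 * (j + 1 + m) ≤ n → ∀ z ∈ heckeSub R g (2 * j + 1) n,
      eprod g h e (j + 1) * z * eprod g h e (j + 1 + m) ∈ M := by
    intro m
    induction m with
    | zero =>
      intro j hj z hz
      exact hsand (j + 1) hj (T.eprod_mul_eprod_mem_sandwich (by omega) hz)
    | succ m ih =>
      intro j hj z hz
      rw [show j + 1 + (m + 1) = j + 1 + 1 + m by ring] at hj ⊢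
      have h2 : d ^ (j + 1) • (eprod g h e (j + 1) * z * eprod g h e (j + 1 + 1 + m)) ∈ M := by
        rw [← mul_smul_comm, ← T.eprod_mul_eprod (j := j + 1) (by omega) hj, ← mul_assoc]
        refine mem_mul_of_mem_span ?_ (T.eprod_mul_eprod_mem_sandwich (by omega) hz)
        rintro _ (⟨v, hv, rfl⟩ | ⟨hk, v, hv, w, hw, rfl⟩)
        · rw [mul_assoc, T.eprod_mul_eprod (by omega) hj]
          exact hl v (heckeSub_mono (by omega) le_rfl hv) _ (M.smul_mem _
            (by simpa using mem _ 1 1 hj hone hone))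
        · rw [mul_assoc, mul_assoc, ← mul_assoc (eprod g h e _)]
          exact hl v (heckeSub_mono (by omega) le_rfl hv) _ (ih _ hj w hw)
      have h3 := M.smul_mem (d' ^ (j + 1)) h2
      rwa [smul_smul, ← mul_pow, mul_comm d' d, T.dd, one_pow, one_smul] at h3
  rw [← mul_one x]
  refine adjoin_mul_mem ?_ hx (by simpa [eprod] using mem 0 1 1 (by omega) hone hone)
  rintro _ (⟨i, h1, h2, rfl⟩ | ⟨hn, rfl⟩) z hz
  · exact hl _ (g_mem_heckeSub h1 h2) z hz
  · refine mul_mem_of_mem_span ?_ hz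
    rintro _ ⟨k, u, v, hk, hu, hv, rfl⟩
    rw [← mul_assoc]
    refine hr v hv _ ?_
    cases k with
    | zero => simpa [eprod] using mem 1 1 u (by omega) hone hu
    | succ k => simpa [eprod_one, mul_assoc, add_comm] using claim k 0 (by omega) u hu

theorem exists_eprod_heckeSub_eprod {k : ℕ} (hk : 2 * k + 2 ≤ n) {v : B}
    (hv : v ∈ heckeSub R g (2 * k + 1) n) :
    ∃ c ∈ cornerSub R g h e n (k + 1),
      eprod g h e (k + 1) * v * eprod g h e (k + 1) = c * eprod g h e (k + 1) := by
  have : sandwich R g h e n (k + 1) ≤ (cornerSub R g h e n (k + 1)).toSubmodule.map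
      (LinearMap.mulRight R (eprod g h e (k + 1))) := by
    refine Submodule.span_le.mpr ?_
    rintro _ (⟨u, hu, rfl⟩ | ⟨hk', u, hu, w, hw, rfl⟩)
    · exact ⟨u, heckeSub_le_cornerSub (by omega) le_rfl hu, rfl⟩
    -- The scalar compensates for the e_(k+1) on the right, which commutes past `w` and is absorbed
    -- by e_(k+2) with factor d^(k+1).
    · refine ⟨d' ^ (k + 1) • (u * eprod g h e (k + 1 + 1) * w), Subalgebra.smul_mem _
        (Subalgebra.mul_mem _ (Subalgebra.mul_mem _
          (heckeSub_le_cornerSub (by omega) le_rfl hu)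
          (Algebra.subset_adjoin (Or.inr ⟨by omega, rfl⟩)))
          (heckeSub_le_cornerSub (by omega) le_rfl hw)) _, ?_⟩
      rw [LinearMap.mulRight_apply, smul_mul_assoc, mul_assoc _ w,
        ← (T.commute_eprod_heckeSub (k := k + 1) hw).eq, ← mul_assoc, mul_assoc u,
        T.eprod_mul_eprod' (by omega) (by omega), mul_smul_comm, smul_mul_assoc, smul_smul,
        ← mul_pow, mul_comm d', T.dd, one_pow, one_smul]
  obtain ⟨c, hc, hc'⟩ := this (T.eprod_mul_eprod_mem_sandwich hk hv)
  exact ⟨c, hc, hc'.symm⟩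

/-- With E = e_(k+1), C the next corner algebra and H the Hecke part, the span of C E H is stable
under right multiplication by the generators: `g i` goes into H, and E v E falls back into C E by
the Hecke case. -/
theorem exists_eprod_cornerSub_eprod {k : ℕ} (hk : 2 * k + 2 ≤ n) {x : B}
    (hx : x ∈ cornerSub R g h e n k) :
    ∃ c ∈ cornerSub R g h e n (k + 1),
      eprod g h e (k + 1) * x * eprod g h e (k + 1) = c * eprod g h e (k + 1) := by
  set E := eprod g h e (k + 1) with hE
  set N := Submodule.span R {y | ∃ c ∈ cornerSub R g h e n (k + 1),
    ∃ v ∈ heckeSub R g (2 * k + 1) n, y = c * E * v} with hN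
  have mem : ∀ c ∈ cornerSub R g h e n (k + 1), ∀ v ∈ heckeSub R g (2 * k + 1) n,
      c * E * v ∈ N := fun c hc v hv => Submodule.subset_span ⟨c, hc, v, hv, rfl⟩
  have hone := Subalgebra.one_mem (heckeSub R g (2 * k + 1) n)
  have h1 : E * x ∈ N := by
    refine mul_adjoin_mem ?_ hx (by simpa using mem 1 (Subalgebra.one_mem _) 1 hone)
    rintro _ (⟨i, h1, h2, rfl⟩ | ⟨hn, rfl⟩) z hz
    · refine mem_mul_of_mem_span ?_ hz
      rintro _ ⟨c, hc, v, hv, rfl⟩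
      rw [mul_assoc _ v]
      exact mem c hc _ (Subalgebra.mul_mem _ hv (g_mem_heckeSub h1 h2))
    · refine mem_mul_of_mem_span ?_ hz
      rintro _ ⟨c, hc, v, hv, rfl⟩
      obtain ⟨c', hc', h3⟩ := T.exists_eprod_heckeSub_eprod hk hv
      rw [← hE] at h3 ⊢
      rw [mul_assoc, mul_assoc, ← mul_assoc E, h3, ← mul_assoc]
      simpa using mem _ (Subalgebra.mul_mem _ hc hc') 1 hone
  have h2 : E * x * E ∈ (cornerSub R g h e n (k + 1)).toSubmodule.map
      (LinearMap.mulRight R E) := by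
    refine mem_mul_of_mem_span ?_ h1
    rintro _ ⟨c, hc, v, hv, rfl⟩
    obtain ⟨c', hc', h3⟩ := T.exists_eprod_heckeSub_eprod hk hv
    rw [mul_assoc, mul_assoc, ← mul_assoc E, h3, ← mul_assoc]
    exact ⟨_, Subalgebra.mul_mem _ hc hc', rfl⟩
  obtain ⟨c, hc, hc'⟩ := h2
  exact ⟨c, hc, hc'.symm⟩

/-- The corner `e₍ₖ₎ Br_n e₍ₖ₎` is generated by `g i` for `i > 2 k` and by `e₍ₖ₊₁₎`. -/
theorem exists_eprod_brauerSub_eprod {k : ℕ} (hk : 2 * k ≤ n) {x : B}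
    (hx : x ∈ brauerSub R g e n) :
    ∃ c ∈ cornerSub R g h e n k, eprod g h e k * x * eprod g h e k =
      eprod g h e k * c * eprod g h e k := by
  induction k with
  | zero => exact ⟨x, by rwa [cornerSub_zero], rfl⟩
  | succ k ih =>
    obtain ⟨c, hc, h1⟩ := ih (by omega)
    obtain ⟨c', hc', h2⟩ := T.exists_eprod_cornerSub_eprod hk hc
    -- e_(k+1) absorbs e_(k) on both sides up to d^k, so `x` may be replaced by the corner element
    -- found for `k`.
    have h3 : eprod g h e (k + 1) * x * eprod g h e (k + 1) =
        eprod g h e (k + 1) * c * eprod g h e (k + 1) := by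
      apply T.pow_d_smul_cancel (k + k)
      have e1 : ∀ y : B, d ^ (k + k) • (eprod g h e (k + 1) * y * eprod g h e (k + 1)) =
          eprod g h e (k + 1) * (eprod g h e k * y * eprod g h e k) * eprod g h e (k + 1) := by
        intro y
        have a1 := T.eprod_mul_eprod (j := k) (k := k + 1) (by omega) hk
        have a2 := T.eprod_mul_eprod' (j := k) (k := k + 1) (by omega) hk
        calc _ = (d ^ k • eprod g h e (k + 1)) * y * (d ^ k • eprod g h e (k + 1)) := by
              rw [smul_mul_assoc, smul_mul_assoc, mul_smul_comm, smul_smul, pow_add]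
          _ = eprod g h e (k + 1) * eprod g h e k * y *
              (eprod g h e k * eprod g h e (k + 1)) := by rw [a1, a2]
          _ = _ := by simp only [mul_assoc]
      rw [e1, e1, h1]
    -- The scalar compensates for the additional e_(k+1) on the left.
    refine ⟨d' ^ (k + 1) • c', Subalgebra.smul_mem _ hc' _, ?_⟩
    have h4 : eprod g h e (k + 1) * (c' * eprod g h e (k + 1)) =
        d ^ (k + 1) • (c' * eprod g h e (k + 1)) := by
      rw [← h2, ← mul_assoc, ← mul_assoc, T.eprod_mul_eprod le_rfl hk]
      simp only [smul_mul_assoc]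
    rw [h3, h2, mul_smul_comm, smul_mul_assoc, mul_assoc, h4, smul_smul, ← mul_pow, mul_comm d',
      T.dd, one_pow, one_smul]

end Tuple

end QBrauer

/-! ### Decomposition of n + 1 strands into three pieces over n strands. -/

namespace QBrauer

namespace Tuple

variable {R B : Type*} [CommRing R] [Ring B] [Algebra R B] {q q' r d d' : R} {n : ℕ}
  {g h : ℕ → B} {e : B}

/-- The element `g_n⁻¹ ⋯ g_2⁻¹ e g_2 ⋯ g_n`. -/
def conjE (g h : ℕ → B) (e : B) (n : ℕ) : B := dn h 2 (n - 1) * e * up g 2 (n - 1)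

variable (R) in
/-- The span of `A_n`, `A_n g_n A_n` and `A_n (g_n⁻¹ ⋯ g_2⁻¹ e g_2 ⋯ g_n) A_n`, where `A_n` is the
`q`-Brauer subalgebra on `n` strands. -/
def stepSpan (g h : ℕ → B) (e : B) (n : ℕ) : Submodule R B :=
  Submodule.span R ({y | y ∈ brauerSub R g e n} ∪
    {y | ∃ a ∈ brauerSub R g e n, ∃ b ∈ brauerSub R g e n, y = a * g n * b} ∪
    {y | ∃ a ∈ brauerSub R g e n, ∃ b ∈ brauerSub R g e n, y = a * conjE g h e n * b})


theorem mul_mem_stepSpan {m : ℕ} {a x : B}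
    (ha : a ∈ brauerSub R g e m) (hx : x ∈ stepSpan R g h e m) : a * x ∈ stepSpan R g h e m := by
  refine mul_mem_of_mem_span ?_ hx
  rintro _ ((hy | ⟨u, hu, v, hv, rfl⟩) | ⟨u, hu, v, hv, rfl⟩)
  · exact Submodule.subset_span (Or.inl (Or.inl (Subalgebra.mul_mem _ ha hy)))
  · refine Submodule.subset_span (Or.inl (Or.inr ⟨_, Subalgebra.mul_mem _ ha hu, v, hv, ?_⟩))
    simp only [mul_assoc]
  · refine Submodule.subset_span (Or.inr ⟨_, Subalgebra.mul_mem _ ha hu, v, hv, ?_⟩)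
    simp only [mul_assoc]

theorem stepSpan_mul_mem {m : ℕ} {a x : B} (ha : a ∈ brauerSub R g e m)
    (hx : x ∈ stepSpan R g h e m) : x * a ∈ stepSpan R g h e m := by
  refine mem_mul_of_mem_span ?_ hx
  rintro _ ((hy | ⟨u, hu, v, hv, rfl⟩) | ⟨u, hu, v, hv, rfl⟩)
  · exact Submodule.subset_span (Or.inl (Or.inl (Subalgebra.mul_mem _ hy ha)))
  · refine Submodule.subset_span (Or.inl (Or.inr ⟨u, hu, _, Subalgebra.mul_mem _ hv ha, ?_⟩))
    simp only [mul_assoc]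
  · refine Submodule.subset_span (Or.inr ⟨u, hu, _, Subalgebra.mul_mem _ hv ha, ?_⟩)
    simp only [mul_assoc]

theorem mem_stepSpan_of_mem {m : ℕ} {x : B} (hx : x ∈ brauerSub R g e m) :
    x ∈ stepSpan R g h e m := Submodule.subset_span (Or.inl (Or.inl hx))

variable (T : Tuple q q' r d d' (n + 1) g h e)
include T

theorem eprod_up_up {j k : ℕ} (h1 : j < k) (h2 : 2 * k ≤ n + 1) :
    eprod g h e k * (up g 2 (2 * j) * up h 1 (2 * j)) = eprod g h e k := by
  induction j with
  | zero => simp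
  | succ j ih =>
    rw [T.up_up_succ (by omega), ← mul_assoc, ih (by omega), T.eprod_wd h1 h2]

theorem up_up_mul_dn_dn {j : ℕ} (hj : 2 * j + 1 < n + 1) :
    up g 2 (2 * j) * up h 1 (2 * j) * (dn g 1 (2 * j) * dn h 2 (2 * j)) = 1 := by
  rw [mul_assoc, ← mul_assoc (up h _ _), up_mul_dn fun i _ _ => T.hg (by omega) (by omega),
    one_mul, up_mul_dn fun i _ _ => T.gh (by omega) (by omega)]

theorem dn_dn_mul_up_up {j : ℕ} (hj : 2 * j + 1 < n + 1) :
    dn g 1 (2 * j) * dn h 2 (2 * j) * (up g 2 (2 * j) * up h 1 (2 * j)) = 1 := by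
  rw [mul_assoc, ← mul_assoc (dn h _ _), dn_mul_up fun i _ _ => T.hg (by omega) (by omega),
    one_mul, dn_mul_up fun i _ _ => T.gh (by omega) (by omega)]

theorem dn_dn_eprod {j k : ℕ} (h1 : j < k) (h2 : 2 * k ≤ n + 1) :
    dn g 1 (2 * j) * dn h 2 (2 * j) * eprod g h e k = eprod g h e k := by
  nth_rewrite 1 [← T.up_up_eprod h1 h2]
  rw [← mul_assoc, T.dn_dn_mul_up_up (by omega), one_mul]

theorem eprod_dn_dn {j k : ℕ} (h1 : j < k) (h2 : 2 * k ≤ n + 1) :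
    eprod g h e k * (dn g 1 (2 * j) * dn h 2 (2 * j)) = eprod g h e k := by
  nth_rewrite 1 [← T.eprod_up_up h1 h2]
  rw [mul_assoc, T.up_up_mul_dn_dn (by omega), mul_one]

theorem heckeSub_le_stepSpan (hn : 1 ≤ n) {u : B} (hu : u ∈ heckeSub R g 1 (n + 1)) :
    u ∈ stepSpan R g h e n := by
  refine Submodule.span_le.mpr ?_ (T.mem_span_mul_dn_h (by omega) hn hu)
  rintro _ ⟨v, hv, i, l, hi, hl, rfl⟩
  refine mul_mem_stepSpan (heckeSub_le_brauerSub le_rfl le_rfl hv) ?_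
  cases l with
  | zero => exact mem_stepSpan_of_mem (Subalgebra.one_mem _)
  | succ l =>
    rw [dn_succ, show i + l = n by omega, T.h_eq]
    refine stepSpan_mul_mem (dn_mem fun j _ _ => T.h_mem (heckeSub_le_brauerSub le_rfl le_rfl
      (g_mem_heckeSub (by omega) (by omega)))) (Submodule.add_mem _ (Submodule.smul_mem _ _
        (Submodule.subset_span (Or.inl (Or.inr ⟨1, Subalgebra.one_mem _, 1, Subalgebra.one_mem _,
          by simp⟩)))) (Submodule.smul_mem _ _ (mem_stepSpan_of_mem (Subalgebra.one_mem _))))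

/-- All left coset words that meet e_(k) reduce to the one ending at index 2. For even `i`, e_(k)
emits an inverse word of crossings: one half commutes to the left and the other prolongs the word
down to 2. For odd `i` the last letter is first absorbed into a scalar. -/
theorem exists_dn_mul_eprod {i l k : ℕ} (hi : 1 ≤ i) (hl : i + l = n + 1) (hik : i ≤ 2 * k)
    (hk : 2 * k ≤ n + 1) :
    ∃ c ∈ heckeSub R g 1 n, dn h i l * eprod g h e k = c * (dn h 2 (n - 1) * eprod g h e k) := by
  have even : ∀ p l, p < k → 2 * p + 2 + l = n + 1 → ∃ c ∈ heckeSub R g 1 n,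
      dn h (2 * p + 2) l * eprod g h e k = c * (dn h 2 (n - 1) * eprod g h e k) := by
    intro p l hp hl
    refine ⟨dn g 1 (2 * p), dn_mem fun j _ _ => g_mem_heckeSub (by omega) (by omega), ?_⟩
    have hc : Commute (dn h (2 * p + 2) l) (dn g 1 (2 * p)) :=
      commute_dn fun i _ _ => (commute_dn fun j _ _ =>
        T.cgh (by omega) (by omega) (by omega) (by omega) (by omega)).symm
    nth_rewrite 1 [← T.dn_dn_eprod hp hk]
    rw [← mul_assoc, ← mul_assoc, hc.eq, show n - 1 = 2 * p + l by omega, dn_add,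
      add_comm 2 (2 * p)]
    simp only [mul_assoc]
  rcases Nat.even_or_odd' i with ⟨p, rfl | rfl⟩
  · obtain ⟨p, rfl⟩ : ∃ m, p = m + 1 := ⟨p - 1, by omega⟩
    exact even p l (by omega) (by omega)
  · obtain ⟨l, rfl⟩ : ∃ m, l = m + 1 := ⟨l - 1, by omega⟩
    obtain ⟨c, hc, h1⟩ := even p l (by omega) (by omega)
    refine ⟨q' • c, Subalgebra.smul_mem _ hc _, ?_⟩
    rw [dn_succ', mul_assoc, T.h_eprod (by omega) hk, mul_smul_comm, h1, smul_mul_assoc]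

/-- The mirror image of `exists_dn_mul_eprod`, resting on the right-hand absorption rules for e_(k).
-/
theorem exists_eprod_mul_up {i l k : ℕ} (hi : 1 ≤ i) (hl : i + l = n + 1) (hik : i ≤ 2 * k)
    (hk : 2 * k ≤ n + 1) :
    ∃ c ∈ heckeSub R g 1 n, eprod g h e k * up g i l = eprod g h e k * up g 2 (n - 1) * c := by
  have even : ∀ p l, p < k → 2 * p + 2 + l = n + 1 → ∃ c ∈ heckeSub R g 1 n,
      eprod g h e k * up g (2 * p + 2) l = eprod g h e k * up g 2 (n - 1) * c := by
    intro p l hp hl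
    refine ⟨up h 1 (2 * p), up_mem fun j _ _ => T.h_mem (g_mem_heckeSub (by omega) (by omega)), ?_⟩
    have hc : Commute (up h 1 (2 * p)) (up g (2 * p + 2) l) :=
      commute_up fun i _ _ => (commute_up fun j _ _ =>
        T.cgh (by omega) (by omega) (by omega) (by omega) (by omega)).symm
    nth_rewrite 1 [← T.eprod_up_up hp hk]
    rw [mul_assoc, mul_assoc, hc.eq, show n - 1 = 2 * p + l by omega, up_add, add_comm 2 (2 * p)]
    simp only [mul_assoc]
  rcases Nat.even_or_odd' i with ⟨p, rfl | rfl⟩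
  · obtain ⟨p, rfl⟩ : ∃ m, p = m + 1 := ⟨p - 1, by omega⟩
    exact even p l (by omega) (by omega)
  · obtain ⟨l, rfl⟩ : ∃ m, l = m + 1 := ⟨l - 1, by omega⟩
    obtain ⟨c, hc, h1⟩ := even p l (by omega) (by omega)
    refine ⟨q • c, Subalgebra.smul_mem _ hc _, ?_⟩
    rw [up_succ, ← mul_assoc, T.eprod_g (by omega) hk, smul_mul_assoc, h1, mul_smul_comm]

/-- Everything in e_(k+1) except its leading `e` can be moved to the right of the long word into the
algebra on `n` strands. Hence a single double coset, that of `conjE`, serves all `k`. -/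
theorem exists_dn_mul_eprod_mul_up {k : ℕ} (hk : 2 * k + 2 ≤ n + 1) :
    ∃ c ∈ brauerSub R g e n,
      dn h 2 (n - 1) * eprod g h e (k + 1) * up g 2 (n - 1) = conjE g h e n * c := by
  obtain ⟨l, hl⟩ : ∃ l, n - 1 = 2 * k + l := ⟨n - 1 - 2 * k, by omega⟩
  have hmem : ∀ i, 1 ≤ i → i < 1 + 2 * k → g i ∈ brauerSub R g e n := fun i h1 h2 =>
    heckeSub_le_brauerSub le_rfl le_rfl (g_mem_heckeSub h1 (by omega))
  refine ⟨up h 1 (2 * k) * eprod g h e k * dn g 1 (2 * k), Subalgebra.mul_mem _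
    (Subalgebra.mul_mem _ (up_mem fun i h1 h2 => T.h_mem (hmem i h1 h2))
      (T.eprod_mem_brauerSub (by omega))) (dn_mem hmem), ?_⟩
  have c1 : Commute (dn g 1 (2 * k)) (up g (2 + 2 * k) l) :=
    commute_up fun i _ _ => (commute_dn fun j _ _ =>
      T.cgg (by omega) (by omega) (by omega) (by omega) (by omega)).symm
  have c2 : Commute (eprod g h e k) (up g (2 + 2 * k) l) :=
    commute_up fun i _ _ => T.commute_eprod_g (by omega) (by omega)
  have c3 : Commute (up h 1 (2 * k)) (up g (2 + 2 * k) l) :=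
    commute_up fun i _ _ => (commute_up fun j _ _ =>
      T.cgh (by omega) (by omega) (by omega) (by omega) (by omega)).symm
  have e1 : eprod g h e (k + 1) * up g 2 (n - 1) =
      e * up g 2 (n - 1) * (up h 1 (2 * k) * eprod g h e k * dn g 1 (2 * k)) := by
    nth_rewrite 1 [← T.eprod_dn_dn (j := k) (k := k + 1) (by omega) (by omega)]
    rw [hl, up_add]
    calc _ = eprod g h e (k + 1) * (dn g 1 (2 * k) * ((dn h 2 (2 * k) * up g 2 (2 * k)) *
          up g (2 + 2 * k) l)) := by simp only [mul_assoc]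
      _ = e * up g 2 (2 * k) * (up h 1 (2 * k) * (eprod g h e k * up g (2 + 2 * k) l)) *
          dn g 1 (2 * k) := by
        rw [dn_mul_up fun i _ _ => T.hg (by omega) (by omega), one_mul, c1.eq, T.eprod_succ]
        simp only [mul_assoc]
      _ = e * up g 2 (2 * k) * (up h 1 (2 * k) * up g (2 + 2 * k) l) * eprod g h e k *
          dn g 1 (2 * k) := by rw [c2.eq]; simp only [mul_assoc]
      _ = _ := by rw [c3.eq]; simp only [mul_assoc]
  rw [mul_assoc, e1, conjE]
  simp only [mul_assoc]

/-- The `q`-Brauer algebra on `n + 1` strands is spanned by `A_n`, `A_n g_n A_n` and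
`A_n (g_n⁻¹ ⋯ g_2⁻¹ e g_2 ⋯ g_n) A_n`. -/
theorem mem_stepSpan (hn : 1 ≤ n) {x : B} (hx : x ∈ brauerSub R g e (n + 1)) :
    x ∈ stepSpan R g h e n := by
  refine Submodule.span_le.mpr ?_ (T.mem_span_hecke_eprod_hecke hx)
  rintro _ ⟨k, u, v, hk, hu, hv, rfl⟩
  refine mul_mul_mem_of_mem_span (a := u * eprod g h e k) (b := 1) ?_
    (T.mem_span_up_g_mul (by omega) hn hv) |> fun hh => by simpa using hh
  rintro _ ⟨b, hb, j, l', hj, hl', rfl⟩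
  rw [mul_one, ← mul_assoc]
  refine stepSpan_mul_mem (heckeSub_le_brauerSub le_rfl le_rfl hb) ?_
  rw [mul_assoc]
  refine mem_mul_of_mem_span ?_ (T.mem_span_mul_dn_h (by omega) hn hu)
  rintro _ ⟨a, ha, i, l, hi, hl, rfl⟩
  rw [mul_assoc a]
  refine mul_mem_stepSpan (heckeSub_le_brauerSub le_rfl le_rfl ha) ?_
  have hdn : dn h i l ∈ heckeSub R g 1 (n + 1) := dn_mem fun m _ _ =>
    T.h_mem (g_mem_heckeSub (by omega) (by omega))
  have hup : up g j l' ∈ heckeSub R g 1 (n + 1) := up_mem fun m _ _ =>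
    g_mem_heckeSub (by omega) (by omega)
  -- If e_(k) does not meet one of the two coset words, it commutes with it; moreover 2k ≤ n, so it
  -- moves into the smaller algebra and a Hecke element remains.
  rcases Nat.lt_or_ge (2 * k) i with hik | hik
  · have hc : Commute (eprod g h e k) (dn h i l) :=
      commute_dn fun m _ _ => T.commute_eprod_h (by omega) (by omega)
    rw [← mul_assoc, ← hc.eq, mul_assoc]
    exact mul_mem_stepSpan (T.eprod_mem_brauerSub (by omega))
      (T.heckeSub_le_stepSpan hn (Subalgebra.mul_mem _ hdn hup))
  rcases Nat.lt_or_ge (2 * k) j with hjk | hjk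
  · have hc : Commute (eprod g h e k) (up g j l') :=
      commute_up fun m _ _ => T.commute_eprod_g (by omega) (by omega)
    rw [hc.eq, ← mul_assoc]
    exact stepSpan_mul_mem (T.eprod_mem_brauerSub (by omega))
      (T.heckeSub_le_stepSpan hn (Subalgebra.mul_mem _ hdn hup))
  obtain ⟨c, hc, h1⟩ := T.exists_dn_mul_eprod hi hl hik hk
  obtain ⟨c', hc', h2⟩ := T.exists_eprod_mul_up hj hl' hjk hk
  obtain ⟨k, rfl⟩ : ∃ m, k = m + 1 := ⟨k - 1, by omega⟩
  obtain ⟨c'', hc'', h3⟩ := T.exists_dn_mul_eprod_mul_up (k := k) (by omega)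
  have e1 : dn h i l * (eprod g h e (k + 1) * up g j l') = c * (conjE g h e n * c'') * c' := by
    rw [← h3, ← mul_assoc, h1]
    calc _ = c * dn h 2 (n - 1) * (eprod g h e (k + 1) * up g j l') := by simp only [mul_assoc]
      _ = _ := by rw [h2]; simp only [mul_assoc]
  rw [e1]
  refine stepSpan_mul_mem (heckeSub_le_brauerSub le_rfl le_rfl hc')
    (mul_mem_stepSpan (heckeSub_le_brauerSub le_rfl le_rfl hc) (Submodule.subset_span
      (Or.inr ⟨1, Subalgebra.one_mem _, c'', hc'', by rw [one_mul]⟩)))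

end Tuple

end QBrauer

/-! ### The corner of ē_(k) as a tuple on fewer strands. -/

namespace QBrauer

namespace Tuple

section Corner

variable {R B : Type*} [CommRing R] [Ring B] [Algebra R B] {q q' r d d' : R} {n : ℕ}
  {g h : ℕ → B} {e : B}

/-- The element `x` in the corner of `p` and the scalar `s` in the complementary corner. -/
def ext (p x : B) (s : R) : B := p * x + s • (1 - p)

theorem ext_mul {p x y : B} (hp : p * p = p) (hx : Commute p x) (s t : R) :
    ext p x s * ext p y t = ext p (x * y) (s * t) := by
  have h1 : p * (1 - p) = 0 := by rw [mul_sub, hp, mul_one, sub_self]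
  have h2 : (1 - p) * p = 0 := by rw [sub_mul, hp, one_mul, sub_self]
  have h3 : (1 - p) * (1 - p) = 1 - p := by rw [sub_mul, one_mul, h1, sub_zero]
  have h4 : x * (1 - p) = (1 - p) * x := by
    rw [mul_sub, sub_mul, hx.eq, mul_one, one_mul]
  have h5 : p * x * (p * y) = p * (x * y) := by
    rw [hx.eq, mul_assoc, ← mul_assoc p, hp, ← mul_assoc, ← hx.eq, mul_assoc]
  have h6 : p * x * (1 - p) = 0 := by rw [mul_assoc, h4, ← mul_assoc, h1, zero_mul]
  have h7 : (1 - p) * (p * y) = 0 := by rw [← mul_assoc, h2, zero_mul]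
  rw [ext, ext, ext, add_mul, mul_add, mul_add, h5, mul_smul_comm, h6, smul_zero, add_zero,
    smul_mul_assoc, h7, smul_zero, zero_add, smul_mul_smul_comm, h3]

theorem mul_ext {p x : B} (hp : p * p = p) (s : R) : p * ext p x s = p * x := by
  rw [ext, mul_add, ← mul_assoc, hp, mul_smul_comm, mul_sub, hp, mul_one, sub_self, smul_zero,
    add_zero]

theorem smul_ext (p x : B) (c s : R) : c • ext p x s = ext p (c • x) (c * s) := by
  rw [ext, ext, smul_add, smul_smul, mul_smul_comm]

theorem ext_add (p x y : B) (s t : R) : ext p x s + ext p y t = ext p (x + y) (s + t) := by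
  rw [ext, ext, ext, mul_add, add_smul]; abel

theorem smul_ext_add (p x : B) (a b s : R) :
    a • ext p x s + b • (1 : B) = ext p (a • x + b • 1) (a * s + b) := by
  have h1 : (1 : B) = ext p 1 (1 : R) := by simp [ext]
  nth_rewrite 1 [h1]
  rw [smul_ext, smul_ext, ext_add, mul_one]

theorem ext_congr {p x y : B} {s t : R} (h1 : p * x = p * y) (h2 : s = t) :
    ext p x s = ext p y t := by rw [ext, ext, h1, h2]

/-- The idempotent `δ⁻ᵏ e₍ₖ₎`. -/
def ebar (d' : R) (g h : ℕ → B) (e : B) (k : ℕ) : B := d' ^ k • eprod g h e k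

variable (T : Tuple q q' r d d' n g h e)
include T

theorem d'_pow_mul (k : ℕ) : d' ^ k * d ^ k = 1 := by
  rw [← mul_pow, mul_comm, T.dd, one_pow]

theorem ebar_mul_ebar {j k : ℕ} (h1 : j ≤ k) (h2 : 2 * k ≤ n) :
    ebar d' g h e j * ebar d' g h e k = ebar d' g h e k := by
  rw [ebar, ebar, smul_mul_smul_comm, T.eprod_mul_eprod h1 h2, smul_smul, mul_right_comm,
    T.d'_pow_mul, one_mul]

theorem ebar_mul_ebar' {j k : ℕ} (h1 : j ≤ k) (h2 : 2 * k ≤ n) :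
    ebar d' g h e k * ebar d' g h e j = ebar d' g h e k := by
  rw [ebar, ebar, smul_mul_smul_comm, T.eprod_mul_eprod' h1 h2, smul_smul, mul_assoc,
    T.d'_pow_mul, mul_one]

theorem commute_ebar_g {k i : ℕ} (h1 : 2 * k < i) (h2 : i < n) :
    Commute (ebar d' g h e k) (g i) := (T.commute_eprod_g h1 h2).smul_left _

theorem commute_ebar_h {k i : ℕ} (h1 : 2 * k < i) (h2 : i < n) :
    Commute (ebar d' g h e k) (h i) := (T.commute_eprod_h h1 h2).smul_left _

theorem corner_eTwo {k : ℕ} (h1 : 2 * k + 4 ≤ n) :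
    d • ebar d' g h e (k + 1) * (g (2 + 2 * k) * g (3 + 2 * k) * h (1 + 2 * k) * h (2 + 2 * k)) *
      (d • ebar d' g h e (k + 1)) = (d' ^ k) • eprod g h e (k + 2) := by
  have := T.eprod_wd_eprod (k := k) (by omega)
  rw [wd] at this
  rw [add_comm 2, add_comm 3, add_comm 1, ebar, smul_smul, smul_mul_assoc, smul_mul_assoc,
    mul_smul_comm, this, smul_smul, smul_smul]
  congr 1
  rw [pow_succ]
  linear_combination (d' ^ k * (d * d' + 1)) * T.dd + (d' ^ k * d * d' * d * d') * T.d'_pow_mul k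

/-- The corner of the idempotent `δ⁻ᵏ e₍ₖ₎` carries a `q`-Brauer tuple on `n - 2 k` strands. -/
theorem corner {m k : ℕ} (hm : m + 2 * k ≤ n) (hk : 2 * k ≤ n) :
    Tuple q q' r d d' m (fun i => ext (ebar d' g h e k) (g (i + 2 * k)) q)
      (fun i => ext (ebar d' g h e k) (h (i + 2 * k)) q')
      (ext (ebar d' g h e k) (d • ebar d' g h e (k + 1)) (0 : R)) := by
  -- The corner has unit `p` rather than 1. The scalars `g = q`, `h = q'`, `e = 0` solve all
  -- relations used, so placing them on the complement `1 - p` gives a tuple with respect to the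
  -- full unit.
  set p := ebar d' g h e k with hp
  have hpp : p * p = p := T.ebar_mul_ebar le_rfl hk
  have cg : ∀ i, 1 ≤ i → i < m → Commute p (g (i + 2 * k)) := fun i h1 h2 =>
    T.commute_ebar_g (by omega) (by omega)
  have ch : ∀ i, 1 ≤ i → i < m → Commute p (h (i + 2 * k)) := fun i h1 h2 =>
    T.commute_ebar_h (by omega) (by omega)
  have pe : 2 ≤ m → p * ebar d' g h e (k + 1) = ebar d' g h e (k + 1) := fun h2 =>
    T.ebar_mul_ebar (by omega) (by omega)
  have ep : 2 ≤ m → ebar d' g h e (k + 1) * p = ebar d' g h e (k + 1) := fun h2 =>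
    T.ebar_mul_ebar' (by omega) (by omega)
  have ce : 2 ≤ m → Commute p (d • ebar d' g h e (k + 1)) := fun h2 =>
    Commute.smul_right ((pe h2).trans (ep h2).symm) _
  have cw : 4 ≤ m → Commute p (g (2 + 2 * k) * g (3 + 2 * k) * h (1 + 2 * k) * h (2 + 2 * k)) :=
    fun h4 => (((cg 2 (by omega) (by omega)).mul_right (cg 3 (by omega) (by omega))).mul_right
      (ch 1 (by omega) (by omega))).mul_right (ch 2 (by omega) (by omega))
  have hw : 4 ≤ m → ext p (g (2 + 2 * k)) q * ext p (g (3 + 2 * k)) q *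
      ext p (h (1 + 2 * k)) q' * ext p (h (2 + 2 * k)) q' =
      ext p (g (2 + 2 * k) * g (3 + 2 * k) * h (1 + 2 * k) * h (2 + 2 * k)) (q * q * q' * q') := by
    intro h4
    have c2 := cg 2 (by omega) (by omega)
    have c3 := cg 3 (by omega) (by omega)
    rw [ext_mul hpp c2, ext_mul hpp (c2.mul_right c3),
      ext_mul hpp ((c2.mul_right c3).mul_right (ch 1 (by omega) (by omega)))]
  refine ⟨T.qq, T.dd, T.dq, ?_, ?_, ?_, ?_, ?_, ?_, ?_, ?_, ?_, ?_, ?_⟩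
  · intro i
    rw [T.h_eq, smul_ext_add]
    exact ext_congr rfl (by linear_combination -T.qq)
  · intro i h1 h2
    rw [ext_mul hpp (cg i h1 h2), T.sq _ (by omega) (by omega)]
    rw [smul_ext_add]
    exact ext_congr rfl (by ring)
  · intro i h1 h2
    have c1 := cg i h1 (by omega)
    have c2 := cg (i + 1) (by omega) h2
    rw [ext_mul hpp c1, ext_mul hpp (c1.mul_right c2), ext_mul hpp c2,
      ext_mul hpp (c2.mul_right c1)]
    refine ext_congr ?_ rfl
    rw [show i + 1 + 2 * k = i + 2 * k + 1 by ring, T.braid _ (by omega) (by omega)]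
  · intro i j h1 h2 h3
    rw [ext_mul hpp (cg i h1 (by omega)), ext_mul hpp (cg j (by omega) h3),
      T.comm _ _ (by omega) (by omega) (by omega)]
  · intro h2
    rw [ext_mul hpp (ce h2), smul_ext]
    refine ext_congr ?_ (by ring)
    rw [smul_mul_smul_comm, T.ebar_mul_ebar le_rfl (by omega), smul_smul]
  · intro i h1 h2
    rw [ext_mul hpp (ce (by omega)), ext_mul hpp (cg i (by omega) h2), smul_mul_assoc,
      (T.commute_ebar_g (by omega) (by omega)).eq, mul_smul_comm]
    exact ext_congr rfl (by ring)
  · intro h2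
    rw [ext_mul hpp (ce h2), smul_ext]
    refine ext_congr ?_ (by ring)
    rw [smul_mul_assoc, ebar, smul_mul_assoc, add_comm 1, T.eprod_g (by omega) (by omega),
      smul_comm q, smul_comm q]
  · intro h2
    rw [ext_mul hpp (cg 1 (by omega) (by omega)), smul_ext]
    refine ext_congr ?_ (by ring)
    have : g (1 + 2 * k) * (d • ebar d' g h e (k + 1)) = q • d • ebar d' g h e (k + 1) := by
      rw [mul_smul_comm, ebar, mul_smul_comm, add_comm 1, T.g_eprod (by omega) (by omega),
        smul_comm q, smul_comm q]
    rw [this]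
  · intro h2
    rw [ext_mul hpp (ce (by omega)),
      ext_mul hpp ((ce (by omega)).mul_right (cg 2 (by omega) (by omega))), smul_ext]
    refine ext_congr ?_ (by ring)
    congr 1
    rw [ebar, smul_smul, smul_mul_assoc, smul_mul_assoc, mul_smul_comm, add_comm 2,
      T.eprod_g_eprod (by omega), smul_smul, smul_smul, smul_smul]
    congr 1
    rw [pow_succ]
    linear_combination (r * d * d' ^ k * d' * d * d') * T.d'_pow_mul k +
      r * d * d' * d' ^ k * T.dd
  · intro h4
    rw [hw h4, ext_mul hpp (ce (by omega)), ext_mul hpp ((ce (by omega)).mul_right (cw h4)),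
      T.corner_eTwo (by omega), ext_mul hpp (cw h4)]
    refine ext_congr ?_ (by ring)
    have := T.wd_eprod (k := k + 2) (l := k) (by omega) (by omega)
    rw [wd] at this
    rw [add_comm 2, add_comm 3, add_comm 1, mul_smul_comm, this]
  · intro h4
    rw [hw h4, ext_mul hpp (ce (by omega)), ext_mul hpp ((ce (by omega)).mul_right (cw h4)),
      T.corner_eTwo (by omega), ext_mul hpp]
    · refine ext_congr ?_ (by ring)
      have := T.eprod_wd (k := k + 2) (l := k) (by omega) (by omega)
      rw [wd] at this
      rw [add_comm 2, add_comm 3, add_comm 1, smul_mul_assoc, this]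
    · refine Commute.smul_right ?_ _
      have h1 := T.eprod_mul_eprod (j := k) (k := k + 2) (by omega) (by omega)
      have h2 := T.eprod_mul_eprod' (j := k) (k := k + 2) (by omega) (by omega)
      exact Commute.smul_left (h1.trans h2.symm) _

end Corner

end Tuple

end QBrauer

/-! ### The q-Brauer algebra over a field and its universal property. -/

namespace QBrauer

universe u

section Br

variable {K : Type u} [Field K] {q r δ : K}

theorem br_tuple (hq : q ≠ 0) (hδ : δ ≠ 0) (hr : δ * (q - 1) = r - 1) (n : ℕ) :
    Tuple q q⁻¹ r δ δ⁻¹ n (g q r δ n) (gInv q r δ n) (e q r δ n) where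
  qq := mul_inv_cancel₀ hq
  dd := mul_inv_cancel₀ hδ
  dq := hr
  h_eq := gInv_eq
  sq _ h1 h2 := g_sq h1 h2
  braid i h1 h2 := by
    simpa [g] using toBr_rel (Rel.hecke_braid (q := q) (r := r) (δ := δ) i h1 h2)
  comm i j h1 h2 h3 := by
    simpa [g] using toBr_rel (Rel.hecke_comm (q := q) (r := r) (δ := δ) i j h1 h2 h3)
  e_sq h := by simpa [e] using toBr_rel (Rel.e_sq (q := q) (r := r) (δ := δ) h)
  e_comm i h1 h2 := by
    simpa [g, e] using toBr_rel (Rel.e_comm (q := q) (r := r) (δ := δ) i h1 h2)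
  e_g1 h := by simpa [g, e] using toBr_rel (Rel.e_g1 (q := q) (r := r) (δ := δ) h)
  g1_e h := by simpa [g, e] using toBr_rel (Rel.g1_e (q := q) (r := r) (δ := δ) h)
  e_g2_e h := by simpa [g, e] using toBr_rel (Rel.e_g2_e (q := q) (r := r) (δ := δ) h)
  w_eTwo h := by
    simpa [g, gInv, e, wFree, eTwoFree] using
      toBr_rel (Rel.w_eTwo (q := q) (r := r) (δ := δ) h)
  eTwo_w h := by
    simpa [g, gInv, e, wFree, eTwoFree] using
      toBr_rel (Rel.eTwo_w (q := q) (r := r) (δ := δ) h)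

theorem toBr_surjective (n : ℕ) : Function.Surjective (toBr q r δ n) :=
  RingQuot.mkAlgHom_surjective K _

theorem toBr_ι_g {n i : ℕ} (hi : 1 ≤ i ∧ i < n) :
    toBr q r δ n (FreeAlgebra.ι K (Gen.g i hi)) = g q r δ n i := by
  rw [g, gFree, dif_pos hi]

theorem toBr_ι_e {n : ℕ} (hn : 2 ≤ n) :
    toBr q r δ n (FreeAlgebra.ι K (Gen.e hn)) = e q r δ n := by
  rw [e, eFree, dif_pos hn]

theorem brauerSub_eq_top (n : ℕ) : brauerSub K (g q r δ n) (e q r δ n) n = ⊤ := by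
  rw [eq_top_iff]
  rintro x -
  obtain ⟨y, rfl⟩ := toBr_surjective n x
  induction y using FreeAlgebra.induction with
  | grade0 c => rw [AlgHom.commutes]; exact Subalgebra.algebraMap_mem _ c
  | grade1 s =>
    cases s with
    | g i hi =>
      rw [toBr_ι_g hi]
      exact Algebra.subset_adjoin (Or.inl ⟨i, hi.1, hi.2, rfl⟩)
    | e hn =>
      rw [toBr_ι_e hn]
      exact Algebra.subset_adjoin (Or.inr ⟨hn, rfl⟩)
  | mul a b ha hb => rw [map_mul]; exact Subalgebra.mul_mem _ ha hb
  | add a b ha hb => rw [map_add]; exact Subalgebra.add_mem _ ha hb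

theorem br_algHom_ext {n : ℕ} {B : Type*} [Ring B] [Algebra K B] {φ ψ : Br q r δ n →ₐ[K] B}
    (hg : ∀ i, 1 ≤ i → i < n → φ (g q r δ n i) = ψ (g q r δ n i))
    (he : 2 ≤ n → φ (e q r δ n) = ψ (e q r δ n)) : φ = ψ := by
  refine AlgHom.ext_of_adjoin_eq_top (brauerSub_eq_top n) ?_
  rintro _ (⟨i, h1, h2, rfl⟩ | ⟨hn, rfl⟩)
  · exact hg i h1 h2
  · exact he hn

/-- The universal property of the `q`-Brauer algebra. -/
theorem Tuple.exists_lift {n : ℕ} {B : Type*} [Ring B] [Algebra K B] {g' h' : ℕ → B} {e' : B}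
    (T : Tuple q q⁻¹ r δ δ⁻¹ n g' h' e') :
    ∃ φ : Br q r δ n →ₐ[K] B, (∀ i, 1 ≤ i → i < n → φ (g q r δ n i) = g' i) ∧
      (2 ≤ n → φ (e q r δ n) = e') := by
  set f : Gen n → B := fun s => match s with
    | .g i _ => g' i
    | .e _ => e' with hf
  have fg : ∀ i, 1 ≤ i → i < n → FreeAlgebra.lift K f (gFree K n i) = g' i := by
    intro i h1 h2
    rw [gFree, dif_pos ⟨h1, h2⟩, FreeAlgebra.lift_ι_apply]
  have fh : ∀ i, 1 ≤ i → i < n → FreeAlgebra.lift K f (gInvFree q n i) = h' i := by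
    intro i h1 h2
    rw [gInvFree, map_add, map_smul, map_smul, fg i h1 h2, map_one, T.h_eq]
  have fe : 2 ≤ n → FreeAlgebra.lift K f (eFree K n) = e' := by
    intro hn
    rw [eFree, dif_pos hn, FreeAlgebra.lift_ι_apply]
  have fw : 4 ≤ n → FreeAlgebra.lift K f (wFree q n) = g' 2 * g' 3 * h' 1 * h' 2 := by
    intro hn
    rw [wFree, map_mul, map_mul, map_mul, fg 2 (by omega) (by omega), fg 3 (by omega) (by omega),
      fh 1 (by omega) (by omega), fh 2 (by omega) (by omega)]
  have frel : ∀ ⦃x y⦄, Rel q r δ n x y → FreeAlgebra.lift K f x = FreeAlgebra.lift K f y := by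
    intro x y hxy
    cases hxy with
    | hecke_sq i h1 h2 =>
      simp only [map_mul, map_add, map_smul, map_one, fg i h1 h2, T.sq i h1 h2]
    | hecke_braid i h1 h2 =>
      simp only [map_mul, fg i h1 (by omega), fg (i + 1) (by omega) h2, T.braid i h1 h2]
    | hecke_comm i j h1 h2 h3 =>
      simp only [map_mul, fg i h1 (by omega), fg j (by omega) h3, T.comm i j h1 h2 h3]
    | e_sq h => simp only [map_mul, map_smul, fe h, T.e_sq h]
    | e_comm i h1 h2 =>
      simp only [map_mul, fe (by omega), fg i (by omega) h2, T.e_comm i h1 h2]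
    | e_g1 h => simp only [map_mul, map_smul, fe h, fg 1 le_rfl (by omega), T.e_g1 h]
    | g1_e h => simp only [map_mul, map_smul, fe h, fg 1 le_rfl (by omega), T.g1_e h]
    | e_g2_e h =>
      simp only [map_mul, map_smul, fe (by omega), fg 2 (by omega) (by omega), T.e_g2_e h]
    | e_g2Inv_e h =>
      simp only [map_mul, map_smul, fe (by omega), fh 2 (by omega) (by omega), T.e_h2_e h]
    | w_eTwo h => simp only [eTwoFree, map_mul, fe (by omega), fw h, T.w_eTwo h]
    | eTwo_w h => simp only [eTwoFree, map_mul, fe (by omega), fw h, T.eTwo_w h]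
  refine ⟨RingQuot.liftAlgHom K ⟨FreeAlgebra.lift K f, frel⟩, fun i h1 h2 => ?_, fun hn => ?_⟩
  · rw [g, toBr, RingQuot.liftAlgHom_mkAlgHom_apply, fg i h1 h2]
  · rw [e, toBr, RingQuot.liftAlgHom_mkAlgHom_apply, fe hn]

theorem ek_eq_eprod (n k : ℕ) : ek q r δ n k = eprod (g q r δ n) (gInv q r δ n) (e q r δ n) k := by
  induction k with
  | zero => rfl
  | succ k ih => rw [ek, eprod, ih]; rfl

theorem ekBar_eq_ebar (n k : ℕ) :
    ekBar q r δ n k = Tuple.ebar δ⁻¹ (g q r δ n) (gInv q r δ n) (e q r δ n) k := by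
  rw [ekBar, Tuple.ebar, ek_eq_eprod]

theorem incl_gInv {n i : ℕ} (h1 : 1 ≤ i) (h2 : i < n) :
    incl q r δ n (gInv q r δ n i) = gInv q r δ (n + 1) i := by
  rw [gInv_eq, gInv_eq, map_add, map_smul, map_smul, incl_g h1 h2, map_one]

theorem incl_eprod {n k : ℕ} (hk : 2 * k ≤ n) :
    incl q r δ n (eprod (g q r δ n) (gInv q r δ n) (e q r δ n) k) =
      eprod (g q r δ (n + 1)) (gInv q r δ (n + 1)) (e q r δ (n + 1)) k := by
  induction k with
  | zero => simp [eprod]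
  | succ k ih =>
    rw [eprod, eprod, map_mul, map_mul, map_mul, ih (by omega), incl_e (by omega),
      map_up _ _ (g q r δ (n + 1)) fun i _ _ => incl_g (by omega) (by omega),
      map_up _ _ (gInv q r δ (n + 1)) fun i _ _ => incl_gInv (by omega) (by omega)]

theorem incl_ebar {n k : ℕ} (hk : 2 * k ≤ n) :
    incl q r δ n (Tuple.ebar δ⁻¹ (g q r δ n) (gInv q r δ n) (e q r δ n) k) =
      Tuple.ebar δ⁻¹ (g q r δ (n + 1)) (gInv q r δ (n + 1)) (e q r δ (n + 1)) k := by
  rw [Tuple.ebar, Tuple.ebar, map_smul, incl_eprod hk]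

theorem brauerSub_le_range_incl (n : ℕ) :
    brauerSub K (g q r δ (n + 1)) (e q r δ (n + 1)) n ≤ (incl q r δ n).range := by
  refine Algebra.adjoin_le ?_
  rintro _ (⟨i, h1, h2, rfl⟩ | ⟨hn, rfl⟩)
  · exact ⟨_, incl_g h1 h2⟩
  · exact ⟨_, incl_e hn⟩

/-- The element `g_n⁻¹ ⋯ g_2⁻¹ e g_2 ⋯ g_n` of `Br_{n+1}`. -/
noncomputable def conjEl (q r δ : K) (n : ℕ) : Br q r δ (n + 1) :=
  Tuple.conjE (g q r δ (n + 1)) (gInv q r δ (n + 1)) (e q r δ (n + 1)) n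

/-- The form in which the three-piece decomposition is applied, both to compare traces and to show
that a functional vanishes. -/
theorem br_linearMap_ext (hq : q ≠ 0) (hδ : δ ≠ 0) (hr : δ * (q - 1) = r - 1) {n : ℕ}
    (hn : 1 ≤ n) {M : Type*} [AddCommGroup M] [Module K M] {f f' : Br q r δ (n + 1) →ₗ[K] M}
    (h1 : ∀ y, f (incl q r δ n y) = f' (incl q r δ n y))
    (h2 : ∀ y z, f (incl q r δ n y * g q r δ (n + 1) n * incl q r δ n z) =
      f' (incl q r δ n y * g q r δ (n + 1) n * incl q r δ n z))
    (h3 : ∀ y z, f (incl q r δ n y * conjEl q r δ n * incl q r δ n z) =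
      f' (incl q r δ n y * conjEl q r δ n * incl q r δ n z)) : f = f' := by
  ext x
  have hx : x ∈ brauerSub K (g q r δ (n + 1)) (e q r δ (n + 1)) (n + 1) := by
    rw [brauerSub_eq_top]; trivial
  have hx' := (br_tuple hq hδ hr (n + 1)).mem_stepSpan hn hx
  refine (Submodule.span_le.mpr ?_ : _ ≤ LinearMap.eqLocus f f') hx'
  rintro _ ((hy | ⟨a, ha, b, hb, rfl⟩) | ⟨a, ha, b, hb, rfl⟩)
  · obtain ⟨y, rfl⟩ := brauerSub_le_range_incl n hy
    exact h1 y
  · obtain ⟨y, rfl⟩ := brauerSub_le_range_incl n ha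
    obtain ⟨z, rfl⟩ := brauerSub_le_range_incl n hb
    exact h2 y z
  · obtain ⟨y, rfl⟩ := brauerSub_le_range_incl n ha
    obtain ⟨z, rfl⟩ := brauerSub_le_range_incl n hb
    exact h3 y z

theorem exists_algebraMap_eq {n : ℕ} (hn : n ≤ 1) (x : Br q r δ n) :
    ∃ c : K, algebraMap K _ c = x := by
  have hx : x ∈ brauerSub K (g q r δ n) (e q r δ n) n := by rw [brauerSub_eq_top]; trivial
  have : brauerSub K (g q r δ n) (e q r δ n) n ≤ ⊥ := by
    refine Algebra.adjoin_le ?_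
    rintro _ (⟨i, h1, h2, rfl⟩ | ⟨hn, rfl⟩) <;> omega
  exact Algebra.mem_bot.mp (this hx)

end Br

end QBrauer

/-! ### Tower traces and their values on corners. -/

namespace QBrauer

universe u

/-- A family of traces on the tower of `q`-Brauer algebras with prescribed values on the three
pieces that span `Br_{n+1}`. -/
structure TowerTrace {K : Type u} [Field K] (q r δ : K) where
  tr : ∀ n : ℕ, Br q r δ n →ₗ[K] K
  tr_one : ∀ n, tr n 1 = 1
  tr_comm : ∀ n (x y : Br q r δ n), tr n (x * y) = tr n (y * x)
  tr_incl : ∀ n y, tr (n + 1) (incl q r δ n y) = tr n y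
  tr_g : ∀ n, 1 ≤ n → ∀ y z, tr (n + 1) (incl q r δ n y * g q r δ (n + 1) n * incl q r δ n z) =
    r / δ * tr n (y * z)
  tr_conjEl : ∀ n, 1 ≤ n → ∀ y z,
    tr (n + 1) (incl q r δ n y * conjEl q r δ n * incl q r δ n z) = r * q⁻¹ / δ * tr n (y * z)

section Conjugate

variable {R B : Type*} [CommRing R] [Ring B] [Algebra R B] {q q' r d d' : R}
  {g h : ℕ → B} {e : B}

/-- The conjugate of `e₍ₖ₎` that occurs in the image of `g_n⁻¹ ⋯ g_2⁻¹ e g_2 ⋯ g_n` in the corner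
of `e₍ₖ₎`, for `k = j + 1`, in terms of a single generator with top index. -/
theorem Tuple.dn_mul_eprod_mul_up {n m j : ℕ} (T : Tuple q q' r d d' (m + 1) g h e) (hn : 1 ≤ n)
    (hm : m = n + 2 * (j + 1)) :
    d ^ j • (dn h (2 * j + 4) (n - 1) * eprod g h e (j + 2) * up g (2 * j + 4) (n - 1)) =
      eprod g h e (j + 1) * (g (2 * j + 2) * h (2 * j + 1)) * up g (2 * j + 3) (n - 1) * g m *
        (dn h (2 * j + 3) (n - 1) * h (2 * j + 2) * eprod g h e (j + 1)) := by
  have c1 : Commute (eprod g h e (j + 1)) (dn h (2 * j + 4) (n - 1)) :=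
    commute_dn fun i _ _ => T.commute_eprod_h (by omega) (by omega)
  have c2 : Commute (eprod g h e (j + 1)) (up g (2 * j + 4) (n - 1)) :=
    commute_up fun i _ _ => T.commute_eprod_g (by omega) (by omega)
  have c3 : Commute (g (2 * j + 2) * h (2 * j + 1)) (dn h (2 * j + 4) (n - 1)) :=
    commute_dn fun i _ _ => (T.cgh (by omega) (by omega) (by omega) (by omega)
      (by omega)).mul_left (T.chh (by omega) (by omega) (by omega) (by omega) (by omega))
  have c4 : Commute (h (2 * j + 2)) (up g (2 * j + 4) (n - 1)) :=
    commute_up fun i _ _ => T.chg (by omega) (by omega) (by omega) (by omega) (by omega)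
  have c5 : Commute (h (2 * j + 1)) (g (2 * j + 3)) :=
    T.chg (by omega) (by omega) (by omega) (by omega) (by omega)
  have hw : wd g h j = g (2 * j + 2) * h (2 * j + 1) * (g (2 * j + 3) * h (2 * j + 2)) := by
    rw [wd, mul_assoc (g (2 * j + 2)), ← c5.eq]; simp only [mul_assoc]
  have hup : up g (2 * j + 3) (n - 1) * g m = up g (2 * j + 3) (n - 1 + 1) := by
    rw [up_succ', show 2 * j + 3 + (n - 1) = m by omega]
  have hsh := T.up_mul_dn_shift (a := 2 * j + 3) (m := n - 1) (l := n - 1) (by omega) (by omega)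
    le_rfl
  rw [← smul_mul_assoc, ← mul_smul_comm, ← T.eprod_wd_eprod (by omega), hw]
  calc _ = (dn h (2 * j + 4) (n - 1) * eprod g h e (j + 1)) * (g (2 * j + 2) * h (2 * j + 1)) *
        g (2 * j + 3) * h (2 * j + 2) * (eprod g h e (j + 1) * up g (2 * j + 4) (n - 1)) := by
        simp only [mul_assoc]
    _ = eprod g h e (j + 1) * (dn h (2 * j + 4) (n - 1) * (g (2 * j + 2) * h (2 * j + 1))) *
        g (2 * j + 3) * (h (2 * j + 2) * up g (2 * j + 4) (n - 1)) * eprod g h e (j + 1) := by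
        rw [← c1.eq, c2.eq]; simp only [mul_assoc]
    _ = eprod g h e (j + 1) * (g (2 * j + 2) * h (2 * j + 1)) * (dn h (2 * j + 4) (n - 1) *
        up g (2 * j + 3) (n - 1 + 1)) * h (2 * j + 2) * eprod g h e (j + 1) := by
        rw [← c3.eq, c4.eq, up_succ]; simp only [mul_assoc]
    _ = _ := by
      rw [← hsh, ← hup]; simp only [mul_assoc]

/-- The braid relation rewrites the middle as h_{2j+1} h_{2j+2} g_{2j+1}. The outer letters are
absorbed with inverse scalars, and compressing h_{2j+2} supplies the factor q⁻¹ needed in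
`TowerTrace.tr_conj_eprod`. -/
theorem Tuple.eprod_mul_g_mul_h_mul_h_mul_eprod {m j : ℕ} (T : Tuple q q' r d d' m g h e)
    (hm : 2 * j + 2 < m) :
    eprod g h e (j + 1) * (g (2 * j + 2) * h (2 * j + 1)) * (h (2 * j + 2) * eprod g h e (j + 1)) =
      (q' * d ^ j) • eprod g h e (j + 1) := by
  have := T.hhg (i := 2 * j + 1) (by omega) (by omega)
  rw [show 2 * j + 1 + 1 = 2 * j + 2 by ring] at this
  calc _ = eprod g h e (j + 1) * (g (2 * j + 2) * (h (2 * j + 1) * h (2 * j + 2))) *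
        eprod g h e (j + 1) := by simp only [mul_assoc]
    _ = (eprod g h e (j + 1) * h (2 * j + 1)) * h (2 * j + 2) *
        (g (2 * j + 1) * eprod g h e (j + 1)) := by rw [← this]; simp only [mul_assoc]
    _ = _ := by
      rw [T.eprod_h (by omega) (by omega), T.g_eprod (by omega) (by omega), smul_mul_assoc,
        smul_mul_smul_comm, T.eprod_h_eprod hm, mul_comm q', T.qq, one_smul]

end Conjugate

namespace TowerTrace

variable {K : Type u} [Field K] {q r δ : K} (S : TowerTrace q r δ)
include S

/-- For `k = 0` this is the rule for `conjEl`. For `k = j + 1` the conjugated idempotent is, up to a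
scalar, A g_m C with A and C in Br_m. The rule for g_m then applies, and AC = q⁻¹δ^j e_(j+1), so the
same constant comes out by another route. -/
theorem tr_conj_eprod (hq : q ≠ 0) (hδ : δ ≠ 0) (hr : δ * (q - 1) = r - 1) {n m k : ℕ}
    (hn : 1 ≤ n) (hm : m = n + 2 * k) (y z : Br q r δ m) :
    S.tr (m + 1) (incl q r δ m y * (dn (gInv q r δ (m + 1)) (2 * k + 2) (n - 1) *
      (δ • Tuple.ebar δ⁻¹ (g q r δ (m + 1)) (gInv q r δ (m + 1)) (e q r δ (m + 1)) (k + 1)) *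
      up (g q r δ (m + 1)) (2 * k + 2) (n - 1)) * incl q r δ m z) =
    r * q⁻¹ / δ * S.tr m
      (y * Tuple.ebar δ⁻¹ (g q r δ m) (gInv q r δ m) (e q r δ m) k * z) := by
  cases k with
  | zero =>
    obtain rfl : m = n := by omega
    simp only [Tuple.ebar, zero_add, pow_zero, one_smul, eprod, mul_one, pow_one,
      mul_zero, up_zero, smul_smul, mul_inv_cancel₀ hδ]
    exact S.tr_conjEl m hn y z
  | succ j =>
    have T := br_tuple hq hδ hr (m + 1)
    have T' := br_tuple hq hδ hr m
    have h1 := T.dn_mul_eprod_mul_up hn hm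
    set A : Br q r δ m := eprod (g q r δ m) (gInv q r δ m) (e q r δ m) (j + 1) *
      (g q r δ m (2 * j + 2) * gInv q r δ m (2 * j + 1)) * up (g q r δ m) (2 * j + 3) (n - 1)
      with hA
    set C : Br q r δ m := dn (gInv q r δ m) (2 * j + 3) (n - 1) * gInv q r δ m (2 * j + 2) *
      eprod (g q r δ m) (gInv q r δ m) (e q r δ m) (j + 1) with hC
    have iA : incl q r δ m A = eprod (g q r δ (m + 1)) (gInv q r δ (m + 1)) (e q r δ (m + 1))
        (j + 1) * (g q r δ (m + 1) (2 * j + 2) * gInv q r δ (m + 1) (2 * j + 1)) *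
        up (g q r δ (m + 1)) (2 * j + 3) (n - 1) := by
      rw [hA, map_mul, map_mul, map_mul, incl_eprod (by omega), incl_g (by omega) (by omega),
        incl_gInv (by omega) (by omega),
        map_up _ _ (g q r δ (m + 1)) fun i _ _ => incl_g (by omega) (by omega)]
    have iC : incl q r δ m C = dn (gInv q r δ (m + 1)) (2 * j + 3) (n - 1) *
        gInv q r δ (m + 1) (2 * j + 2) *
        eprod (g q r δ (m + 1)) (gInv q r δ (m + 1)) (e q r δ (m + 1)) (j + 1) := by
      rw [hC, map_mul, map_mul, incl_eprod (by omega), incl_gInv (by omega) (by omega),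
        map_dn _ _ (gInv q r δ (m + 1)) fun i _ _ => incl_gInv (by omega) (by omega)]
    have hAC : A * C = (q⁻¹ * δ ^ j) • eprod (g q r δ m) (gInv q r δ m) (e q r δ m) (j + 1) := by
      rw [← T'.eprod_mul_g_mul_h_mul_h_mul_eprod (by omega), hA, hC]
      have hud := up_mul_dn (a := 2 * j + 3) (l := n - 1) (x := g q r δ m) (y := gInv q r δ m)
        fun i _ _ => T'.gh (by omega) (by omega)
      calc _ = eprod (g q r δ m) (gInv q r δ m) (e q r δ m) (j + 1) *
            (g q r δ m (2 * j + 2) * gInv q r δ m (2 * j + 1)) *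
            (up (g q r δ m) (2 * j + 3) (n - 1) * dn (gInv q r δ m) (2 * j + 3) (n - 1)) *
            (gInv q r δ m (2 * j + 2) *
              eprod (g q r δ m) (gInv q r δ m) (e q r δ m) (j + 1)) := by
            simp only [mul_assoc]
        _ = _ := by rw [hud, mul_one]
    rw [← iA, ← iC] at h1
    have h2 : dn (gInv q r δ (m + 1)) (2 * (j + 1) + 2) (n - 1) *
        (δ • Tuple.ebar δ⁻¹ (g q r δ (m + 1)) (gInv q r δ (m + 1)) (e q r δ (m + 1))
          (j + 1 + 1)) * up (g q r δ (m + 1)) (2 * (j + 1) + 2) (n - 1) =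
        (δ⁻¹ ^ (j + 1) * δ⁻¹ ^ j) • (incl q r δ m A * g q r δ (m + 1) m * incl q r δ m C) := by
      rw [← h1, Tuple.ebar, mul_smul_comm, mul_smul_comm, smul_mul_assoc, smul_mul_assoc,
        smul_smul, smul_smul]
      congr 1
      have : δ⁻¹ ^ j * δ ^ j = 1 := by rw [← mul_pow, inv_mul_cancel₀ hδ, one_pow]
      rw [mul_assoc _ _ (δ ^ j), this, mul_one, pow_succ', ← mul_assoc, mul_inv_cancel₀ hδ,
        one_mul]
    rw [h2, mul_smul_comm, smul_mul_assoc, map_smul]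
    have h3 : incl q r δ m y * (incl q r δ m A * g q r δ (m + 1) m * incl q r δ m C) *
        incl q r δ m z = incl q r δ m (y * A) * g q r δ (m + 1) m * incl q r δ m (C * z) := by
      simp only [map_mul, mul_assoc]
    rw [h3, S.tr_g m (by omega), ← mul_assoc, mul_assoc y, hAC, Tuple.ebar]
    simp only [mul_smul_comm, smul_mul_assoc, map_smul, smul_eq_mul]
    have : δ⁻¹ ^ j * δ ^ j = 1 := by rw [← mul_pow, inv_mul_cancel₀ hδ, one_pow]
    linear_combination (δ⁻¹ ^ (j + 1) * (r / δ) * q⁻¹ * S.tr m (y * eprod (g q r δ m)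
      (gInv q r δ m) (e q r δ m) (j + 1) * z)) * this

/-- The trace is multiplicative for the embedding of `Br_n` into the corner of `δ⁻ᵏ e₍ₖ₎`. -/
theorem tr_ebar_mul (hq : q ≠ 0) (hδ : δ ≠ 0) (hr : δ * (q - 1) = r - 1) (k : ℕ) :
    ∀ n m : ℕ, m = n + 2 * k → ∀ φ : Br q r δ n →ₐ[K] Br q r δ m,
      (∀ i, 1 ≤ i → i < n → φ (g q r δ n i) =
        Tuple.ext (Tuple.ebar δ⁻¹ (g q r δ m) (gInv q r δ m) (e q r δ m) k)
          (g q r δ m (i + 2 * k)) q) →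
      (2 ≤ n → φ (e q r δ n) =
        Tuple.ext (Tuple.ebar δ⁻¹ (g q r δ m) (gInv q r δ m) (e q r δ m) k)
          (δ • Tuple.ebar δ⁻¹ (g q r δ m) (gInv q r δ m) (e q r δ m) (k + 1)) (0 : K)) →
      ∀ x, S.tr m (Tuple.ebar δ⁻¹ (g q r δ m) (gInv q r δ m) (e q r δ m) k * φ x) =
        (r * q⁻¹ / δ ^ 2) ^ k * S.tr n x := by
  -- The outer induction is on `k`, the inner one on `n`. For `n = 0` the value at ē_(k+1) comes
  -- from the case (k, 2) evaluated at `e`; raising `n` uses the three-piece decomposition.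
  induction k with
  | zero =>
    intro n m hm φ hg he x
    obtain rfl : m = n := by omega
    have : φ = AlgHom.id K _ := by
      refine br_algHom_ext (fun i h1 h2 => ?_) fun hn => ?_
      · simp [hg i h1 h2, Tuple.ebar, Tuple.ext, eprod]
      · simp [he hn, Tuple.ebar, Tuple.ext, eprod, smul_smul, mul_inv_cancel₀ hδ]
    simp [this, Tuple.ebar, eprod]
  | succ k ihk =>
    intro n
    induction n with
    | zero =>
      intro m hm φ _ _ x
      obtain ⟨c, rfl⟩ := exists_algebraMap_eq (Nat.zero_le 1) x
      have hm' : m = 2 + 2 * k := by omega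
      have T := br_tuple hq hδ hr m
      obtain ⟨ψ, hψ1, hψ2⟩ := (T.corner (m := 2) (k := k) (by omega) (by omega)).exists_lift
      have h1 := ihk 2 m hm' ψ hψ1 hψ2 (e q r δ 2)
      have hpp := T.ebar_mul_ebar (j := k) (k := k) le_rfl (by omega)
      rw [hψ2 le_rfl, Tuple.mul_ext hpp, mul_smul_comm,
        T.ebar_mul_ebar (by omega) (by omega), map_smul, smul_eq_mul] at h1
      have h2 := S.tr_conjEl 1 le_rfl 1 1
      simp only [map_one, one_mul, mul_one, S.tr_one, conjEl, Tuple.conjE, Nat.sub_self, dn_zero,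
        up_zero] at h2
      have h3 : S.tr 2 (e q r δ 2) = r * q⁻¹ / δ := h2
      rw [h3] at h1
      rw [AlgHom.commutes, Algebra.algebraMap_eq_smul_one, Algebra.algebraMap_eq_smul_one,
        mul_smul_comm, mul_one, map_smul, map_smul, S.tr_one, smul_eq_mul, smul_eq_mul, mul_one]
      have h4 : S.tr m (Tuple.ebar δ⁻¹ (g q r δ m) (gInv q r δ m) (e q r δ m) (k + 1)) =
          (r * q⁻¹ / δ ^ 2) ^ (k + 1) := by
        apply mul_left_cancel₀ hδ
        have h5 : r * q⁻¹ / δ = δ * (r * q⁻¹ / δ ^ 2) := by field_simp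
        rw [h1, h5]
        ring
      rw [h4, mul_comm]
    | succ n ih =>
      intro m' hm' φ hg he
      obtain ⟨m, rfl⟩ : ∃ m, m' = m + 1 := ⟨m' - 1, by omega⟩
      have hm : m = n + 2 * (k + 1) := by omega
      have T := br_tuple hq hδ hr (m + 1)
      have T' := br_tuple hq hδ hr m
      obtain ⟨ψ, hψ1, hψ2⟩ := (T'.corner (m := n) (k := k + 1) (by omega) (by omega)).exists_lift
      have hpp := T.ebar_mul_ebar (j := k + 1) (k := k + 1) le_rfl (by omega)
      have hpp' := T'.ebar_mul_ebar (j := k + 1) (k := k + 1) le_rfl (by omega)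
      have hip := incl_ebar (q := q) (r := r) (δ := δ) (n := m) (k := k + 1) (by omega)
      have hie := fun hn : 2 ≤ n =>
        incl_ebar (q := q) (r := r) (δ := δ) (n := m) (k := k + 1 + 1) (by omega)
      set p := Tuple.ebar δ⁻¹ (g q r δ (m + 1)) (gInv q r δ (m + 1)) (e q r δ (m + 1)) (k + 1)
        with hp
      set p' := Tuple.ebar δ⁻¹ (g q r δ m) (gInv q r δ m) (e q r δ m) (k + 1) with hp'
      have hψ := ih m hm ψ hψ1 hψ2
      -- `incl` preserves ē_(k+1) and the shifted generators, so the corner embeddings are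
      -- compatible with adding a strand at the top.
      have hφψ : ∀ y, φ (incl q r δ n y) = incl q r δ m (ψ y) := by
        intro y
        have : φ.comp (incl q r δ n) = (incl q r δ m).comp ψ := by
          refine br_algHom_ext (fun i h1 h2 => ?_) fun hn => ?_
          · rw [AlgHom.comp_apply, AlgHom.comp_apply, incl_g h1 h2, hg i h1 (by omega),
              hψ1 i h1 h2, Tuple.ext, Tuple.ext, map_add, map_mul, map_smul, map_sub, hip, map_one,
              incl_g (by omega) (by omega)]
          · rw [AlgHom.comp_apply, AlgHom.comp_apply, incl_e hn, he (by omega), hψ2 hn, Tuple.ext,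
              Tuple.ext, map_add, map_mul, map_smul, map_smul, map_sub, hip, map_one, hie hn]
        exact DFunLike.congr_fun this y
      have cφ : ∀ y, Commute p (φ y) := by
        intro y
        have hy : y ∈ brauerSub K (g q r δ (n + 1)) (e q r δ (n + 1)) (n + 1) := by
          rw [brauerSub_eq_top]; trivial
        have c1 : Commute p (1 - p) := (Commute.one_right p).sub_right (Commute.refl p)
        induction hy using Algebra.adjoin_induction with
        | mem y hy =>
          rcases hy with ⟨i, h1, h2, rfl⟩ | ⟨hn, rfl⟩
          · rw [hg i h1 h2]
            exact ((Commute.refl p).mul_right (T.commute_ebar_g (by omega) (by omega))).add_right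
              (c1.smul_right _)
          · rw [he hn]
            refine ((Commute.refl p).mul_right (Commute.smul_right ?_ _)).add_right
              (c1.smul_right _)
            exact (T.ebar_mul_ebar (by omega) (by omega)).trans
              (T.ebar_mul_ebar' (by omega) (by omega)).symm
        | algebraMap c => rw [AlgHom.commutes]; exact (Algebra.commutes c p).symm
        | add y z _ _ hy hz => rw [map_add]; exact hy.add_right hz
        | mul y z _ _ hy hz => rw [map_mul]; exact hy.mul_right hz
      have hincl : ∀ y, S.tr (m + 1) (p * φ (incl q r δ n y)) =
          (r * q⁻¹ / δ ^ 2) ^ (k + 1) * S.tr (n + 1) (incl q r δ n y) := by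
        intro y
        rw [hφψ, ← hip, ← map_mul, S.tr_incl, hψ, S.tr_incl]
      rcases Nat.eq_zero_or_pos n with rfl | hn
      · intro x
        obtain ⟨c, rfl⟩ := exists_algebraMap_eq (n := 0 + 1) le_rfl x
        have := hincl (algebraMap K _ c)
        rwa [AlgHom.commutes] at this
      have hlin : (S.tr (m + 1)).comp ((LinearMap.mulLeft K p).comp φ.toLinearMap) =
          (r * q⁻¹ / δ ^ 2) ^ (k + 1) • S.tr (n + 1) := by
        refine br_linearMap_ext hq hδ hr hn ?_ ?_ ?_
        · intro y
          simpa using hincl y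
        · intro y z
          have h1 : p * φ (incl q r δ n y * g q r δ (n + 1) n * incl q r δ n z) =
              incl q r δ m (p' * ψ y) * g q r δ (m + 1) m * incl q r δ m (ψ z) := by
            rw [map_mul, map_mul, hφψ, hφψ, hg n hn (by omega), map_mul, hip, ← hφψ, ← mul_assoc,
              ← mul_assoc, (cφ _).eq, mul_assoc (φ _) p, Tuple.mul_ext hpp, ← mul_assoc (φ _),
              show n + 2 * (k + 1) = m by omega]
          have h2 : p' * ψ y * ψ z = p' * ψ (y * z) := by rw [map_mul, mul_assoc]
          simp only [LinearMap.comp_apply, AlgHom.toLinearMap_apply, LinearMap.mulLeft_apply,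
            LinearMap.smul_apply, smul_eq_mul]
          rw [h1, S.tr_g m (by omega), S.tr_g n hn, h2, hψ]
          ring
        · intro y z
          -- After multiplication by `p` the complementary scalars disappear, and the image of
          -- `conjEl` becomes the shifted word treated in `tr_conj_eprod`.
          have hdn : p * φ (conjEl q r δ n) = p * (dn (gInv q r δ (m + 1)) (2 * (k + 1) + 2)
              (n - 1) * (δ • Tuple.ebar δ⁻¹ (g q r δ (m + 1)) (gInv q r δ (m + 1))
              (e q r δ (m + 1)) (k + 1 + 1)) * up (g q r δ (m + 1)) (2 * (k + 1) + 2) (n - 1)) := by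
            have hu : ∀ l, l ≤ n - 1 → p * φ (up (g q r δ (n + 1)) 2 l) =
                p * up (g q r δ (m + 1)) (2 * (k + 1) + 2) l := by
              intro l hl
              induction l with
              | zero => simp
              | succ l ihl =>
                rw [up_succ', up_succ', map_mul, ← mul_assoc, ihl (by omega),
                  hg _ (by omega) (by omega), ← mul_assoc p]
                have : Commute p (up (g q r δ (m + 1)) (2 * (k + 1) + 2) l) :=
                  commute_up fun i _ _ => T.commute_ebar_g (by omega) (by omega)
                rw [this.eq, mul_assoc, Tuple.mul_ext hpp, mul_assoc,
                  show 2 + l + 2 * (k + 1) = 2 * (k + 1) + 2 + l by ring]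
            have hd : ∀ l, l ≤ n - 1 → p * φ (dn (gInv q r δ (n + 1)) 2 l) =
                p * dn (gInv q r δ (m + 1)) (2 * (k + 1) + 2) l := by
              intro l hl
              induction l with
              | zero => simp
              | succ l ihl =>
                have hgi : p * φ (gInv q r δ (n + 1) (2 + l)) =
                    p * gInv q r δ (m + 1) (2 * (k + 1) + 2 + l) := by
                  rw [gInv_eq, gInv_eq, map_add, map_smul, map_smul, map_one,
                    hg _ (by omega) (by omega), mul_add, mul_smul_comm, Tuple.mul_ext hpp,
                    show 2 + l + 2 * (k + 1) = 2 * (k + 1) + 2 + l by ring]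
                  simp only [mul_add, mul_smul_comm]
                have : Commute p (gInv q r δ (m + 1) (2 * (k + 1) + 2 + l)) :=
                  T.commute_ebar_h (by omega) (by omega)
                rw [dn_succ, dn_succ, map_mul, ← mul_assoc, hgi, this.eq, mul_assoc, ihl (by omega),
                  ← mul_assoc, ← this.eq, mul_assoc]
            rw [conjEl, Tuple.conjE, map_mul, map_mul, he (by omega), ← mul_assoc, ← mul_assoc,
              hd _ le_rfl]
            have c1 : Commute p (dn (gInv q r δ (m + 1)) (2 * (k + 1) + 2) (n - 1)) :=
              commute_dn fun i _ _ => T.commute_ebar_h (by omega) (by omega)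
            have c2 : Commute p (δ • Tuple.ebar δ⁻¹ (g q r δ (m + 1)) (gInv q r δ (m + 1))
                (e q r δ (m + 1)) (k + 1 + 1)) := Commute.smul_right
              ((T.ebar_mul_ebar (by omega) (by omega)).trans
                (T.ebar_mul_ebar' (by omega) (by omega)).symm) _
            rw [c1.eq, mul_assoc _ p, Tuple.mul_ext hpp, c2.eq, mul_assoc, mul_assoc,
              hu _ le_rfl, ← mul_assoc (δ • _) p, ← c2.eq, ← mul_assoc, ← mul_assoc, ← c1.eq]
            simp only [mul_assoc]
          have h1 : p * φ (incl q r δ n y * conjEl q r δ n * incl q r δ n z) =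
              incl q r δ m (p' * ψ y) * (dn (gInv q r δ (m + 1)) (2 * (k + 1) + 2)
              (n - 1) * (δ • Tuple.ebar δ⁻¹ (g q r δ (m + 1)) (gInv q r δ (m + 1))
              (e q r δ (m + 1)) (k + 1 + 1)) * up (g q r δ (m + 1)) (2 * (k + 1) + 2) (n - 1)) *
              incl q r δ m (ψ z) := by
            rw [map_mul, map_mul, ← mul_assoc, ← mul_assoc, (cφ _).eq, mul_assoc _ p, hdn,
              ← mul_assoc _ p, ← (cφ _).eq, hφψ, hφψ, map_mul, hip]
          have c3 : Commute p' (ψ y) := by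
            have hy : y ∈ brauerSub K (g q r δ n) (e q r δ n) n := by
              rw [brauerSub_eq_top]; trivial
            have c1 : Commute p' (1 - p') := (Commute.one_right p').sub_right (Commute.refl p')
            refine Algebra.adjoin_induction (p := fun y _ => Commute p' (ψ y)) ?_ ?_ ?_ ?_ hy
            · rintro _ (⟨i, h1, h2, rfl⟩ | ⟨hn, rfl⟩)
              · rw [hψ1 i h1 h2]
                exact ((Commute.refl p').mul_right
                  (T'.commute_ebar_g (by omega) (by omega))).add_right (c1.smul_right _)
              · rw [hψ2 hn]
                refine ((Commute.refl p').mul_right (Commute.smul_right ?_ _)).add_right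
                  (c1.smul_right _)
                exact (T'.ebar_mul_ebar (by omega) (by omega)).trans
                  (T'.ebar_mul_ebar' (by omega) (by omega)).symm
            · intro c
              rw [AlgHom.commutes]; exact (Algebra.commutes c p').symm
            · intro y z _ _ hy hz
              rw [map_add]; exact hy.add_right hz
            · intro y z _ _ hy hz
              rw [map_mul]; exact hy.mul_right hz
          have h2 : p' * ψ y * p' * ψ z = p' * ψ (y * z) := by
            rw [mul_assoc p', ← c3.eq, ← mul_assoc p', hpp', map_mul, mul_assoc]
          simp only [LinearMap.comp_apply, AlgHom.toLinearMap_apply, LinearMap.mulLeft_apply,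
            LinearMap.smul_apply, smul_eq_mul]
          rw [h1, S.tr_conj_eprod hq hδ hr hn hm, S.tr_conjEl n hn, h2, hψ]
          ring
      intro x
      exact DFunLike.congr_fun hlin x

end TowerTrace

end QBrauer

/-! ### From tower traces to the Markov trace: existence, annihilators, uniqueness. -/

namespace QBrauer

universe u

variable {K : Type u} [Field K] {q r δ : K}

theorem shift_ι_g {n i k : ℕ} (hi : 1 ≤ i ∧ i < n) :
    shift q r δ n k (FreeAlgebra.ι K (Gen.g i hi)) = g q r δ (n + 2 * k) (i + 2 * k) := by
  rw [shift, FreeAlgebra.lift_ι_apply]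

theorem shift_ι_e {n k : ℕ} (hn : 2 ≤ n) :
    shift q r δ n k (FreeAlgebra.ι K (Gen.e hn)) = δ • ekBar q r δ (n + 2 * k) (k + 1) := by
  rw [shift, FreeAlgebra.lift_ι_apply]

theorem ekBar_mul_self (hq : q ≠ 0) (hδ : δ ≠ 0) (hr : δ * (q - 1) = r - 1) (n k : ℕ) :
    ekBar q r δ (n + 2 * k) k * ekBar q r δ (n + 2 * k) k = ekBar q r δ (n + 2 * k) k := by
  rw [ekBar_eq_ebar, (br_tuple hq hδ hr (n + 2 * k)).ebar_mul_ebar le_rfl (by omega)]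

theorem commute_ekBar_shift (hq : q ≠ 0) (hδ : δ ≠ 0) (hr : δ * (q - 1) = r - 1) (n k : ℕ)
    (x : FreeAlgebra K (Gen n)) :
    Commute (ekBar q r δ (n + 2 * k) k) (shift q r δ n k x) := by
  have T := br_tuple hq hδ hr (n + 2 * k)
  induction x using FreeAlgebra.induction with
  | grade0 c => rw [AlgHom.commutes]; exact (Algebra.commutes c _).symm
  | grade1 s =>
    cases s with
    | g i hi =>
      rw [shift_ι_g, ekBar_eq_ebar]
      exact T.commute_ebar_g (by omega) (by omega)
    | e hn =>
      rw [shift_ι_e, ekBar_eq_ebar, ekBar_eq_ebar]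
      exact Commute.smul_right ((T.ebar_mul_ebar (by omega) (by omega)).trans
        (T.ebar_mul_ebar' (by omega) (by omega)).symm) _
  | mul a b ha hb => rw [map_mul]; exact ha.mul_right hb
  | add a b ha hb => rw [map_add]; exact ha.add_right hb

theorem cornerSub_le_range_shift (hδ : δ ≠ 0) (n k : ℕ) :
    cornerSub K (g q r δ (n + 2 * k)) (gInv q r δ (n + 2 * k)) (e q r δ (n + 2 * k))
      (n + 2 * k) k ≤ (shift q r δ n k).range := by
  refine Algebra.adjoin_le ?_
  rintro _ (⟨i, h1, h2, rfl⟩ | ⟨hn, rfl⟩)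
  · refine ⟨FreeAlgebra.ι K (Gen.g (i - 2 * k) ⟨by omega, by omega⟩), ?_⟩
    rw [AlgHom.toRingHom_eq_coe, RingHom.coe_coe, shift_ι_g]
    congr 1
    omega
  -- `shift` sends `e` to δ ē_(k+1) = δ · δ^(-(k+1)) e_(k+1); the scalar removes this normalization.
  · refine ⟨(δ⁻¹ * δ ^ (k + 1)) • FreeAlgebra.ι K (Gen.e (by omega)), ?_⟩
    rw [AlgHom.toRingHom_eq_coe, RingHom.coe_coe, map_smul, shift_ι_e, ekBar, smul_smul,
      smul_smul, ek_eq_eprod, mul_right_comm δ⁻¹, inv_mul_cancel₀ hδ, one_mul,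
      ← mul_pow, mul_inv_cancel₀ hδ, one_pow, one_smul]

theorem heckeSub_le_map_incl (n : ℕ) :
    heckeSub K (g q r δ (n + 1)) 1 n ≤ (hecke q r δ n).map (incl q r δ n) := by
  refine Algebra.adjoin_le ?_
  rintro _ ⟨i, h1, h2, rfl⟩
  exact ⟨g q r δ n i, Algebra.subset_adjoin ⟨i, h1, h2, rfl⟩, incl_g h1 h2⟩

namespace TowerTrace

/-- `shift` is defined only on the free algebra, but after multiplication by ē_(k) it agrees with
the corner homomorphism on Br_n, so `tr_ebar_mul` applies. -/
theorem tr_ekBar_mul_shift (S : TowerTrace q r δ) (hq : q ≠ 0) (hδ : δ ≠ 0)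
    (hr : δ * (q - 1) = r - 1) (n k : ℕ) (x : FreeAlgebra K (Gen n)) :
    S.tr (n + 2 * k) (ekBar q r δ (n + 2 * k) k * shift q r δ n k x) =
      (r * q⁻¹ / δ ^ 2) ^ k * S.tr n (toBr q r δ n x) := by
  have T := br_tuple hq hδ hr (n + 2 * k)
  obtain ⟨φ, h1, h2⟩ := (T.corner (m := n) (k := k) (by omega) (by omega)).exists_lift
  have h3 := S.tr_ebar_mul hq hδ hr k n _ rfl φ h1 h2 (toBr q r δ n x)
  have hpp := T.ebar_mul_ebar (j := k) (k := k) le_rfl (by omega)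
  rw [← h3, ekBar_eq_ebar]
  congr 1
  clear h3
  induction x using FreeAlgebra.induction with
  | grade0 c => rw [AlgHom.commutes, AlgHom.commutes, AlgHom.commutes]
  | grade1 s =>
    cases s with
    | g i hi => rw [toBr_ι_g, h1 i hi.1 hi.2, Tuple.mul_ext hpp, shift_ι_g]
    | e hn => rw [toBr_ι_e, h2 hn, Tuple.mul_ext hpp, shift_ι_e, ekBar_eq_ebar]
  | mul a b ha hb =>
    have := commute_ekBar_shift hq hδ hr n k a
    rw [ekBar_eq_ebar] at this
    rw [map_mul, map_mul, map_mul, ← mul_assoc, ← mul_assoc, ← ha, this.eq, mul_assoc, hb,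
      mul_assoc]
  | add a b ha hb => rw [map_add, map_add, map_add, mul_add, mul_add, ha, hb]

/-- The Markov trace defined by a compatible family of traces. -/
noncomputable def toMarkovTrace (S : TowerTrace q r δ) (hq : q ≠ 0) (hδ : δ ≠ 0)
    (hr : δ * (q - 1) = r - 1) : MarkovTrace q r δ where
  tr := S.tr
  tr_one := S.tr_one
  tr_comm := S.tr_comm
  tr_hecke_incl n h _ := S.tr_incl n h
  tr_hecke_markov n hn h _ := by simpa using S.tr_g n hn 1 h
  tr_ekBar n k a _ b _ x hx := by
    have hpp := ekBar_mul_self hq hδ hr n k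
    rw [← S.tr_ekBar_mul_shift hq hδ hr, ← hpp]
    set p := ekBar q r δ (n + 2 * k) k
    calc S.tr _ (a * (p * p) * b) = S.tr _ (p * (b * a) * p) := by
          rw [mul_assoc, S.tr_comm, mul_assoc p p b, mul_assoc p,
            S.tr_comm _ p]
          simp only [mul_assoc]
      _ = _ := by
          rw [hx, S.tr_comm, ← mul_assoc]

/-- The annihilator ideals of the Markov trace are compatible with the inclusions. -/
theorem incl_mem_ann (S : TowerTrace q r δ) (hq : q ≠ 0) (hδ : δ ≠ 0)
    (hr : δ * (q - 1) = r - 1) {n : ℕ} {a : Br q r δ n}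
    (ha : a ∈ (S.toMarkovTrace hq hδ hr).ann n) :
    incl q r δ n a ∈ (S.toMarkovTrace hq hδ hr).ann (n + 1) := by
  have ha' : ∀ b, S.tr n (a * b) = 0 := ha
  have h0 : ∀ b, S.tr (n + 1) (incl q r δ n a * incl q r δ n b) = 0 := fun b => by
    rw [← map_mul, S.tr_incl, ha']
  show ∀ b, S.tr (n + 1) (incl q r δ n a * b) = 0
  rcases Nat.eq_zero_or_pos n with rfl | hn
  · intro b
    obtain ⟨c, rfl⟩ := exists_algebraMap_eq (n := 0 + 1) le_rfl b
    simpa using h0 (algebraMap K _ c)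
  -- On each of the three pieces the value is a multiple of some `S.tr n (a * b)`, hence zero.
  · have h1 : (S.tr (n + 1)).comp (LinearMap.mulLeft K (incl q r δ n a)) = 0 := by
      refine br_linearMap_ext hq hδ hr hn ?_ ?_ ?_
      · intro y; exact h0 y
      · intro y z
        have := S.tr_g n hn (a * y) z
        rw [map_mul (incl q r δ n), mul_assoc a, ha', mul_zero] at this
        simpa only [LinearMap.comp_apply, LinearMap.mulLeft_apply, mul_assoc,
          LinearMap.zero_apply] using this
      · intro y z
        have := S.tr_conjEl n hn (a * y) z
        rw [map_mul (incl q r δ n), mul_assoc a, ha', mul_zero] at this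
        simpa only [LinearMap.comp_apply, LinearMap.mulLeft_apply, mul_assoc,
          LinearMap.zero_apply] using this
    exact fun b => DFunLike.congr_fun h1 b

end TowerTrace

namespace MarkovTrace

/-- The coset decomposition writes a Hecke element on one more strand through `a` and `a g_n⁻¹ b`
with `a`, `b` in the smaller Hecke algebra; cyclicity and the Markov property reduce both to that
algebra. -/
theorem tr_eq_of_mem_hecke (hq : q ≠ 0) (hδ : δ ≠ 0) (hr : δ * (q - 1) = r - 1)
    (T T' : MarkovTrace q r δ) (n : ℕ) : ∀ x ∈ hecke q r δ n, T.tr n x = T'.tr n x := by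
  have small : ∀ m, m ≤ 1 → ∀ x, T.tr m x = T'.tr m x := by
    intro m hm x
    obtain ⟨c, rfl⟩ := exists_algebraMap_eq hm x
    rw [Algebra.algebraMap_eq_smul_one, map_smul, map_smul, T.tr_one, T'.tr_one]
  induction n with
  | zero => exact fun x _ => small 0 (by omega) x
  | succ n ih =>
    rcases Nat.eq_zero_or_pos n with rfl | hn
    · exact fun x _ => small _ le_rfl x
    have key : ∀ a ∈ hecke q r δ n, ∀ b ∈ hecke q r δ n,
        T.tr (n + 1) (incl q r δ n a * (gInv q r δ (n + 1) n * incl q r δ n b)) =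
          T'.tr (n + 1) (incl q r δ n a * (gInv q r δ (n + 1) n * incl q r δ n b)) := by
      intro a ha b hb
      have hba := Subalgebra.mul_mem _ hb ha
      have h1 : ∀ S : MarkovTrace q r δ,
          S.tr (n + 1) (incl q r δ n a * (gInv q r δ (n + 1) n * incl q r δ n b)) =
            q⁻¹ * (r / δ * S.tr n (b * a)) + (q⁻¹ - 1) * S.tr n (b * a) := by
        intro S
        rw [S.tr_comm, mul_assoc, ← map_mul, gInv_eq, add_mul, smul_mul_assoc, smul_mul_assoc,
          one_mul, map_add, map_smul, map_smul, S.tr_hecke_markov n hn _ hba,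
          S.tr_hecke_incl n _ hba, smul_eq_mul, smul_eq_mul]
      rw [h1, h1, ih _ hba]
    intro x hx
    refine (Submodule.span_le.mpr ?_ : _ ≤ LinearMap.eqLocus (T.tr (n + 1)) (T'.tr (n + 1)))
      ((br_tuple hq hδ hr (n + 1)).mem_span_mul_dn_h (by omega) hn hx)
    rintro _ ⟨a, ha, i, l, hi, hl, rfl⟩
    obtain ⟨a, ha', rfl⟩ := heckeSub_le_map_incl n ha
    cases l with
    | zero =>
      rw [dn_zero, mul_one]
      exact (T.tr_hecke_incl n a ha').trans ((ih a ha').trans (T'.tr_hecke_incl n a ha').symm)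
    | succ l =>
      have hd : dn (gInv q r δ (n + 1)) i l ∈ heckeSub K (g q r δ (n + 1)) 1 n :=
        dn_mem fun m _ _ => (br_tuple hq hδ hr (n + 1)).h_mem
          (g_mem_heckeSub (by omega) (by omega))
      obtain ⟨b, hb, hb'⟩ := heckeSub_le_map_incl n hd
      have hil : i + l = n := by omega
      rw [dn_succ, hil, ← hb']
      exact key a ha' b hb

/-- Strong induction over the span of the u e_(k) v. For `k ≥ 1` generation of the corner provides
the preimage `x` required by `tr_ekBar`, and the value is then fixed by the trace on `n - 2k`
strands. -/
theorem tr_eq (hq : q ≠ 0) (hδ : δ ≠ 0) (hr : δ * (q - 1) = r - 1)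
    (T T' : MarkovTrace q r δ) (n : ℕ) : T.tr n = T'.tr n := by
  induction n using Nat.strong_induction_on with
  | _ n ih =>
    ext x
    have A := br_tuple hq hδ hr n
    have hx : x ∈ brauerSub K (g q r δ n) (e q r δ n) n := by rw [brauerSub_eq_top]; trivial
    refine (Submodule.span_le.mpr ?_ : _ ≤ LinearMap.eqLocus (T.tr n) (T'.tr n))
      (A.mem_span_hecke_eprod_hecke hx)
    rintro _ ⟨k, u, v, hk, hu, hv, rfl⟩
    rcases Nat.eq_zero_or_pos k with rfl | hk0
    · rw [eprod, mul_one]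
      exact tr_eq_of_mem_hecke hq hδ hr T T' n _ (Subalgebra.mul_mem _ hu hv)
    obtain ⟨m, rfl⟩ : ∃ m, n = m + 2 * k := ⟨n - 2 * k, by omega⟩
    obtain ⟨c, hc, h1⟩ := A.exists_eprod_brauerSub_eprod hk (x := v * u)
      (by rw [brauerSub_eq_top]; trivial)
    obtain ⟨x, hx⟩ := cornerSub_le_range_shift hδ m k hc
    have hx' : shift q r δ m k x = c := hx
    have h2 : ekBar q r δ (m + 2 * k) k * (v * u) * ekBar q r δ (m + 2 * k) k =
        ekBar q r δ (m + 2 * k) k * shift q r δ m k x * ekBar q r δ (m + 2 * k) k := by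
      rw [hx', ekBar, ek_eq_eprod]
      simp only [smul_mul_assoc, mul_smul_comm, h1]
    have h3 := T.tr_ekBar m k u hu v hv x h2
    rw [ih m (by omega), ← T'.tr_ekBar m k u hu v hv x h2, ekBar, ek_eq_eprod, mul_smul_comm,
      smul_mul_assoc, map_smul, map_smul] at h3
    exact smul_right_injective K (pow_ne_zero k (inv_ne_zero hδ)) h3

end MarkovTrace

theorem TowerTrace.exists_markovTrace (S : TowerTrace q r δ) (hq : q ≠ 0) (hδ : δ ≠ 0)
    (hr : δ * (q - 1) = r - 1) :
    ∃ T : MarkovTrace q r δ, (∀ T' : MarkovTrace q r δ, T' = T) ∧ ∀ n : ℕ,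
      (∀ a ∈ T.ann n, incl q r δ n a ∈ T.ann (n + 1)) ∧
      ∃ φ : (Br q r δ n ⧸ T.ann n) →ₐ[K] (Br q r δ (n + 1) ⧸ T.ann (n + 1)),
        Function.Injective φ ∧ ∀ a : Br q r δ n, φ (Ideal.Quotient.mk (T.ann n) a) =
          Ideal.Quotient.mk (T.ann (n + 1)) (incl q r δ n a) := by
  refine ⟨S.toMarkovTrace hq hδ hr, fun T' => ?_, fun n => ?_⟩
  · have := MarkovTrace.tr_eq hq hδ hr T' (S.toMarkovTrace hq hδ hr)
    generalize S.toMarkovTrace hq hδ hr = T at this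
    cases T
    cases T'
    congr
    exact funext this
  set T := S.toMarkovTrace hq hδ hr with hT
  have h1 : T.ann n ≤ (T.ann (n + 1)).comap (incl q r δ n) := fun a ha =>
    S.incl_mem_ann hq hδ hr ha
  -- It suffices to test against elements of the image, where the trace restricts to that of Br_n.
  have h2 : (T.ann (n + 1)).comap (incl q r δ n) ≤ T.ann n := by
    intro a ha b
    have h3 : T.tr (n + 1) (incl q r δ n a * incl q r δ n b) = 0 := ha (incl q r δ n b)
    rw [← map_mul] at h3
    exact (S.tr_incl n (a * b)).symm.trans h3
  refine ⟨h1, Ideal.quotientMapₐ _ (incl q r δ n) h1, ?_, fun a => rfl⟩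
  exact Ideal.quotientMap_injective' (H := h1) h2

end QBrauer

/-! ### The tensor space model, with q = t², and its basic relations. -/

namespace QBrauer

namespace Model

open Equiv

section Operators

variable {F : Type*} [Field F] (t : F) {N : ℕ}

/-- The diagonal coefficients of the Hecke generators. -/
def gam (a b : Fin (N + 1)) : F := if a = b then t ^ 2 - t else if b < a then t ^ 2 - 1 else 0

/-- The action of a Hecke generator on the tensor factors `p` and `p + 1`. -/
def opG (N p : ℕ) : Module.End F ((ℕ → Fin (N + 1)) → F) where
  toFun f s := gam t (s p) (s (p + 1)) * f s + t * f (s ∘ swap p (p + 1))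
  map_add' f f' := by ext s; simp only [Pi.add_apply]; ring
  map_smul' c f := by ext s; simp only [Pi.smul_apply, smul_eq_mul, RingHom.id_apply]; ring

/-- Replace the first two entries of a sequence by `c`. -/
def cap {α : Type*} (s : ℕ → α) (c : α) : ℕ → α := fun i => if i < 2 then c else s i

/-- The action of the generator `e` on the first two tensor factors. -/
def opE (N : ℕ) : Module.End F ((ℕ → Fin (N + 1)) → F) where
  toFun f s := if s 0 = s 1 then (t ^ 2) ^ (s 0 : ℕ) * ∑ c, f (cap s c) else 0
  map_add' f f' := by
    ext s; simp only [Pi.add_apply, Finset.sum_add_distrib]; split_ifs <;> ring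
  map_smul' c f := by
    ext s
    simp only [Pi.smul_apply, smul_eq_mul, RingHom.id_apply, ← Finset.mul_sum]
    split_ifs <;> ring

theorem opG_apply (p : ℕ) (f : (ℕ → Fin (N + 1)) → F) (s : ℕ → Fin (N + 1)) :
    opG t N p f s = gam t (s p) (s (p + 1)) * f s + t * f (s ∘ swap p (p + 1)) := rfl

theorem opE_apply (f : (ℕ → Fin (N + 1)) → F) (s : ℕ → Fin (N + 1)) :
    opE t N f s = if s 0 = s 1 then (t ^ 2) ^ (s 0 : ℕ) * ∑ c, f (cap s c) else 0 := rfl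

end Operators

section Window

variable {α : Type*}

/-- Replace four consecutive entries of a sequence, starting at position `p`. -/
def upd (p : ℕ) (s : ℕ → α) (x y z w : α) : ℕ → α := fun i =>
  if i = p then x else if i = p + 1 then y else if i = p + 2 then z else if i = p + 3 then w
  else s i

variable (p : ℕ) (s : ℕ → α) (x y z w : α)

@[simp] theorem upd_0 : upd p s x y z w p = x := by simp [upd]
@[simp] theorem upd_1 : upd p s x y z w (p + 1) = y := by simp [upd]
@[simp] theorem upd_2 : upd p s x y z w (p + 2) = z := by simp [upd]
@[simp] theorem upd_3 : upd p s x y z w (p + 3) = w := by simp [upd]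

theorem upd_self : upd p s (s p) (s (p + 1)) (s (p + 2)) (s (p + 3)) = s := by
  ext i
  simp only [upd]
  split_ifs with h1 h2 h3 h4
  · rw [h1]
  · rw [h2]
  · rw [h3]
  · rw [h4]
  · rfl

theorem upd_swap_0 : upd p s x y z w ∘ swap p (p + 1) = upd p s y x z w := by
  ext i
  rcases eq_or_ne i p with rfl | h1
  · simp
  rcases eq_or_ne i (p + 1) with rfl | h2
  · simp
  rw [Function.comp_apply, swap_apply_of_ne_of_ne h1 h2]
  simp [upd, h1, h2]

theorem upd_swap_1 : upd p s x y z w ∘ swap (p + 1) (p + 2) = upd p s x z y w := by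
  ext i
  rcases eq_or_ne i (p + 1) with rfl | h1
  · simp
  rcases eq_or_ne i (p + 2) with rfl | h2
  · simp
  rw [Function.comp_apply, swap_apply_of_ne_of_ne h1 h2]
  simp [upd, h1, h2]

theorem upd_swap_2 : upd p s x y z w ∘ swap (p + 2) (p + 3) = upd p s x y w z := by
  ext i
  rcases eq_or_ne i (p + 2) with rfl | h1
  · simp
  rcases eq_or_ne i (p + 3) with rfl | h2
  · simp
  rw [Function.comp_apply, swap_apply_of_ne_of_ne h1 h2]
  simp [upd, h1, h2]

theorem cap_upd (c : α) : cap (upd 0 s x y z w) c = upd 0 s c c z w := by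
  ext i
  simp only [cap, upd]
  split_ifs <;> first | rfl | omega

end Window

section Relations

variable {F : Type*} [Field F] (t : F) {N : ℕ}

/-- The local relations involve at most four consecutive factors, so evaluating on an explicit
window turns them into case checks on the order of its entries. -/
theorem ext_upd (p : ℕ) {A B : Module.End F ((ℕ → Fin (N + 1)) → F)}
    (h : ∀ f s x y z w, A f (upd p s x y z w) = B f (upd p s x y z w)) : A = B := by
  ext f s
  have := h f s (s p) (s (p + 1)) (s (p + 2)) (s (p + 3))
  rwa [upd_self] at this

variable (f : (ℕ → Fin (N + 1)) → F) (p : ℕ) (s : ℕ → Fin (N + 1)) (x y z w : Fin (N + 1))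

theorem opG_upd_0 : opG t N p f (upd p s x y z w) =
    gam t x y * f (upd p s x y z w) + t * f (upd p s y x z w) := by
  rw [opG_apply, upd_swap_0, upd_0, upd_1]

theorem opG_upd_1 : opG t N (p + 1) f (upd p s x y z w) =
    gam t y z * f (upd p s x y z w) + t * f (upd p s x z y w) := by
  rw [opG_apply, upd_swap_1, upd_1, upd_2]

theorem opG_upd_2 : opG t N (p + 2) f (upd p s x y z w) =
    gam t z w * f (upd p s x y z w) + t * f (upd p s x y w z) := by
  rw [opG_apply, upd_swap_2, upd_2, upd_3]

theorem opE_upd : opE t N f (upd 0 s x y z w) =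
    if x = y then (t ^ 2) ^ (x : ℕ) * ∑ c, f (upd 0 s c c z w) else 0 := by
  simp only [opE_apply, cap_upd, upd_0]
  rw [show upd 0 s x y z w 1 = y from upd_1 0 s x y z w]

theorem gam_self : gam t x x = t ^ 2 - t := by simp [gam]

theorem gam_lt {x y : Fin (N + 1)} (h : x < y) : gam t x y = 0 := by
  simp [gam, h.ne, h.not_gt]

theorem gam_gt {x y : Fin (N + 1)} (h : y < x) : gam t x y = t ^ 2 - 1 := by
  simp [gam, h.ne', h]

theorem opG_mul_self (p : ℕ) :
    opG t N p * opG t N p = (t ^ 2 - 1) • opG t N p + t ^ 2 • (1 : Module.End F _) := by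
  refine ext_upd p fun f s x y z w => ?_
  simp only [Module.End.mul_apply, LinearMap.add_apply, LinearMap.smul_apply, Pi.add_apply,
    Pi.smul_apply, smul_eq_mul, Module.End.one_apply, opG_upd_0]
  rcases lt_trichotomy x y with h | rfl | h
  · rw [gam_lt t h, gam_gt t h]; ring
  · rw [gam_self]; ring
  · rw [gam_lt t h, gam_gt t h]; ring

theorem opG_braid (p : ℕ) : opG t N p * opG t N (p + 1) * opG t N p =
    opG t N (p + 1) * opG t N p * opG t N (p + 1) := by
  refine ext_upd p fun f s x y z w => ?_
  simp only [Module.End.mul_apply, opG_upd_0, opG_upd_1]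
  rcases lt_trichotomy x y with h1 | h1 | h1 <;> rcases lt_trichotomy y z with h2 | h2 | h2 <;>
    rcases lt_trichotomy x z with h3 | h3 | h3 <;> first
    | (exfalso; order)
    | (subst_vars; simp only [gam_self, gam_lt, gam_gt, *] <;> ring)

theorem opG_comm {p r : ℕ} (h : p + 1 < r) : opG t N p * opG t N r = opG t N r * opG t N p := by
  ext f s
  have c1 : (s ∘ swap p (p + 1)) ∘ swap r (r + 1) = (s ∘ swap r (r + 1)) ∘ swap p (p + 1) := by
    ext i
    simp only [Function.comp_apply, swap_apply_def]
    split_ifs <;> first | rfl | omega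
  have a1 : swap p (p + 1) r = r := swap_apply_of_ne_of_ne (by omega) (by omega)
  have a2 : swap p (p + 1) (r + 1) = r + 1 := swap_apply_of_ne_of_ne (by omega) (by omega)
  have a3 : swap r (r + 1) p = p := swap_apply_of_ne_of_ne (by omega) (by omega)
  have a4 : swap r (r + 1) (p + 1) = p + 1 := swap_apply_of_ne_of_ne (by omega) (by omega)
  simp only [Module.End.mul_apply, opG_apply, c1, Function.comp_apply, a1, a2, a3, a4]
  ring

theorem opE_comm {r : ℕ} (h : 2 ≤ r) : opE t N * opG t N r = opG t N r * opE t N := by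
  ext f s
  have c1 : ∀ c, cap s c ∘ swap r (r + 1) = cap (s ∘ swap r (r + 1)) c := by
    intro c
    ext i
    simp only [Function.comp_apply, swap_apply_def, cap]
    split_ifs <;> first | rfl | omega
  have a1 : swap r (r + 1) 0 = 0 := swap_apply_of_ne_of_ne (by omega) (by omega)
  have a2 : swap r (r + 1) 1 = 1 := swap_apply_of_ne_of_ne (by omega) (by omega)
  have a3 : ∀ c, cap s c r = s r := fun c => by simp [cap]; omega
  have a4 : ∀ c, cap s c (r + 1) = s (r + 1) := fun c => by simp [cap]; omega
  simp only [Module.End.mul_apply, opG_apply, opE_apply, c1, Function.comp_apply, a1, a2, a3, a4,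
    Finset.sum_add_distrib, ← Finset.mul_sum]
  split_ifs <;> ring

/-- The value of the parameter `δ`. -/
def del (N : ℕ) : F := ∑ c : Fin (N + 1), (t ^ 2) ^ (c : ℕ)

theorem del_mul : del t N * (t ^ 2 - 1) = (t ^ 2) ^ (N + 1) - 1 := by
  rw [del, Fin.sum_univ_eq_sum_range (fun i => (t ^ 2) ^ i), geom_sum_mul]

theorem opE_mul_self : opE t N * opE t N = del t N • opE t N := by
  refine ext_upd 0 fun f s x y z w => ?_
  simp only [Module.End.mul_apply, LinearMap.smul_apply, Pi.smul_apply, smul_eq_mul, opE_upd,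
    if_true, ← Finset.sum_mul]
  rw [del]
  split_ifs <;> ring

theorem opE_mul_opG_zero : opE t N * opG t N 0 = t ^ 2 • opE t N := by
  refine ext_upd 0 fun f s x y z w => ?_
  simp only [Module.End.mul_apply, LinearMap.smul_apply, Pi.smul_apply, smul_eq_mul, opE_upd,
    opG_upd_0, gam_self, ← add_mul, ← Finset.mul_sum, sub_add_cancel]
  split_ifs <;> ring

theorem opG_zero_mul_opE : opG t N 0 * opE t N = t ^ 2 • opE t N := by
  refine ext_upd 0 fun f s x y z w => ?_
  simp only [Module.End.mul_apply, LinearMap.smul_apply, Pi.smul_apply, smul_eq_mul, opE_upd,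
    opG_upd_0]
  rcases eq_or_ne x y with rfl | h
  · simp only [gam_self, if_true]; ring
  · simp [h, h.symm]

/-- The summands of a telescoping sum. -/
def tel (a c : Fin (N + 1)) : F :=
  if c = a then (t ^ 2) ^ ((a : ℕ) + 1) else if a < c then (t ^ 2 - 1) * (t ^ 2) ^ (c : ℕ) else 0

/-- q^(a+1) + Σ_{c>a} (q - 1)q^c telescopes to a value independent of `a`. This independence is what
makes e g_2 e a scalar multiple of `e`. -/
theorem sum_tel (a : Fin (N + 1)) : ∑ c, tel t a c = (t ^ 2) ^ (N + 1) := by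
  have h1 : ∀ k j : ℕ, ∑ c ∈ Finset.range (k + j + 1),
      (if c = k then (t ^ 2) ^ (k + 1) else if k < c then (t ^ 2 - 1) * (t ^ 2) ^ c else 0) =
      (t ^ 2) ^ (k + j + 1) := by
    intro k j
    induction j with
    | zero =>
      rw [add_zero, Finset.sum_range_succ, Finset.sum_eq_zero, if_pos rfl, zero_add]
      intro c hc
      have := Finset.mem_range.mp hc
      rw [if_neg (by omega), if_neg (by omega)]
    | succ j ih =>
      rw [← add_assoc, Finset.sum_range_succ, ih, if_neg (by omega), if_pos (by omega)]
      ring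
  obtain ⟨j, hj⟩ : ∃ j, N = a + j := ⟨N - a, by omega⟩
  have h2 := h1 a j
  rw [← hj, ← Fin.sum_univ_eq_sum_range] at h2
  rw [← h2]
  refine Finset.sum_congr rfl fun c _ => ?_
  simp only [tel, Fin.ext_iff, Fin.lt_def]

theorem opE_mul_opG_one_mul_opE :
    opE t N * opG t N 1 * opE t N = (t ^ 2) ^ (N + 1) • opE t N := by
  refine ext_upd 0 fun f s x y z w => ?_
  have h1 := fun f s x y z w => opG_upd_1 t (N := N) f 0 s x y z w
  rw [zero_add] at h1
  simp only [Module.End.mul_apply, LinearMap.smul_apply, Pi.smul_apply, smul_eq_mul, opE_upd, h1,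
    if_true]
  -- Both terms contribute the same contraction, and their combined coefficient is a summand of the
  -- telescoping sum.
  have h2 : ∀ c, gam t c z * ((t ^ 2) ^ (c : ℕ) * ∑ d, f (upd 0 s d d z w)) +
      t * (if c = z then (t ^ 2) ^ (c : ℕ) * ∑ d, f (upd 0 s d d c w) else 0) =
      tel t z c * ∑ d, f (upd 0 s d d z w) := by
    intro c
    rw [tel]
    rcases lt_trichotomy c z with h | rfl | h
    · simp [gam_lt t h, h.ne, h.not_gt]
    · simp [gam_self]; ring
    · simp [gam_gt t h, h.ne', h]; ring
  simp only [h2, ← Finset.sum_mul, sum_tel]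
  split_ifs <;> ring

end Relations

end Model

end QBrauer

/-! ### The element e_(2) of the model and its symmetries. -/

namespace QBrauer

namespace Model

open Equiv

section Relations

variable {F : Type*} [Field F] (t : F) {N : ℕ}

theorem upd_upd {α : Type*} (s : ℕ → α) (x y z w x' y' z' w' : α) :
    upd 0 (upd 0 s x y z w) x' y' z' w' = upd 0 s x' y' z' w' := by
  ext i
  simp only [upd]
  split_ifs <;> rfl

/-- The product of the generators `e` acting on the first two and on the next two tensor factors. -/
def opX (N : ℕ) : Module.End F ((ℕ → Fin (N + 1)) → F) where
  toFun f s := if s 0 = s 1 ∧ s 2 = s 3 then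
    (t ^ 2) ^ ((s 0 : ℕ) + (s 2 : ℕ)) * ∑ c, ∑ d, f (upd 0 s c c d d) else 0
  map_add' f f' := by
    ext s; simp only [Pi.add_apply, Finset.sum_add_distrib]; split_ifs <;> ring
  map_smul' c f := by
    ext s
    simp only [Pi.smul_apply, smul_eq_mul, RingHom.id_apply, ← Finset.mul_sum]
    split_ifs <;> ring

variable (f : (ℕ → Fin (N + 1)) → F) (s : ℕ → Fin (N + 1)) (x y z w : Fin (N + 1))

theorem opX_upd : opX t N f (upd 0 s x y z w) = if x = y ∧ z = w then
    (t ^ 2) ^ ((x : ℕ) + (z : ℕ)) * ∑ c, ∑ d, f (upd 0 s c c d d) else 0 := by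
  have h1 : upd 0 s x y z w 1 = y := upd_1 0 s x y z w
  have h2 : upd 0 s x y z w 2 = z := upd_2 0 s x y z w
  have h3 : upd 0 s x y z w 3 = w := upd_3 0 s x y z w
  change (if upd 0 s x y z w 0 = _ ∧ _ then _ else _) = _
  simp only [upd_0, h1, h2, h3, upd_upd]

theorem opG_one_upd : opG t N 1 f (upd 0 s x y z w) =
    gam t y z * f (upd 0 s x y z w) + t * f (upd 0 s x z y w) := opG_upd_1 t f 0 s x y z w

theorem opG_two_upd : opG t N 2 f (upd 0 s x y z w) =
    gam t z w * f (upd 0 s x y z w) + t * f (upd 0 s x y w z) := opG_upd_2 t f 0 s x y z w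

/-- Position `p` carries the generator g_{p+1}. The symmetries of X = `opX` collected from here on
are g_1X = g_3X, Xg_2g_1 = Xg_2g_3 and g_1g_2X = g_3g_2X; they imply the relations for e_(2). -/
theorem opG_zero_mul_opX : opG t N 0 * opX t N = t ^ 2 • opX t N := by
  refine ext_upd 0 fun f s x y z w => ?_
  simp only [Module.End.mul_apply, LinearMap.smul_apply, Pi.smul_apply, smul_eq_mul, opX_upd,
    opG_upd_0]
  rcases eq_or_ne x y with rfl | h
  · simp only [gam_self, true_and]; ring
  · simp [h, h.symm]

theorem opG_two_mul_opX : opG t N 2 * opX t N = t ^ 2 • opX t N := by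
  refine ext_upd 0 fun f s x y z w => ?_
  simp only [Module.End.mul_apply, LinearMap.smul_apply, Pi.smul_apply, smul_eq_mul, opX_upd,
    opG_two_upd]
  rcases eq_or_ne z w with rfl | h
  · simp only [gam_self, and_true]; ring
  · simp [h, h.symm]

theorem opX_mul_opG_one_mul_opG_zero :
    opX t N * opG t N 1 * opG t N 0 = opX t N * opG t N 1 * opG t N 2 := by
  refine ext_upd 0 fun f s x y z w => ?_
  simp only [Module.End.mul_apply, opX_upd, opG_upd_0, opG_one_upd, opG_two_upd, gam_self,
    Finset.sum_add_distrib, mul_add, ← Finset.mul_sum]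
  rw [Finset.sum_comm (f := fun c d => f (upd 0 s c d d c))]

theorem opG_zero_mul_opG_one_mul_opX :
    opG t N 0 * opG t N 1 * opX t N = opG t N 2 * opG t N 1 * opX t N := by
  refine ext_upd 0 fun f s x y z w => ?_
  simp only [Module.End.mul_apply, opX_upd, opG_upd_0, opG_one_upd, opG_two_upd]
  generalize (∑ c, ∑ d, f (upd 0 s c c d d)) = G
  by_cases hxy : x = y
  · subst hxy
    by_cases hzw : z = w
    · subst hzw
      rcases lt_trichotomy x z with h | h | h
      · simp [gam_self, gam_lt t h, h.ne]
      · subst h; simp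
      · simp [gam_self, gam_gt t h, h.ne']
    · have hne : ¬ (x = z ∧ x = w) := fun h => hzw (h.1.symm.trans h.2)
      have hne' : ¬ (x = w ∧ x = z) := fun h => hne h.symm
      simp [hzw, Ne.symm hzw, hne, hne']
  · by_cases hxz : x = z
    · subst hxz
      by_cases hyw : y = w
      · subst hyw
        rcases lt_trichotomy x y with h | h | h
        · simp [gam_self, gam_lt t h, gam_gt t h, h.ne, h.ne']; try ring
        · exact absurd h hxy
        · simp [gam_self, gam_lt t h, gam_gt t h, h.ne, h.ne']; try ring
      · simp [hxy, Ne.symm hxy, hyw]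
    · by_cases hxw : x = w
      · subst hxw
        by_cases hyz : y = z
        · subst hyz
          simp [hxy, Ne.symm hxy, add_comm]
        · simp [hxy, Ne.symm hxy, hxz, Ne.symm hxz, hyz]
      · simp [hxy, Ne.symm hxy, hxz, hxw]

/-- The summand of `opE_word_opE` for a fixed contracted letter `c`. A, B and C record the
intermediate operators, and `v` abstracts the contracted function. All dependence on `c` beyond the
term for X is in a telescoping factor, whose sum does not depend on `max z w`. -/
theorem opE_word_opE_aux (v : Fin (N + 1) → Fin (N + 1) → F) (c z w : Fin (N + 1))
    (A : Fin (N + 1) → Fin (N + 1) → Fin (N + 1) → Fin (N + 1) → F)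
    (hA : ∀ x y z w, A x y z w = gam t y z * (if x = y then (t ^ 2) ^ (x : ℕ) * v z w else 0) +
      t * (if x = z then (t ^ 2) ^ (x : ℕ) * v y w else 0))
    (B : Fin (N + 1) → Fin (N + 1) → Fin (N + 1) → Fin (N + 1) → F)
    (hB : ∀ x y z w, B x y z w = gam t z w * A x y z w + t * A x y w z)
    (C : Fin (N + 1) → Fin (N + 1) → Fin (N + 1) → Fin (N + 1) → F)
    (hC : ∀ x y z w, C x y z w = gam t x y * B x y z w + t * B y x z w) :
    gam t c z * C c c z w + t * C c z c w =
      (if z = w then (t ^ 2) ^ 2 * (t ^ 2) ^ (z : ℕ) * v c c else 0) +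
      (t ^ 2 - 1) * t ^ 2 * (gam t z w * v z w + t * v w z + v z w) * tel t (max z w) c := by
  simp only [hC, hB]
  rcases lt_trichotomy z w with h1 | h1 | h1 <;> rcases lt_trichotomy c z with h2 | h2 | h2 <;>
    rcases lt_trichotomy c w with h3 | h3 | h3 <;> first
    | (exfalso; order)
    | (subst_vars
       simp only [hA, tel, gam_self, gam_lt, gam_gt, *, LT.lt.ne, LT.lt.ne', LT.lt.not_gt, if_true,
         if_false, lt_irrefl, max_eq_left_of_lt, max_eq_right_of_lt, max_self]
       ring)

/-- Computed with positive generators, where the matrix coefficients are simplest; `eTwo_of_symm`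
converts the identity to the word with inverses, where the correction terms cancel. -/
theorem opE_word_opE :
    opE t N * opG t N 1 * opG t N 0 * opG t N 2 * opG t N 1 * opE t N =
      (t ^ 2) ^ 2 • opX t N +
        ((t ^ 2 - 1) * t ^ 2 * (t ^ 2) ^ (N + 1)) • (opE t N * opG t N 2 + opE t N) := by
  refine ext_upd 0 fun f s x y z w => ?_
  simp only [Module.End.mul_apply, LinearMap.add_apply, LinearMap.smul_apply, Pi.smul_apply,
    Pi.add_apply, smul_eq_mul]
  rw [opE_upd, opX_upd, opE_upd, opE_upd]
  have key : ∀ c, opG t N 1 (opG t N 0 (opG t N 2 (opG t N 1 (opE t N f)))) (upd 0 s c c z w) =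
      (if z = w then (t ^ 2) ^ 2 * (t ^ 2) ^ (z : ℕ) * ∑ d, f (upd 0 s d d c c) else 0) +
      (t ^ 2 - 1) * t ^ 2 * (gam t z w * ∑ d, f (upd 0 s d d z w) +
        t * ∑ d, f (upd 0 s d d w z) + ∑ d, f (upd 0 s d d z w)) * tel t (max z w) c := by
    intro c
    rw [opG_one_upd]
    refine opE_word_opE_aux t (fun u v => ∑ d, f (upd 0 s d d u v)) c z w
      (fun x y z w => opG t N 1 (opE t N f) (upd 0 s x y z w)) (fun x y z w => ?_)
      (fun x y z w => opG t N 2 (opG t N 1 (opE t N f)) (upd 0 s x y z w)) (fun x y z w => ?_)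
      (fun x y z w => opG t N 0 (opG t N 2 (opG t N 1 (opE t N f))) (upd 0 s x y z w))
      (fun x y z w => ?_)
    · simp only [opG_one_upd, opE_upd]
    · rw [opG_two_upd]
    · rw [opG_upd_0]
  simp only [key, Finset.sum_add_distrib, ← Finset.mul_sum, sum_tel, opG_two_upd]
  by_cases hxy : x = y
  · by_cases hzw : z = w
    · simp only [hxy, hzw, and_self, if_true, ← Finset.mul_sum]
      rw [Finset.sum_comm (f := fun c d => f (upd 0 s d d c c))]
      ring
    · simp only [hxy, hzw, and_false, if_true, if_false, Finset.sum_const_zero]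
      ring
  · simp [hxy]

end Relations

end Model

/-- In the presence of the other relations, the relations for `e₍₂₎` follow if `e₍₂₎` is an element
with suitable symmetries. -/
theorem eTwo_of_symm {R B : Type*} [CommRing R] [Ring B] [Algebra R B] {q q' r d d' : R}
    {g h : ℕ → B} {e X : B} (T : Tuple q q' r d d' 3 g h e) (g3 : g 3 * g 3 = (q - 1) • g 3 + q • 1)
    (hh : ∀ i, h i = q' • g i + (q' - 1) • (1 : B)) (h13 : g 1 * g 3 = g 3 * g 1)
    (b23 : g 2 * g 3 * g 2 = g 3 * g 2 * g 3) (e3 : e * g 3 = g 3 * e)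
    (hX : e * g 2 * g 1 * g 3 * g 2 * e = q ^ 2 • X + ((q - 1) * q * r) • (e * g 3 + e)) :
    e * (g 2 * g 3 * h 1 * h 2) * e = X := by
  have e232 : e * (g 2 * g 3 * g 2) * e = r • (e * (g 3 * g 3)) := by
    rw [b23]
    calc _ = e * g 3 * g 2 * (g 3 * e) := by simp only [mul_assoc]
      _ = g 3 * e * g 2 * (e * g 3) := by rw [← e3]
      _ = g 3 * (e * g 2 * e) * g 3 := by simp only [mul_assoc]
      _ = _ := by
        rw [T.e_g2_e le_rfl, mul_smul_comm, smul_mul_assoc, ← e3, mul_assoc]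
  have e23 : e * (g 2 * g 3) * e = r • (e * g 3) := by
    calc _ = e * g 2 * (g 3 * e) := by simp only [mul_assoc]
      _ = (e * g 2 * e) * g 3 := by rw [← e3]; simp only [mul_assoc]
      _ = _ := by rw [T.e_g2_e le_rfl, smul_mul_assoc]
  have e231 : e * (g 2 * g 3 * g 1) * e = (q * r) • (e * g 3) := by
    calc _ = e * (g 2 * g 3) * (g 1 * e) := by simp only [mul_assoc]
      _ = _ := by rw [T.g1_e (by omega), mul_smul_comm, e23, smul_smul]
  have e2312 : e * (g 2 * g 3 * g 1 * g 2) * e =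
      q ^ 2 • X + ((q - 1) * q * r) • (e * g 3 + e) := by
    rw [← hX, mul_assoc (g 2), ← h13]
    simp only [mul_assoc]
  have e1 : e * (g 2 * g 3 * h 1 * h 2) * e = (q' * q') • (e * (g 2 * g 3 * g 1 * g 2) * e) +
      (q' * (q' - 1)) • (e * (g 2 * g 3 * g 1) * e) +
      (q' * (q' - 1)) • (e * (g 2 * g 3 * g 2) * e) +
      ((q' - 1) * (q' - 1)) • (e * (g 2 * g 3) * e) := by
    rw [hh, hh]
    simp only [mul_add, add_mul, mul_smul_comm, smul_mul_assoc, mul_one, smul_smul, smul_add]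
    rw [mul_comm (q' - 1) q']
    abel
  have hq := T.qq
  have c1 : q' * q' * q ^ 2 = 1 := by linear_combination (q * q' + 1) * hq
  rw [e1, e2312, e231, e232, e23, g3]
  simp only [mul_add, smul_add, mul_smul_comm, mul_one, smul_smul, c1, one_smul]
  -- These are the total coefficients of `e * g 3` and of `e` after expansion of the inverses.
  have c2 : q' * q' * ((q - 1) * q * r) + q' * (q' - 1) * (q * r) + q' * (q' - 1) * (r * (q - 1)) +
      (q' - 1) * (q' - 1) * r = 0 := by
    linear_combination (r * (q * q' - 1 + q')) * hq
  have c3 : q' * q' * ((q - 1) * q * r) + q' * (q' - 1) * (r * q) = 0 := by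
    linear_combination (r * q * q') * hq
  calc _ = X + (q' * q' * ((q - 1) * q * r) + q' * (q' - 1) * (q * r) +
        q' * (q' - 1) * (r * (q - 1)) + (q' - 1) * (q' - 1) * r) • (e * g 3) +
        (q' * q' * ((q - 1) * q * r) + q' * (q' - 1) * (r * q)) • e := by
        simp only [add_smul]; abel
    _ = X := by rw [c2, c3]; simp

end QBrauer

/-! ### The model satisfies all relations; inserting and removing a tensor factor. -/

namespace QBrauer

theorem mul_inv_of_sq {R B : Type*} [CommRing R] [Ring B] [Algebra R B] {q q' : R} {g h : B}
    (hq : q * q' = 1) (hg : g * g = (q - 1) • g + q • 1) (hh : h = q' • g + (q' - 1) • 1) :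
    g * h = 1 := by
  have hc : q' * (q - 1) + (q' - 1) = 0 := by linear_combination hq
  rw [hh, mul_add, mul_smul_comm, mul_smul_comm, hg, mul_one, smul_add, smul_smul,
    smul_smul, mul_comm q' q, hq, one_smul, add_right_comm, ← add_smul, hc, zero_smul, zero_add]

/-- Inverses are affine in the generators, so the symmetries give g_1⁻¹g_2⁻¹X = g_3⁻¹g_2⁻¹X, after
which the word cancels. -/
theorem word_mul_of_symm {R B : Type*} [CommRing R] [Ring B] [Algebra R B] {q' : R}
    {g h : ℕ → B} {X : B} (hh : ∀ i, h i = q' • g i + (q' - 1) • (1 : B)) (h2 : g 2 * h 2 = 1)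
    (h3 : g 3 * h 3 = 1) (e1 : g 1 * X = g 3 * X) (e2 : g 1 * g 2 * X = g 3 * g 2 * X) :
    g 2 * g 3 * h 1 * h 2 * X = X := by
  have h13 : h 1 * (h 2 * X) = h 3 * (h 2 * X) := by
    rw [mul_assoc, mul_assoc] at e2
    rw [hh 1, hh 2, hh 3]
    simp only [mul_add, add_mul, mul_smul_comm, smul_mul_assoc, one_mul, e1, e2]
  calc _ = g 2 * g 3 * (h 1 * (h 2 * X)) := by simp only [mul_assoc]
    _ = g 2 * (g 3 * h 3) * (h 2 * X) := by rw [h13]; simp only [mul_assoc]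
    _ = X := by rw [h3, mul_one, ← mul_assoc, h2, one_mul]

theorem mul_word_of_symm {B : Type*} [Ring B]
    {g h : ℕ → B} {X : B} (h1 : g 1 * h 1 = 1) (h2 : g 2 * h 2 = 1)
    (e2 : X * g 2 * g 1 = X * g 2 * g 3) : X * (g 2 * g 3 * h 1 * h 2) = X := by
  calc _ = X * g 2 * g 3 * h 1 * h 2 := by simp only [mul_assoc]
    _ = X * g 2 * (g 1 * h 1) * h 2 := by rw [← e2]; simp only [mul_assoc]
    _ = X := by rw [h1, mul_one, mul_assoc, h2, mul_one]

namespace Model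

open Equiv

variable {F : Type*} [Field F] (t : F) {N : ℕ}

/-- The inverse of `opG`. -/
def opH (N p : ℕ) : Module.End F ((ℕ → Fin (N + 1)) → F) :=
  (t ^ 2)⁻¹ • opG t N p + ((t ^ 2)⁻¹ - 1) • 1

variable {t}

theorem tuple_of_eTwo (ht : t ≠ 0) (hd : del t N ≠ 0) (n : ℕ)
    (h1 : 4 ≤ n → opG t N 1 * opG t N 2 * opH t N 0 * opH t N 1 *
      (opE t N * (opG t N 1 * opG t N 2 * opH t N 0 * opH t N 1) * opE t N) =
      opE t N * (opG t N 1 * opG t N 2 * opH t N 0 * opH t N 1) * opE t N)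
    (h2 : 4 ≤ n → opE t N * (opG t N 1 * opG t N 2 * opH t N 0 * opH t N 1) * opE t N *
      (opG t N 1 * opG t N 2 * opH t N 0 * opH t N 1) =
      opE t N * (opG t N 1 * opG t N 2 * opH t N 0 * opH t N 1) * opE t N) :
    Tuple (t ^ 2) (t ^ 2)⁻¹ ((t ^ 2) ^ (N + 1)) (del t N) (del t N)⁻¹ n
      (fun i => opG t N (i - 1)) (fun i => opH t N (i - 1)) (opE t N) where
  qq := mul_inv_cancel₀ (pow_ne_zero 2 ht)
  dd := mul_inv_cancel₀ hd
  dq := del_mul t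
  h_eq _ := rfl
  sq i _ _ := opG_mul_self t _
  braid i h _ := by
    obtain ⟨i, rfl⟩ := Nat.exists_eq_add_of_le' h
    exact opG_braid t i
  comm i j h hij _ := opG_comm t (by omega)
  e_sq _ := opE_mul_self t
  e_comm i h _ := opE_comm t (by omega)
  e_g1 _ := opE_mul_opG_zero t
  g1_e _ := opG_zero_mul_opE t
  e_g2_e _ := opE_mul_opG_one_mul_opE t
  w_eTwo := h1
  eTwo_w := h2

theorem opG_mul_opH (ht : t ≠ 0) (p : ℕ) : opG t N p * opH t N p = 1 :=
  mul_inv_of_sq (mul_inv_cancel₀ (pow_ne_zero 2 ht)) (opG_mul_self t p) rfl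

theorem tuple (ht : t ≠ 0) (hd : del t N ≠ 0) (n : ℕ) :
    Tuple (t ^ 2) (t ^ 2)⁻¹ ((t ^ 2) ^ (N + 1)) (del t N) (del t N)⁻¹ n
      (fun i => opG t N (i - 1)) (fun i => opH t N (i - 1)) (opE t N) := by
  -- On three strands the relations for e_(2) are vacuous. This tuple already suffices to identify
  -- e_(2) with `opX`.
  have T := tuple_of_eTwo (N := N) ht hd 3 (by omega) (by omega)
  have hX : opE t N * (opG t N 1 * opG t N 2 * opH t N 0 * opH t N 1) * opE t N = opX t N :=
    eTwo_of_symm T (opG_mul_self t 2) (fun _ => rfl) (opG_comm t (by omega)) (opG_braid t 1)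
      (opE_comm t le_rfl) (opE_word_opE t)
  refine tuple_of_eTwo ht hd n (fun _ => ?_) (fun _ => ?_)
  · rw [hX]
    exact word_mul_of_symm (g := fun i => opG t N (i - 1)) (h := fun i => opH t N (i - 1))
      (fun _ => rfl) (opG_mul_opH ht 1) (opG_mul_opH ht 2)
      ((opG_zero_mul_opX t).trans (opG_two_mul_opX t).symm) (opG_zero_mul_opG_one_mul_opX t)
  · rw [hX]
    exact mul_word_of_symm (g := fun i => opG t N (i - 1)) (h := fun i => opH t N (i - 1))
      (opG_mul_opH ht 0) (opG_mul_opH ht 1) (opX_mul_opG_one_mul_opG_zero t)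

section Insert

variable {α : Type*}

/-- Insert `c` at position `n`. -/
def ins (n : ℕ) (c : α) (s : ℕ → α) : ℕ → α := fun i =>
  if i < n then s i else if i = n then c else s (i - 1)

/-- Remove the entry at position `n`. -/
def rem (n : ℕ) (s : ℕ → α) : ℕ → α := fun i => if i < n then s i else s (i + 1)

@[simp] theorem ins_same (n : ℕ) (c : α) (s : ℕ → α) : ins n c s n = c := by simp [ins]

theorem ins_lt {n i : ℕ} (h : i < n) (c : α) (s : ℕ → α) : ins n c s i = s i := by simp [ins, h]

theorem rem_lt {n i : ℕ} (h : i < n) (s : ℕ → α) : rem n s i = s i := by simp [rem, h]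

theorem rem_ins (n : ℕ) (c : α) (s : ℕ → α) : rem n (ins n c s) = s := by
  ext i
  simp only [rem, ins]
  split_ifs <;> first | rfl | omega

theorem ins_comp_swap {n p : ℕ} (h : p + 1 < n) (c : α) (s : ℕ → α) :
    ins n c s ∘ swap p (p + 1) = ins n c (s ∘ swap p (p + 1)) := by
  ext i
  simp only [Function.comp_apply, ins, swap_apply_def]
  split_ifs <;> first | rfl | omega

theorem rem_comp_swap {n p : ℕ} (h : p + 1 < n) (s : ℕ → α) :
    rem n s ∘ swap p (p + 1) = rem n (s ∘ swap p (p + 1)) := by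
  ext i
  simp only [Function.comp_apply, rem, swap_apply_def]
  split_ifs <;> first | rfl | omega

theorem cap_ins {n : ℕ} (h : 2 ≤ n) (c d : α) (s : ℕ → α) :
    cap (ins n c s) d = ins n c (cap s d) := by
  ext i
  simp only [cap, ins]
  split_ifs <;> first | rfl | omega

theorem cap_rem {n : ℕ} (h : 2 ≤ n) (d : α) (s : ℕ → α) :
    cap (rem n s) d = rem n (cap s d) := by
  ext i
  simp only [cap, rem]
  split_ifs <;> first | rfl | omega

theorem ins_comp_swap_top (p : ℕ) (c : α) (s : ℕ → α) :
    ins (p + 1) c s ∘ swap p (p + 1) = ins p c s := by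
  ext i
  simp only [Function.comp_apply, ins, swap_apply_def]
  split_ifs <;> first | rfl | omega | (congr 1; omega)

theorem rem_comp_swap_top (p : ℕ) (s : ℕ → α) :
    rem (p + 1) (s ∘ swap p (p + 1)) = rem p s := by
  ext i
  simp only [Function.comp_apply, rem, swap_apply_def]
  split_ifs <;> first | rfl | omega | (congr 1; omega)

theorem rem_succ_ins (p : ℕ) (s : ℕ → α) : rem (p + 1) (ins p (s p) s) = s := by
  ext i
  simp only [rem, ins]
  split_ifs <;> first | rfl | omega | (congr 1; omega)

theorem rem_ins_succ (p : ℕ) (s : ℕ → α) : rem p (ins (p + 1) (s p) s) = s := by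
  ext i
  simp only [rem, ins]
  split_ifs <;> first | rfl | omega | (congr 1; omega)

theorem ins_ins_comp_swap (p : ℕ) (a b : α) (s : ℕ → α) :
    ins (p + 1) b (ins p a s) ∘ swap p (p + 1) = ins (p + 1) a (ins p b s) := by
  ext i
  simp only [Function.comp_apply, ins, swap_apply_def]
  split_ifs <;> first | rfl | omega

theorem rem_rem_comp_swap (p : ℕ) (s : ℕ → α) :
    rem p (rem (p + 1) (s ∘ swap p (p + 1))) = rem p (rem (p + 1) s) := by
  ext i
  simp only [Function.comp_apply, rem, swap_apply_def]
  split_ifs <;> first | rfl | omega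

end Insert

section Operators

variable (F)

/-- Restriction to the sequences with entry `c` at position `n`. -/
def opI (N n : ℕ) (c : Fin (N + 1)) : Module.End F ((ℕ → Fin (N + 1)) → F) where
  toFun f s := f (ins n c s)
  map_add' _ _ := rfl
  map_smul' _ _ := rfl

/-- Tensoring with a basis vector at position `n`. -/
def opJ (N n : ℕ) (c : Fin (N + 1)) : Module.End F ((ℕ → Fin (N + 1)) → F) where
  toFun f s := if s n = c then f (rem n s) else 0
  map_add' f f' := by ext s; simp only [Pi.add_apply]; split_ifs <;> simp
  map_smul' a f := by ext s; simp

/-- Projection to the sequences with entry `c` at position `n`. -/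
def opP (N n : ℕ) (c : Fin (N + 1)) : Module.End F ((ℕ → Fin (N + 1)) → F) where
  toFun f s := if s n = c then f s else 0
  map_add' f f' := by ext s; simp only [Pi.add_apply]; split_ifs <;> simp
  map_smul' a f := by ext s; simp

variable {F}

theorem opI_apply (n : ℕ) (c : Fin (N + 1)) (f : (ℕ → Fin (N + 1)) → F) (s : ℕ → Fin (N + 1)) :
    opI F N n c f s = f (ins n c s) := rfl

theorem opJ_apply (n : ℕ) (c : Fin (N + 1)) (f : (ℕ → Fin (N + 1)) → F) (s : ℕ → Fin (N + 1)) :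
    opJ F N n c f s = if s n = c then f (rem n s) else 0 := rfl

theorem opP_apply (n : ℕ) (c : Fin (N + 1)) (f : (ℕ → Fin (N + 1)) → F) (s : ℕ → Fin (N + 1)) :
    opP F N n c f s = if s n = c then f s else 0 := rfl

theorem opI_mul_opJ (n : ℕ) (c : Fin (N + 1)) : opI F N n c * opJ F N n c = 1 := by
  ext f s
  simp [opI_apply, opJ_apply, rem_ins]

/-- Inserting `c` at `p` pushes `s p` to position `p + 1`; removing it there is allowed only if it
equals `c`, and then restores `s`. -/
theorem opI_mul_opJ_succ (p : ℕ) (c : Fin (N + 1)) :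
    opI F N p c * opJ F N (p + 1) c = opP F N p c := by
  ext f s
  have : ins p c s (p + 1) = s p := by simp [ins]
  simp only [Module.End.mul_apply, opI_apply, opJ_apply, opP_apply, this]
  split_ifs with h
  · rw [← h, rem_succ_ins]
  · rfl

theorem opI_succ_mul_opJ (p : ℕ) (c : Fin (N + 1)) :
    opI F N (p + 1) c * opJ F N p c = opP F N p c := by
  ext f s
  simp only [Module.End.mul_apply, opI_apply, opJ_apply, opP_apply, ins_lt (Nat.lt_succ_self p)]
  split_ifs with h
  · rw [← h, rem_ins_succ]
  · rfl

theorem commute_opG_opI {n p : ℕ} (h : p + 1 < n) (c : Fin (N + 1)) :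
    Commute (opG t N p) (opI F N n c) := by
  ext f s
  simp only [Module.End.mul_apply, opI_apply, opG_apply, ins_comp_swap h, ins_lt h,
    ins_lt (Nat.lt_of_succ_lt h)]

theorem commute_opG_opJ {n p : ℕ} (h : p + 1 < n) (c : Fin (N + 1)) :
    Commute (opG t N p) (opJ F N n c) := by
  ext f s
  have h1 : swap p (p + 1) n = n := swap_apply_of_ne_of_ne (by omega) (by omega)
  simp only [Module.End.mul_apply, opJ_apply, opG_apply, rem_comp_swap h, rem_lt h,
    rem_lt (Nat.lt_of_succ_lt h), Function.comp_apply, h1]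
  split_ifs <;> simp

theorem commute_opE_opI {n : ℕ} (h : 2 ≤ n) (c : Fin (N + 1)) :
    Commute (opE t N) (opI F N n c) := by
  ext f s
  simp only [Module.End.mul_apply, opI_apply, opE_apply, cap_ins h, ins_lt (show 0 < n by omega),
    ins_lt (show 1 < n by omega)]

theorem commute_opE_opJ {n : ℕ} (h : 2 ≤ n) (c : Fin (N + 1)) :
    Commute (opE t N) (opJ F N n c) := by
  ext f s
  have h1 : ∀ d, cap s d n = s n := fun d => by simp [cap]; omega
  simp only [Module.End.mul_apply, opJ_apply, opE_apply, cap_rem h, rem_lt (show 0 < n by omega),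
    rem_lt (show 1 < n by omega), h1]
  split_ifs <;> simp

theorem sum_smul_opP_apply (p : ℕ) (φ : Fin (N + 1) → F) (f : (ℕ → Fin (N + 1)) → F)
    (s : ℕ → Fin (N + 1)) : (∑ a, φ a • opP F N p a) f s = φ (s p) * f s := by
  simp [LinearMap.sum_apply, Finset.sum_apply, opP_apply]

theorem sum_opP (p : ℕ) : ∑ a, opP F N p a = 1 := by
  ext f s
  have := sum_smul_opP_apply p (fun _ => (1 : F)) f s
  simpa using this

/-- With the entry at `p + 1` frozen to `c`, the diagonal part of the generator is a function of the
entry at `p`, and the swap moves the frozen entry to `p`. -/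
theorem opI_mul_opG (p : ℕ) (c : Fin (N + 1)) :
    opI F N (p + 1) c * opG t N p =
      (∑ a, gam t a c • opP F N p a) * opI F N (p + 1) c + t • opI F N p c := by
  ext f s
  simp only [Module.End.mul_apply, LinearMap.add_apply, LinearMap.smul_apply, Pi.add_apply,
    Pi.smul_apply, smul_eq_mul, sum_smul_opP_apply, opI_apply, opG_apply, ins_comp_swap_top,
    ins_same, ins_lt (Nat.lt_succ_self p)]

theorem opG_mul_opJ (p : ℕ) (c : Fin (N + 1)) :
    opG t N p * opJ F N (p + 1) c =
      opJ F N (p + 1) c * (∑ a, gam t a c • opP F N p a) + t • opJ F N p c := by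
  ext f s
  have h1 : swap p (p + 1) (p + 1) = p := swap_apply_right _ _
  simp only [Module.End.mul_apply, LinearMap.add_apply, LinearMap.smul_apply, Pi.add_apply,
    Pi.smul_apply, smul_eq_mul, sum_smul_opP_apply, opJ_apply, opG_apply, rem_comp_swap_top,
    Function.comp_apply, h1, rem_lt (Nat.lt_succ_self p)]
  congr 1
  split_ifs with h
  · rw [h]
  · rw [mul_zero]

theorem opI_mul_opI_mul_opG (p : ℕ) (a b : Fin (N + 1)) :
    opI F N p a * opI F N (p + 1) b * opG t N p =
      gam t a b • (opI F N p a * opI F N (p + 1) b) +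
        t • (opI F N p b * opI F N (p + 1) a) := by
  ext f s
  simp only [Module.End.mul_apply, LinearMap.add_apply, LinearMap.smul_apply, Pi.add_apply,
    Pi.smul_apply, smul_eq_mul, opI_apply, opG_apply, ins_ins_comp_swap,
    ins_same, ins_lt (Nat.lt_succ_self p)]

theorem opG_mul_opJ_mul_opJ (p : ℕ) (a b : Fin (N + 1)) :
    opG t N p * (opJ F N (p + 1) b * opJ F N p a) =
      gam t a b • (opJ F N (p + 1) b * opJ F N p a) +
        t • (opJ F N (p + 1) a * opJ F N p b) := by
  ext f s
  have h1 : swap p (p + 1) (p + 1) = p := swap_apply_right _ _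
  have h2 : swap p (p + 1) p = p + 1 := swap_apply_left _ _
  simp only [Module.End.mul_apply, LinearMap.add_apply, LinearMap.smul_apply, Pi.add_apply,
    Pi.smul_apply, smul_eq_mul, opJ_apply, opG_apply, rem_rem_comp_swap, h1, h2,
    Function.comp_apply, rem_lt (Nat.lt_succ_self p)]
  split_ifs <;> first | (subst_vars; rfl) | (subst_vars; ring)

end Operators

end Model

end QBrauer

/-! ### Weighted partial traces over one tensor factor. -/

namespace QBrauer

namespace Model

variable {F : Type*} [Field F] (t : F) {N : ℕ}

/-- The weights of the partial trace. -/
def wt (c : Fin (N + 1)) : F := (t ^ 2) ^ (N - (c : ℕ))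

/-- The weighted partial trace over the tensor factor `n`. -/
def opEx (N n : ℕ) : Module.End F ((ℕ → Fin (N + 1)) → F) →ₗ[F]
    Module.End F ((ℕ → Fin (N + 1)) → F) :=
  ∑ c, wt t c • (LinearMap.mulLeft F (opI F N n c) ∘ₗ LinearMap.mulRight F (opJ F N n c))

theorem opEx_apply (n : ℕ) (X : Module.End F ((ℕ → Fin (N + 1)) → F)) :
    opEx t N n X = ∑ c, wt t c • (opI F N n c * X * opJ F N n c) := by
  simp [opEx, LinearMap.sum_apply, mul_assoc]

theorem sum_wt : ∑ c : Fin (N + 1), wt t c = del t N := by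
  rw [del, ← Equiv.sum_comp Fin.revPerm]
  refine Finset.sum_congr rfl fun c _ => ?_
  rw [wt, Fin.revPerm_apply, Fin.val_rev]
  congr 1
  omega

/-- The summands of a telescoping sum. -/
def tel' (a c : Fin (N + 1)) : F :=
  if c = a then t ^ 2 * wt t a else if c < a then (t ^ 2 - 1) * wt t c else 0

theorem sum_tel' (a : Fin (N + 1)) : ∑ c, tel' t a c = (t ^ 2) ^ (N + 1) := by
  rw [← sum_tel t a.rev, ← Equiv.sum_comp Fin.revPerm]
  refine Finset.sum_congr rfl fun c _ => ?_
  have h1 : N - (c.rev : ℕ) = c := by rw [Fin.val_rev]; omega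
  have h2 : (a.rev : ℕ) + 1 = (N - a) + 1 := by rw [Fin.val_rev]; omega
  have h3 : c.rev = a ↔ c = a.rev := Fin.rev_eq_iff
  have h4 : c.rev < a ↔ a.rev < c := by
    rw [Fin.lt_def, Fin.lt_def, Fin.val_rev, Fin.val_rev]; omega
  simp only [tel', tel, Fin.revPerm_apply, h3, h4, wt, h1, h2, pow_succ']

theorem opEx_mul {n : ℕ} {a : Module.End F ((ℕ → Fin (N + 1)) → F)}
    (ha : ∀ c, Commute a (opI F N n c)) (X : Module.End F ((ℕ → Fin (N + 1)) → F)) :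
    opEx t N n (a * X) = a * opEx t N n X := by
  rw [opEx_apply, opEx_apply, Finset.mul_sum]
  refine Finset.sum_congr rfl fun c _ => ?_
  rw [← mul_assoc, ← (ha c).eq, mul_smul_comm]
  simp only [mul_assoc]

theorem mul_opEx {n : ℕ} {a : Module.End F ((ℕ → Fin (N + 1)) → F)}
    (ha : ∀ c, Commute a (opJ F N n c)) (X : Module.End F ((ℕ → Fin (N + 1)) → F)) :
    opEx t N n (X * a) = opEx t N n X * a := by
  rw [opEx_apply, opEx_apply, Finset.sum_mul]
  refine Finset.sum_congr rfl fun c _ => ?_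
  rw [smul_mul_assoc, mul_assoc _ _ a, ← (ha c).eq]
  simp only [mul_assoc]

theorem opEx_one (n : ℕ) : opEx t N n 1 = del t N • 1 := by
  simp only [opEx_apply, mul_one, opI_mul_opJ, ← Finset.sum_smul, sum_wt]

theorem wt_mul_gam_add (a c : Fin (N + 1)) :
    wt t c * gam t a c + (if c = a then t * wt t a else 0) = tel' t a c := by
  rw [tel']
  rcases lt_trichotomy c a with h | rfl | h
  · rw [gam_gt t h, if_neg h.ne, if_neg h.ne, if_pos h]; ring
  · rw [gam_self, if_pos rfl, if_pos rfl]; ring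
  · rw [gam_lt t h, if_neg h.ne', if_neg h.ne', if_neg h.not_gt]; ring

/-- The result is diagonal, and its coefficient on the entry `a` is the telescoping sum of `tel' t
a`, which does not depend on `a`. -/
theorem opEx_opG (p : ℕ) : opEx t N (p + 1) (opG t N p) = (t ^ 2) ^ (N + 1) • 1 := by
  have h1 : ∀ c, wt t c • (opI F N (p + 1) c * opG t N p * opJ F N (p + 1) c) =
      ∑ a, tel' t a c • opP F N p a := by
    intro c
    rw [opI_mul_opG, add_mul, mul_assoc, opI_mul_opJ, mul_one, smul_mul_assoc, opI_mul_opJ_succ,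
      smul_add, Finset.smul_sum, smul_smul]
    simp only [← wt_mul_gam_add, add_smul, Finset.sum_add_distrib, smul_smul, ite_smul, zero_smul,
      Finset.sum_ite_eq, Finset.mem_univ, if_true]
    rw [mul_comm t]
  rw [opEx_apply]
  simp only [h1]
  rw [Finset.sum_comm]
  simp only [← Finset.sum_smul, sum_tel']
  rw [← Finset.smul_sum, sum_opP]

theorem opEx_opE : opEx t N 1 (opE t N) = (t ^ 2) ^ N • 1 := by
  ext f s
  have h1 : ∀ c d, rem 1 (cap (ins 1 c s) d) = ins 0 d (rem 0 s) := by
    intro c d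
    ext i
    simp only [cap, ins, rem]
    split_ifs <;> first | rfl | omega | (congr 2; omega)
  have h2 : ins 0 (s 0) (rem 0 s) = s := by
    ext i
    rcases Nat.eq_zero_or_pos i with rfl | hi
    · simp [ins]
    · simp [ins, rem, hi.ne', Nat.sub_add_cancel hi]
  have h3 : ∀ (u : ℕ → Fin (N + 1)) d, cap u d 1 = d := fun u d => by simp [cap]
  have h4 : ∀ c, ins 1 c s 0 = s 0 := fun c => ins_lt (by omega) c s
  simp only [opEx_apply, LinearMap.sum_apply, Finset.sum_apply, LinearMap.smul_apply,
    Pi.smul_apply, Module.End.mul_apply, opI_apply, opE_apply, opJ_apply, h1, h3, h4, ins_same,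
    smul_eq_mul, Module.End.one_apply, Finset.sum_ite_eq', Finset.mem_univ, if_true]
  rw [Finset.sum_eq_single (s 0)]
  · rw [if_pos rfl, h2, wt, ← mul_assoc, ← pow_add, Nat.sub_add_cancel (by omega)]
  · intro c _ hc
    rw [if_neg hc.symm, mul_zero]
  · simp

/-- Diagonal terms agree on both sides; the swap terms are exchanged by renaming (a, b) to (b, a),
since the weight is the symmetric product `wt a * wt b`. This is the source of the trace property
for the top generator. -/
theorem opEx_opEx_comm (p : ℕ) (X : Module.End F ((ℕ → Fin (N + 1)) → F)) :
    opEx t N p (opEx t N (p + 1) (opG t N p * X)) =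
      opEx t N p (opEx t N (p + 1) (X * opG t N p)) := by
  have h1 : ∀ Y : Module.End F ((ℕ → Fin (N + 1)) → F), opEx t N p (opEx t N (p + 1) Y) =
      ∑ a, ∑ b, (wt t a * wt t b) • ((opI F N p a * opI F N (p + 1) b) * Y *
        (opJ F N (p + 1) b * opJ F N p a)) := by
    intro Y
    simp only [opEx_apply, Finset.mul_sum, Finset.sum_mul, Finset.smul_sum, mul_smul_comm,
      smul_mul_assoc, smul_smul, mul_assoc]
  have h2 : ∀ a b, (wt t a * wt t b) • ((opI F N p a * opI F N (p + 1) b) * (opG t N p * X) *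
        (opJ F N (p + 1) b * opJ F N p a)) =
      (wt t a * wt t b * gam t a b) • ((opI F N p a * opI F N (p + 1) b) * X *
        (opJ F N (p + 1) b * opJ F N p a)) +
      (wt t a * wt t b * t) • ((opI F N p b * opI F N (p + 1) a) * X *
        (opJ F N (p + 1) b * opJ F N p a)) := by
    intro a b
    rw [← mul_assoc _ (opG t N p), opI_mul_opI_mul_opG]
    simp only [add_mul, smul_mul_assoc, smul_add, smul_smul]
  have h3 : ∀ a b, (wt t a * wt t b) • ((opI F N p a * opI F N (p + 1) b) * (X * opG t N p) *
        (opJ F N (p + 1) b * opJ F N p a)) =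
      (wt t a * wt t b * gam t a b) • ((opI F N p a * opI F N (p + 1) b) * X *
        (opJ F N (p + 1) b * opJ F N p a)) +
      (wt t a * wt t b * t) • ((opI F N p a * opI F N (p + 1) b) * X *
        (opJ F N (p + 1) a * opJ F N p b)) := by
    intro a b
    rw [← mul_assoc _ X, mul_assoc _ (opG t N p), opG_mul_opJ_mul_opJ]
    simp only [mul_add, mul_smul_comm, smul_add, smul_smul]
  rw [h1, h1]
  simp only [h2, h3, Finset.sum_add_distrib]
  congr 1
  rw [Finset.sum_comm]
  simp only [mul_comm (wt t _) (wt t _)]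

/-- The diagonal coefficients of the inverses of the Hecke generators. -/
def gamInv (a b : Fin (N + 1)) : F := (t ^ 2)⁻¹ * gam t a b + ((t ^ 2)⁻¹ - 1)

variable {t}

theorem opI_mul_opH (ht : t ≠ 0) (p : ℕ) (c : Fin (N + 1)) :
    opI F N (p + 1) c * opH t N p =
      (∑ a, gamInv t a c • opP F N p a) * opI F N (p + 1) c + t⁻¹ • opI F N p c := by
  have h1 : ∑ a, gamInv t a c • opP F N p a =
      (t ^ 2)⁻¹ • (∑ a, gam t a c • opP F N p a) + ((t ^ 2)⁻¹ - 1) • 1 := by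
    simp only [gamInv, add_smul, Finset.sum_add_distrib, ← smul_smul, ← Finset.smul_sum, sum_opP]
  rw [opH, mul_add, mul_smul_comm, mul_smul_comm, opI_mul_opG, h1, mul_one, add_mul,
    smul_mul_assoc, smul_mul_assoc, one_mul, smul_add, smul_smul]
  have h2 : (t ^ 2)⁻¹ * t = t⁻¹ := by field_simp
  rw [h2]
  abel

/-- The total coefficient of P_a Y P_b in `opEx_opH_mul_mul_opG`, with P_a the projection to entry
`a`. -/
theorem sum_wt_mul_gamInv_mul_gam (ht : t ≠ 0) (a b : Fin (N + 1)) :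
    ∑ c, wt t c * gamInv t a c * gam t b c + t * wt t b * gamInv t a b +
      t⁻¹ * wt t a * gam t b a = 0 := by
  have g1 : ∀ {x y : Fin (N + 1)}, y < x → gamInv t x y = 0 := fun h => by
    rw [gamInv, gam_gt t h]; field_simp; ring
  have g2 : ∀ {x y : Fin (N + 1)}, x < y → gamInv t x y = (t ^ 2)⁻¹ - 1 := fun h => by
    rw [gamInv, gam_lt t h, mul_zero, zero_add]
  have g3 : ∀ x : Fin (N + 1), gamInv t x x = (t ^ 2)⁻¹ - t⁻¹ := fun x => by
    rw [gamInv, gam_self]; field_simp; ring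
  rcases lt_trichotomy a b with h | rfl | h
  -- Each summand is a multiple of a difference of two telescoping families with equal sums, plus
  -- corrections at `c = a` and `c = b` that cancel the boundary terms.
  · have h1 : ∀ c, wt t c * gamInv t a c * gam t b c =
        ((t ^ 2)⁻¹ - 1) * (tel' t b c - tel' t a c) +
        (if c = a then wt t a * (((t ^ 2)⁻¹ - t⁻¹) * (t ^ 2 - 1) + ((t ^ 2)⁻¹ - 1)) else 0) +
        (if c = b then -(t * ((t ^ 2)⁻¹ - 1) * wt t b) else 0) := by
      intro c
      simp only [tel']
      rcases lt_trichotomy c a with h2 | h2 | h2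
      · have h3 := h2.trans h
        rw [g1 h2, if_neg h2.ne, if_neg h3.ne, if_neg h3.ne, if_pos h3, if_neg h2.ne, if_pos h2]
        ring
      · subst h2
        rw [g3, gam_gt t h, if_neg h.ne, if_pos h, if_pos rfl, if_pos rfl, if_neg h.ne]
        ring
      · rw [g2 h2, if_neg h2.ne', if_neg h2.ne', if_neg h2.not_gt]
        rcases lt_trichotomy c b with h3 | h3 | h3
        · rw [gam_gt t h3, if_neg h3.ne, if_pos h3, if_neg h3.ne]; ring
        · subst h3
          rw [gam_self, if_pos rfl, if_pos rfl]; ring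
        · rw [gam_lt t h3, if_neg h3.ne', if_neg h3.ne', if_neg h3.not_gt]; ring
    simp only [h1, Finset.sum_add_distrib, ← Finset.mul_sum, Finset.sum_sub_distrib, sum_tel',
      sub_self, mul_zero, zero_add, Finset.sum_ite_eq', Finset.mem_univ, if_true]
    rw [g2 h, gam_gt t h]
    field_simp
    ring
  · have h1 : ∀ c, wt t c * gamInv t a c * gam t a c =
        if c = a then wt t a * ((t ^ 2)⁻¹ - t⁻¹) * (t ^ 2 - t) else 0 := by
      intro c
      rcases lt_trichotomy c a with h2 | h2 | h2
      · rw [g1 h2, if_neg h2.ne]; ring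
      · subst h2
        rw [g3, gam_self, if_pos rfl]
      · rw [gam_lt t h2, if_neg h2.ne']; ring
    simp only [h1, Finset.sum_ite_eq', Finset.mem_univ, if_true]
    rw [g3, gam_self]
    field_simp
    ring
  · have h1 : ∀ c, wt t c * gamInv t a c * gam t b c = 0 := by
      intro c
      rcases lt_or_ge c a with h2 | h2
      · rw [g1 h2]; ring
      · rw [gam_lt t (h.trans_le h2)]; ring
    rw [Finset.sum_eq_zero fun c _ => h1 c, g1 h, gam_lt t h]
    ring

/-- Conjugation by the generator moves the traced factor from `p + 1` to `p` when `Y` does not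
involve factor `p + 1`. In the expansion the product of the two swap terms gives the right-hand
side; the remaining terms have the form P_a Y P_b and cancel. -/
theorem opEx_opH_mul_mul_opG (ht : t ≠ 0) {p : ℕ} {Y : Module.End F ((ℕ → Fin (N + 1)) → F)}
    (hI : ∀ c, Commute Y (opI F N (p + 1) c)) (hJ : ∀ c, Commute Y (opJ F N (p + 1) c)) :
    opEx t N (p + 1) (opH t N p * Y * opG t N p) = opEx t N p Y := by
  set P := opP F N p
  have h1 : ∀ c, wt t c • (opI F N (p + 1) c * (opH t N p * Y * opG t N p) *
      opJ F N (p + 1) c) =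
      (∑ a, ∑ b, (wt t c * gamInv t a c * gam t b c) • (P a * Y * P b) +
        ∑ a, (t * wt t c * gamInv t a c) • (P a * Y * P c) +
        ∑ b, (t⁻¹ * wt t c * gam t b c) • (P c * Y * P b)) +
      wt t c • (opI F N p c * Y * opJ F N p c) := by
    intro c
    set G1 := ∑ a, gam t a c • P a with hG1
    set G2 := ∑ a, gamInv t a c • P a with hG2
    have e1 : opI F N (p + 1) c * (opH t N p * Y * opG t N p) * opJ F N (p + 1) c =
        (opI F N (p + 1) c * opH t N p) * Y * (opG t N p * opJ F N (p + 1) c) := by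
      simp only [mul_assoc]
    have e2 : G2 * opI F N (p + 1) c * Y * (opJ F N (p + 1) c * G1) = G2 * Y * G1 := by
      calc _ = G2 * (opI F N (p + 1) c * Y) * opJ F N (p + 1) c * G1 := by simp only [mul_assoc]
        _ = G2 * Y * (opI F N (p + 1) c * opJ F N (p + 1) c) * G1 := by
          rw [← (hI c).eq]; simp only [mul_assoc]
        _ = _ := by rw [opI_mul_opJ, mul_one]
    have e3 : G2 * opI F N (p + 1) c * Y * (opJ F N p c) = G2 * Y * P c := by
      calc _ = G2 * (opI F N (p + 1) c * Y) * opJ F N p c := by simp only [mul_assoc]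
        _ = G2 * Y * (opI F N (p + 1) c * opJ F N p c) := by
          rw [← (hI c).eq]; simp only [mul_assoc]
        _ = _ := by rw [opI_succ_mul_opJ]
    have e4 : opI F N p c * Y * (opJ F N (p + 1) c * G1) = P c * Y * G1 := by
      calc _ = opI F N p c * (Y * opJ F N (p + 1) c) * G1 := by simp only [mul_assoc]
        _ = (opI F N p c * opJ F N (p + 1) c) * Y * G1 := by
          rw [(hJ c).eq]; simp only [mul_assoc]
        _ = _ := by rw [opI_mul_opJ_succ]
    have e5 : opI F N (p + 1) c * (opH t N p * Y * opG t N p) * opJ F N (p + 1) c =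
        G2 * Y * G1 + t • (G2 * Y * P c) + t⁻¹ • (P c * Y * G1) +
          opI F N p c * Y * opJ F N p c := by
      rw [e1, opI_mul_opH ht, opG_mul_opJ, ← hG1, ← hG2]
      simp only [add_mul, mul_add, smul_mul_assoc, mul_smul_comm, smul_add, smul_smul]
      rw [e2, e3, e4, mul_inv_cancel₀ ht, one_smul]
      abel
    have e6 : wt t c • (G2 * Y * G1) =
        ∑ a, ∑ b, (wt t c * gamInv t a c * gam t b c) • (P a * Y * P b) := by
      rw [hG2, Finset.sum_mul, Finset.sum_mul, Finset.smul_sum]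
      refine Finset.sum_congr rfl fun a _ => ?_
      rw [hG1, Finset.mul_sum, Finset.smul_sum]
      refine Finset.sum_congr rfl fun b _ => ?_
      rw [smul_mul_assoc, smul_mul_assoc, mul_smul_comm, smul_smul, smul_smul, mul_assoc]
    have e7 : wt t c • t • (G2 * Y * P c) =
        ∑ a, (t * wt t c * gamInv t a c) • (P a * Y * P c) := by
      rw [hG2, Finset.sum_mul, Finset.sum_mul, Finset.smul_sum, Finset.smul_sum]
      refine Finset.sum_congr rfl fun a _ => ?_
      rw [smul_mul_assoc, smul_mul_assoc, smul_smul, smul_smul, mul_comm (wt t c) t]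
    have e8 : wt t c • t⁻¹ • (P c * Y * G1) =
        ∑ b, (t⁻¹ * wt t c * gam t b c) • (P c * Y * P b) := by
      rw [hG1, Finset.mul_sum, Finset.smul_sum, Finset.smul_sum]
      refine Finset.sum_congr rfl fun a _ => ?_
      rw [mul_smul_comm, smul_smul, smul_smul, mul_comm (wt t c) t⁻¹]
    rw [e5, smul_add, smul_add, smul_add, e6, e7, e8]
  rw [opEx_apply, opEx_apply]
  simp only [h1]
  rw [Finset.sum_add_distrib, add_eq_right]
  simp only [Finset.sum_add_distrib]
  have s1 : ∑ c, ∑ a, ∑ b, (wt t c * gamInv t a c * gam t b c) • (P a * Y * P b) =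
      ∑ a, ∑ b, (∑ c, wt t c * gamInv t a c * gam t b c) • (P a * Y * P b) := by
    rw [Finset.sum_comm]
    refine Finset.sum_congr rfl fun a _ => ?_
    rw [Finset.sum_comm]
    simp only [Finset.sum_smul]
  have s2 : ∑ c, ∑ a, (t * wt t c * gamInv t a c) • (P a * Y * P c) =
      ∑ a, ∑ b, (t * wt t b * gamInv t a b) • (P a * Y * P b) := Finset.sum_comm
  rw [s1, s2, ← Finset.sum_add_distrib, ← Finset.sum_add_distrib]
  refine Finset.sum_eq_zero fun a _ => ?_
  rw [← Finset.sum_add_distrib, ← Finset.sum_add_distrib]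
  refine Finset.sum_eq_zero fun b _ => ?_
  rw [← add_smul, ← add_smul, sum_wt_mul_gamInv_mul_gam ht, zero_smul]

end Model

end QBrauer

/-! ### Conditional expectations and the traces obtained by composing them. -/

namespace QBrauer

/-- A compatible family of conditional expectations, up to scalars, from the algebra on `n + 1`
strands to the algebra on `n` strands. -/
structure CondExp {R B : Type*} [CommRing R] [Ring B] [Algebra R B] (q' r d : R)
    (g h : ℕ → B) (e : B) (E : ℕ → B →ₗ[R] B) : Prop where
  one : ∀ n, 1 ≤ n → E n 1 = d • 1
  g_top : ∀ n, 1 ≤ n → E n (g n) = r • 1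
  conj : ∀ n, 1 ≤ n → E n (Tuple.conjE g h e n) = (r * q') • 1
  g_mul : ∀ n i x, 1 ≤ i → i < n → E n (g i * x) = g i * E n x
  mul_g : ∀ n i x, 1 ≤ i → i < n → E n (x * g i) = E n x * g i
  e_mul : ∀ n x, 2 ≤ n → E n (e * x) = e * E n x
  mul_e : ∀ n x, 2 ≤ n → E n (x * e) = E n x * e
  swap : ∀ n x, 2 ≤ n → E (n - 1) (E n (g n * x)) = E (n - 1) (E n (x * g n))

namespace CondExp

variable {R B : Type*} [CommRing R] [Ring B] [Algebra R B] {q q' r d d' : R}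
  {g h : ℕ → B} {e : B} {E : ℕ → B →ₗ[R] B}

theorem mul_left (hE : CondExp q' r d g h e E) {n : ℕ} {a : B} (ha : a ∈ brauerSub R g e n)
    (x : B) : E n (a * x) = a * E n x := by
  induction ha using Algebra.adjoin_induction generalizing x with
  | mem a ha =>
    rcases ha with ⟨i, h1, h2, rfl⟩ | ⟨hn, rfl⟩
    · exact hE.g_mul n i x h1 h2
    · exact hE.e_mul n x hn
  | algebraMap c => rw [← Algebra.smul_def, ← Algebra.smul_def, map_smul]
  | add a b _ _ ha hb => rw [add_mul, map_add, ha, hb, add_mul]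
  | mul a b _ _ ha hb => rw [mul_assoc, ha, hb, mul_assoc]

theorem mul_right (hE : CondExp q' r d g h e E) {n : ℕ} {a : B} (ha : a ∈ brauerSub R g e n)
    (x : B) : E n (x * a) = E n x * a := by
  induction ha using Algebra.adjoin_induction generalizing x with
  | mem a ha =>
    rcases ha with ⟨i, h1, h2, rfl⟩ | ⟨hn, rfl⟩
    · exact hE.mul_g n i x h1 h2
    · exact hE.mul_e n x hn
  | algebraMap c =>
    rw [← Algebra.commutes, ← Algebra.smul_def, map_smul, ← Algebra.commutes, ← Algebra.smul_def]
  | add a b _ _ ha hb => rw [mul_add, map_add, ha, hb, mul_add]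
  | mul a b _ _ ha hb => rw [← mul_assoc, hb, ha, mul_assoc]

theorem mul_mul (hE : CondExp q' r d g h e E) {n : ℕ} {a b : B} (ha : a ∈ brauerSub R g e n)
    (hb : b ∈ brauerSub R g e n) (x : B) : E n (a * x * b) = a * E n x * b := by
  rw [hE.mul_right hb, hE.mul_left ha]

/-- By bimodularity and the three-piece decomposition, it is enough that the values at 1, g_n and
`conjE` are scalars. -/
theorem mem (hE : CondExp q' r d g h e E) {n : ℕ} (T : Tuple q q' r d d' (n + 1) g h e)
    (hn : 1 ≤ n) {x : B} (hx : x ∈ brauerSub R g e (n + 1)) : E n x ∈ brauerSub R g e n := by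
  have h1 : ∀ c : R, c • (1 : B) ∈ brauerSub R g e n := fun c =>
    Subalgebra.smul_mem _ (Subalgebra.one_mem _) c
  refine (Submodule.span_le.mpr ?_ : _ ≤ (brauerSub R g e n).toSubmodule.comap (E n))
    (T.mem_stepSpan hn hx)
  rintro _ ((hy | ⟨a, ha, b, hb, rfl⟩) | ⟨a, ha, b, hb, rfl⟩)
  · have := hE.mul_left hy 1
    rw [mul_one, hE.one n hn] at this
    rw [SetLike.mem_coe, Submodule.mem_comap, this]
    exact Subalgebra.mul_mem _ hy (h1 _)
  · rw [SetLike.mem_coe, Submodule.mem_comap, hE.mul_mul ha hb, hE.g_top n hn]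
    exact Subalgebra.mul_mem _ (Subalgebra.mul_mem _ ha (h1 _)) hb
  · rw [SetLike.mem_coe, Submodule.mem_comap, hE.mul_mul ha hb, hE.conj n hn]
    exact Subalgebra.mul_mem _ (Subalgebra.mul_mem _ ha (h1 _)) hb

/-- The composition of the normalized conditional expectations down to the algebra on one strand. -/
noncomputable def iter (d' : R) (E : ℕ → B →ₗ[R] B) : ℕ → B →ₗ[R] B
  | 0 => LinearMap.id
  | 1 => LinearMap.id
  | n + 2 => iter d' E (n + 1) ∘ₗ (d' • E (n + 1))

theorem iter_succ {n : ℕ} (hn : 1 ≤ n) (x : B) :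
    iter d' E (n + 1) x = d' • iter d' E n (E n x) := by
  obtain ⟨n, rfl⟩ := Nat.exists_eq_add_of_le' hn
  simp [iter]

theorem brauerSub_le_bot {n : ℕ} (hn : n ≤ 1) : brauerSub R g e n ≤ ⊥ := by
  refine Algebra.adjoin_le ?_
  rintro _ (⟨i, h1, h2, rfl⟩ | ⟨hn, rfl⟩) <;> omega

section Iter

variable (hE : CondExp q' r d g h e E) (T : ∀ n, Tuple q q' r d d' n g h e)
include hE T

theorem iter_mem (n : ℕ) : ∀ x ∈ brauerSub R g e n, iter d' E n x ∈ (⊥ : Subalgebra R B) := by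
  induction n with
  | zero => exact fun x hx => brauerSub_le_bot (Nat.zero_le 1) hx
  | succ n ih =>
    intro x hx
    rcases Nat.eq_zero_or_pos n with rfl | hn
    · exact brauerSub_le_bot le_rfl hx
    · rw [iter_succ hn]
      exact Subalgebra.smul_mem _ (ih _ (hE.mem (T _) hn hx)) _

theorem iter_of_mem {n : ℕ} {y : B} (hy : y ∈ brauerSub R g e n) :
    iter d' E (n + 1) y = iter d' E n y := by
  rcases Nat.eq_zero_or_pos n with rfl | hn
  · rfl
  · have := hE.mul_left hy 1
    rw [mul_one, hE.one n hn, mul_smul_comm, mul_one] at this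
    rw [iter_succ hn, this, map_smul, smul_smul, mul_comm, (T n).dd, one_smul]

theorem iter_one (n : ℕ) : iter d' E n 1 = 1 := by
  induction n with
  | zero => rfl
  | succ n ih => rw [hE.iter_of_mem T (Subalgebra.one_mem _), ih]

omit T in
theorem iter_mul_g_mul {n : ℕ} (hn : 1 ≤ n) {y z : B} (hy : y ∈ brauerSub R g e n)
    (hz : z ∈ brauerSub R g e n) :
    iter d' E (n + 1) (y * g n * z) = (d' * r) • iter d' E n (y * z) := by
  rw [iter_succ hn, hE.mul_mul hy hz, hE.g_top n hn, mul_smul_comm, smul_mul_assoc, mul_one,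
    map_smul, smul_smul]

omit T in
theorem iter_mul_conjE_mul {n : ℕ} (hn : 1 ≤ n) {y z : B} (hy : y ∈ brauerSub R g e n)
    (hz : z ∈ brauerSub R g e n) :
    iter d' E (n + 1) (y * Tuple.conjE g h e n * z) = (d' * (r * q')) • iter d' E n (y * z) := by
  rw [iter_succ hn, hE.mul_mul hy hz, hE.conj n hn, mul_smul_comm, smul_mul_assoc, mul_one,
    map_smul, smul_smul]

/-- It suffices to let `y` run over generators. Those on fewer strands pass through the last
expectation and are covered by induction; the top generator is handled by `swap` after two
expectations. -/
theorem iter_mul_comm (n : ℕ) : ∀ y ∈ brauerSub R g e n, ∀ x ∈ brauerSub R g e n,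
    iter d' E n (x * y) = iter d' E n (y * x) := by
  -- Up to two strands the algebra is commutative, since `e` and `g 1` commute; `swap` is available
  -- only from `n = 2` on.
  have comm : ∀ m, m ≤ 2 → ∀ y ∈ brauerSub R g e m, ∀ x ∈ brauerSub R g e m, x * y = y * x := by
    intro m hm
    have hc : ∀ y ∈ ({x | ∃ i, 1 ≤ i ∧ i < m ∧ x = g i} ∪ {x | 2 ≤ m ∧ x = e} : Set B),
        ∀ x ∈ ({x | ∃ i, 1 ≤ i ∧ i < m ∧ x = g i} ∪ {x | 2 ≤ m ∧ x = e} : Set B),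
        Commute x y := by
      have h1 : Commute e (g 1) := ((T 2).e_g1 le_rfl).trans ((T 2).g1_e le_rfl).symm
      rintro _ (⟨i, hi, hi', rfl⟩ | ⟨_, rfl⟩) _ (⟨j, hj, hj', rfl⟩ | ⟨_, rfl⟩)
      · rw [show i = 1 by omega, show j = 1 by omega]
      · rw [show i = 1 by omega]; exact h1
      · rw [show j = 1 by omega]; exact h1.symm
      · exact Commute.refl _
    intro y hy x hx
    exact (commute_of_mem_adjoin (fun y' hy' =>
      (commute_of_mem_adjoin (fun x' hx' => (hc y' hy' x' hx').symm) hx).symm) hy).eq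
  induction n with
  | zero => intro y hy x hx; rw [comm 0 (by omega) y hy x hx]
  | succ n ih =>
    intro y hy x hx
    rcases Nat.lt_or_ge n 2 with hn | hn
    · rw [comm (n + 1) (by omega) y hy x hx]
    have hlow : ∀ y ∈ brauerSub R g e n, ∀ x ∈ brauerSub R g e (n + 1),
        iter d' E (n + 1) (x * y) = iter d' E (n + 1) (y * x) := by
      intro y hy x hx
      rw [iter_succ (by omega), iter_succ (by omega), hE.mul_right hy, hE.mul_left hy,
        ih y hy _ (hE.mem (T _) (by omega) hx)]
    refine Algebra.adjoin_induction (p := fun y _ => ∀ x ∈ brauerSub R g e (n + 1),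
      iter d' E (n + 1) (x * y) = iter d' E (n + 1) (y * x)) ?_ ?_ ?_ ?_ hy x hx
    · rintro _ (⟨i, h1, h2, rfl⟩ | ⟨_, rfl⟩) x hx
      · rcases Nat.lt_or_ge i n with h3 | h3
        · exact hlow _ (Algebra.subset_adjoin (Or.inl ⟨i, h1, h3, rfl⟩)) x hx
        · obtain rfl : i = n := by omega
          obtain ⟨i, rfl⟩ := Nat.exists_eq_add_of_le' h1
          have := hE.swap (i + 1) x hn
          rw [Nat.add_sub_cancel] at this
          rw [iter_succ h1, iter_succ h1, iter_succ (by omega), iter_succ (by omega), this]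
      · exact hlow _ (e_mem_brauerSub hn) x hx
    · intro c x _
      rw [Algebra.commutes]
    · intro y z _ _ hy hz x hx
      rw [mul_add, add_mul, map_add, map_add, hy x hx, hz x hx]
    · intro y z hy' hz' hy hz x hx
      rw [← mul_assoc, hz _ (Subalgebra.mul_mem _ hx hy'), ← mul_assoc,
        hy _ (Subalgebra.mul_mem _ hz' hx), mul_assoc]

/-- The traces defined by the conditional expectations. -/
theorem exists_trace (hR : Function.Injective (algebraMap R B)) :
    ∃ τ : ∀ n, brauerSub R g e n →ₗ[R] R, ∀ n x, algebraMap R B (τ n x) = iter d' E n x := by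
  have h1 : ∀ n (x : brauerSub R g e n), ∃ c : R, algebraMap R B c = iter d' E n x := fun n x =>
    Algebra.mem_bot.mp (hE.iter_mem T n x x.2)
  choose τ hτ using h1
  refine ⟨fun n => ⟨⟨τ n, fun x y => hR ?_⟩, fun c x => hR ?_⟩, hτ⟩
  · rw [hτ, map_add, hτ, hτ, ← map_add]; rfl
  · rw [RingHom.id_apply, smul_eq_mul, map_mul, hτ, hτ, ← Algebra.smul_def, ← map_smul]; rfl

end Iter

end CondExp

namespace Model

variable {F : Type*} [Field F] {t : F} {N : ℕ}

theorem condExp (ht : t ≠ 0) :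
    CondExp (t ^ 2)⁻¹ ((t ^ 2) ^ (N + 1)) (del t N) (fun i => opG t N (i - 1))
      (fun i => opH t N (i - 1)) (opE t N) (opEx t N) where
  one n _ := opEx_one t n
  g_top n hn := by
    obtain ⟨n, rfl⟩ := Nat.exists_eq_add_of_le' hn
    exact opEx_opG t n
  conj n hn := by
    have h1 : (t ^ 2) ^ (N + 1) * (t ^ 2)⁻¹ = (t ^ 2) ^ N := by
      rw [pow_succ, mul_inv_cancel_right₀ (pow_ne_zero 2 ht)]
    rw [h1]
    -- c_{n+1} is the conjugate of c_n by g_{n+1}, and c_n does not touch the last factor, so the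
    -- partial trace descends to that of c_1 = e.
    induction n, hn using Nat.le_induction with
    | base =>
      rw [Tuple.conjE, Nat.sub_self, dn_zero, up_zero, one_mul, mul_one]
      exact opEx_opE t
    | succ n hn ih =>
      have h2 : Tuple.conjE (fun i => opG t N (i - 1)) (fun i => opH t N (i - 1)) (opE t N) (n + 1) =
          opH t N n * Tuple.conjE (fun i => opG t N (i - 1)) (fun i => opH t N (i - 1))
            (opE t N) n * opG t N n := by
        obtain ⟨n, rfl⟩ := Nat.exists_eq_add_of_le' hn
        rw [Tuple.conjE, Tuple.conjE, Nat.add_sub_cancel, Nat.add_sub_cancel, dn_succ, up_succ']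
        simp only [mul_assoc, show 2 + n - 1 = n + 1 by omega]
      rw [h2, opEx_opH_mul_mul_opG ht, ih]
      · intro c
        refine ((Commute.mul_left ?_ (commute_opE_opI (by omega) c)).mul_left ?_)
        · refine (commute_dn fun i h3 h4 => ?_).symm
          exact (((commute_opG_opI (by omega) c).smul_left _).add_left
            ((Commute.one_left _).smul_left _)).symm
        · exact (commute_up fun i h3 h4 => (commute_opG_opI (by omega) c).symm).symm
      · intro c
        refine ((Commute.mul_left ?_ (commute_opE_opJ (by omega) c)).mul_left ?_)
        · refine (commute_dn fun i h3 h4 => ?_).symm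
          exact (((commute_opG_opJ (by omega) c).smul_left _).add_left
            ((Commute.one_left _).smul_left _)).symm
        · exact (commute_up fun i h3 h4 => (commute_opG_opJ (by omega) c).symm).symm
  g_mul n i x h1 h2 := opEx_mul t (fun c => commute_opG_opI (by omega) c) x
  mul_g n i x h1 h2 := mul_opEx t (fun c => commute_opG_opJ (by omega) c) x
  e_mul n x h := opEx_mul t (fun c => commute_opE_opI h c) x
  mul_e n x h := mul_opEx t (fun c => commute_opE_opJ h c) x
  swap n x h := by
    obtain ⟨n, rfl⟩ := Nat.exists_eq_add_of_le' (show 1 ≤ n by omega)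
    exact opEx_opEx_comm t n x

end Model

end QBrauer

/-! ### Transport of tuples and traces along ring maps and scalar extension. -/

namespace QBrauer

namespace Tuple

section Transport

variable {R B : Type*} [CommRing R] [Ring B] [Algebra R B] {q q' r d d' : R} {n : ℕ}
  {g h : ℕ → B} {e : B}

theorem map {R' B' : Type*} [CommRing R'] [Ring B'] [Algebra R' B'] (T : Tuple q q' r d d' n g h e)
    (σ : R →+* R') (f : B →+* B') (hf : ∀ (c : R) (b : B), f (c • b) = σ c • f b) :
    Tuple (σ q) (σ q') (σ r) (σ d) (σ d') n (fun i => f (g i)) (fun i => f (h i)) (f e) where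
  qq := by rw [← map_mul, T.qq, map_one]
  dd := by rw [← map_mul, T.dd, map_one]
  dq := by simpa using congrArg σ T.dq
  h_eq i := by simpa [hf] using congrArg f (T.h_eq i)
  sq i h1 h2 := by simpa [hf] using congrArg f (T.sq i h1 h2)
  braid i h1 h2 := by simpa [hf] using congrArg f (T.braid i h1 h2)
  comm i j h1 h2 h3 := by simpa [hf] using congrArg f (T.comm i j h1 h2 h3)
  e_sq h := by simpa [hf] using congrArg f (T.e_sq h)
  e_comm i h1 h2 := by simpa [hf] using congrArg f (T.e_comm i h1 h2)
  e_g1 h := by simpa [hf] using congrArg f (T.e_g1 h)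
  g1_e h := by simpa [hf] using congrArg f (T.g1_e h)
  e_g2_e h := by simpa [hf] using congrArg f (T.e_g2_e h)
  w_eTwo h := by simpa [hf] using congrArg f (T.w_eTwo h)
  eTwo_w h := by simpa [hf] using congrArg f (T.eTwo_w h)

/-- Apart from `h_eq`, the relations see only the letters in range. This matters because the
generators of the subalgebras are set to 0 outside it. -/
theorem congr (T : Tuple q q' r d d' n g h e) {g' h' : ℕ → B} {e' : B}
    (hg : ∀ i, 1 ≤ i → i < n → g' i = g i) (he : 2 ≤ n → e' = e)
    (hh : ∀ i, h' i = q' • g' i + (q' - 1) • (1 : B)) : Tuple q q' r d d' n g' h' e' := by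
  have hh' : ∀ i, 1 ≤ i → i < n → h' i = h i := fun i h1 h2 => by rw [hh, T.h_eq, hg i h1 h2]
  refine ⟨T.qq, T.dd, T.dq, hh, fun i h1 h2 => ?_, fun i h1 h2 => ?_, fun i j h1 h2 h3 => ?_,
    fun h => ?_, fun i h1 h2 => ?_, fun h => ?_, fun h => ?_, fun h => ?_, fun h => ?_,
    fun h => ?_⟩
  · rw [hg i h1 h2, T.sq i h1 h2]
  · rw [hg i h1 (by omega), hg _ (by omega) h2, T.braid i h1 h2]
  · rw [hg i h1 (by omega), hg j (by omega) h3, T.comm i j h1 h2 h3]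
  · rw [he h, T.e_sq h]
  · rw [he (by omega), hg i (by omega) h2, T.e_comm i h1 h2]
  · rw [he h, hg 1 le_rfl (by omega), T.e_g1 h]
  · rw [he h, hg 1 le_rfl (by omega), T.g1_e h]
  · rw [he (by omega), hg 2 (by omega) (by omega), T.e_g2_e h]
  · rw [he (by omega), hg 2 (by omega) (by omega), hg 3 (by omega) (by omega),
      hh' 1 (by omega) (by omega), hh' 2 (by omega) (by omega), T.w_eTwo h]
  · rw [he (by omega), hg 2 (by omega) (by omega), hg 3 (by omega) (by omega),
      hh' 1 (by omega) (by omega), hh' 2 (by omega) (by omega), T.eTwo_w h]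

/-- Relations can be checked after applying a jointly injective family of homomorphisms. -/
theorem of_eval {ι : Type*} {S A : ι → Type*} [∀ i, CommRing (S i)] [∀ i, Ring (A i)]
    [∀ i, Algebra (S i) (A i)] (qq : q * q' = 1) (dd : d * d' = 1) (dq : d * (q - 1) = r - 1)
    (σ : ∀ i, R →+* S i) (f : ∀ i, B →+* A i)
    (hf : ∀ i (c : R) (b : B), f i (c • b) = σ i c • f i b)
    (hinj : ∀ x y : B, (∀ i, f i x = f i y) → x = y)
    (T : ∀ i, Tuple (σ i q) (σ i q') (σ i r) (σ i d) (σ i d') n (fun j => f i (g j))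
      (fun j => f i (h j)) (f i e)) : Tuple q q' r d d' n g h e where
  qq := qq
  dd := dd
  dq := dq
  h_eq j := hinj _ _ fun i => by simpa [hf] using (T i).h_eq j
  sq j h1 h2 := hinj _ _ fun i => by simpa [hf] using (T i).sq j h1 h2
  braid j h1 h2 := hinj _ _ fun i => by simpa [hf] using (T i).braid j h1 h2
  comm j k h1 h2 h3 := hinj _ _ fun i => by simpa [hf] using (T i).comm j k h1 h2 h3
  e_sq h := hinj _ _ fun i => by simpa [hf] using (T i).e_sq h
  e_comm j h1 h2 := hinj _ _ fun i => by simpa [hf] using (T i).e_comm j h1 h2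
  e_g1 h := hinj _ _ fun i => by simpa [hf] using (T i).e_g1 h
  g1_e h := hinj _ _ fun i => by simpa [hf] using (T i).g1_e h
  e_g2_e h := hinj _ _ fun i => by simpa [hf] using (T i).e_g2_e h
  w_eTwo h := hinj _ _ fun i => by simpa [hf] using (T i).w_eTwo h
  eTwo_w h := hinj _ _ fun i => by simpa [hf] using (T i).eTwo_w h

end Transport

end Tuple

section BaseChange

open TensorProduct

universe u

variable {R B : Type*} {K : Type u} [CommRing R] [Field K] [Algebra R K]
  {q q' r d d' : R}

section Scalars

variable {A C : Type*} [Ring A] [Algebra R A] [Ring C] [Algebra R C]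

variable (K) in
/-- Extension of scalars of a linear functional. -/
noncomputable def scalarExt (τ : A →ₗ[R] R) : K ⊗[R] A →ₗ[K] K :=
  (Algebra.TensorProduct.rid R K K).toLinearMap ∘ₗ τ.baseChange K

theorem scalarExt_tmul (τ : A →ₗ[R] R) (c : K) (x : A) :
    scalarExt K τ (c ⊗ₜ[R] x) = algebraMap R K (τ x) * c := by
  rw [scalarExt, LinearMap.comp_apply, LinearMap.baseChange_tmul, AlgEquiv.toLinearMap_apply,
    Algebra.TensorProduct.rid_tmul, Algebra.smul_def]

theorem scalarExt_mul_comm (τ : A →ₗ[R] R) (hτ : ∀ x y, τ (x * y) = τ (y * x))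
    (x y : K ⊗[R] A) : scalarExt K τ (x * y) = scalarExt K τ (y * x) := by
  induction x using TensorProduct.induction_on with
  | zero => rw [zero_mul, mul_zero]
  | add x x' hx hx' => rw [add_mul, mul_add, map_add, map_add, hx, hx']
  | tmul a x =>
    induction y using TensorProduct.induction_on with
    | zero => rw [zero_mul, mul_zero]
    | add y y' hy hy' => rw [add_mul, mul_add, map_add, map_add, hy, hy']
    | tmul b y =>
      rw [Algebra.TensorProduct.tmul_mul_tmul, Algebra.TensorProduct.tmul_mul_tmul, scalarExt_tmul,
        scalarExt_tmul, hτ, mul_comm a]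

/-- Applied with `G` the top generator and with `G` the element `conjE`: the rules for the last two
pieces survive extension of scalars. -/
theorem scalarExt_map_mul_mul (τ : A →ₗ[R] R) (σ : C →ₗ[R] R) (ι : A →ₐ[R] C) (G : C) (c : R)
    (hG : ∀ x y, σ (ι x * G * ι y) = c * τ (x * y)) (x y : K ⊗[R] A) :
    scalarExt K σ (Algebra.TensorProduct.map (AlgHom.id K K) ι x * ((1 : K) ⊗ₜ[R] G) *
      Algebra.TensorProduct.map (AlgHom.id K K) ι y) =
      algebraMap R K c * scalarExt K τ (x * y) := by
  induction x using TensorProduct.induction_on with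
  | zero => rw [map_zero, zero_mul, zero_mul, zero_mul, map_zero, map_zero, mul_zero]
  | add x x' hx hx' => rw [map_add, add_mul, add_mul, add_mul, map_add, map_add, mul_add, hx, hx']
  | tmul a x =>
    induction y using TensorProduct.induction_on with
    | zero => rw [map_zero, mul_zero, mul_zero, map_zero, map_zero, mul_zero]
    | add y y' hy hy' => rw [map_add, mul_add, mul_add, map_add, map_add, mul_add, hy, hy']
    | tmul b y =>
      rw [Algebra.TensorProduct.map_tmul, Algebra.TensorProduct.map_tmul,
        Algebra.TensorProduct.tmul_mul_tmul, Algebra.TensorProduct.tmul_mul_tmul,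
        Algebra.TensorProduct.tmul_mul_tmul, scalarExt_tmul, scalarExt_tmul, hG, map_mul]
      rw [AlgHom.id_apply, AlgHom.id_apply, mul_one, mul_assoc]

theorem scalarExt_map (τ : A →ₗ[R] R) (σ : C →ₗ[R] R) (ι : A →ₐ[R] C)
    (h : ∀ x, σ (ι x) = τ x) (x : K ⊗[R] A) :
    scalarExt K σ (Algebra.TensorProduct.map (AlgHom.id K K) ι x) = scalarExt K τ x := by
  induction x using TensorProduct.induction_on with
  | zero => rw [map_zero, map_zero, map_zero]
  | add y y' hy hy' => rw [map_add, map_add, map_add, hy, hy']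
  | tmul b y =>
    rw [Algebra.TensorProduct.map_tmul, scalarExt_tmul, scalarExt_tmul, h, AlgHom.id_apply]

theorem Tuple.baseChange {n : ℕ} {g h : ℕ → A} {e : A} (T : Tuple q q' r d d' n g h e) :
    Tuple (algebraMap R K q) (algebraMap R K q)⁻¹ (algebraMap R K r)
      (algebraMap R K d) (algebraMap R K d)⁻¹ n (fun i => (1 : K) ⊗ₜ[R] g i)
      (fun i => (1 : K) ⊗ₜ[R] h i) ((1 : K) ⊗ₜ[R] e) := by
  have hq' : (algebraMap R K q)⁻¹ = algebraMap R K q' :=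
    inv_eq_of_mul_eq_one_right (by rw [← map_mul, T.qq, map_one])
  have hd' : (algebraMap R K d)⁻¹ = algebraMap R K d' :=
    inv_eq_of_mul_eq_one_right (by rw [← map_mul, T.dd, map_one])
  rw [hq', hd']
  exact T.map (algebraMap R K)
    (Algebra.TensorProduct.includeRight : A →ₐ[R] K ⊗[R] A).toRingHom
    fun c b => by
      change (1 : K) ⊗ₜ[R] (c • b) = algebraMap R K c • ((1 : K) ⊗ₜ[R] b)
      rw [algebraMap_smul, TensorProduct.tmul_smul]

variable (K) in
theorem one_tmul_conjE (n : ℕ) (g h : ℕ → A) (e : A) :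
    (1 : K) ⊗ₜ[R] Tuple.conjE g h e n = Tuple.conjE (fun i => (1 : K) ⊗ₜ[R] g i)
      (fun i => (1 : K) ⊗ₜ[R] h i) ((1 : K) ⊗ₜ[R] e) n := by
  have hf : ∀ x, (1 : K) ⊗ₜ[R] x =
      (Algebra.TensorProduct.includeRight : A →ₐ[R] K ⊗[R] A) x := fun _ => rfl
  simp only [hf]
  rw [Tuple.conjE, Tuple.conjE, map_mul, map_mul, map_up _ g _ fun i _ _ => rfl,
    map_dn _ h _ fun i _ _ => rfl]

end Scalars

section Family

variable {A : ℕ → Type*} [∀ n, Ring (A n)] [∀ n, Algebra R (A n)] {g h : ∀ n, ℕ → A n}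
  {e : ∀ n, A n}

/-- A family of compatible traces on algebras over `R` that are generated by tuples
defines, after extension of scalars, a family of traces on the `q`-Brauer algebras over `K`. -/
theorem nonempty_towerTrace (T : ∀ n, Tuple q q' r d d' n (g n) (h n) (e n))
    (ι : ∀ n, A n →ₐ[R] A (n + 1)) (ιg : ∀ n i, 1 ≤ i → i < n → ι n (g n i) = g (n + 1) i)
    (ιe : ∀ n, 2 ≤ n → ι n (e n) = e (n + 1))
    (τ : ∀ n, A n →ₗ[R] R) (t_one : ∀ n, τ n 1 = 1)
    (t_comm : ∀ n x y, τ n (x * y) = τ n (y * x))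
    (t_incl : ∀ n x, τ (n + 1) (ι n x) = τ n x)
    (t_g : ∀ n, 1 ≤ n → ∀ x y,
      τ (n + 1) (ι n x * g (n + 1) n * ι n y) = r * d' * τ n (x * y))
    (t_conj : ∀ n, 1 ≤ n → ∀ x y,
      τ (n + 1) (ι n x * Tuple.conjE (g (n + 1)) (h (n + 1)) (e (n + 1)) n * ι n y) =
        r * q' * d' * τ n (x * y)) :
    Nonempty (TowerTrace (algebraMap R K q) (algebraMap R K r) (algebraMap R K d)) := by
  have hq' : algebraMap R K q' = (algebraMap R K q)⁻¹ :=
    (inv_eq_of_mul_eq_one_right (by rw [← map_mul, (T 0).qq, map_one])).symm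
  have hd' : algebraMap R K d' = (algebraMap R K d)⁻¹ :=
    (inv_eq_of_mul_eq_one_right (by rw [← map_mul, (T 0).dd, map_one])).symm
  have hφ := fun n => ((T n).baseChange (K := K)).exists_lift
  choose φ φg φe using hφ
  have φι : ∀ n x, φ (n + 1) (incl _ _ _ n x) =
      Algebra.TensorProduct.map (AlgHom.id K K) (ι n) (φ n x) := by
    intro n x
    have : (φ (n + 1)).comp (incl _ _ _ n) =
        (Algebra.TensorProduct.map (AlgHom.id K K) (ι n)).comp (φ n) := by
      refine br_algHom_ext (fun i h1 h2 => ?_) fun hn => ?_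
      · rw [AlgHom.comp_apply, AlgHom.comp_apply, incl_g h1 h2, φg _ i h1 (by omega), φg _ i h1 h2,
          Algebra.TensorProduct.map_tmul, ιg n i h1 h2, AlgHom.id_apply]
      · rw [AlgHom.comp_apply, AlgHom.comp_apply, incl_e hn, φe _ (by omega), φe _ hn,
          Algebra.TensorProduct.map_tmul, ιe n hn, AlgHom.id_apply]
    exact DFunLike.congr_fun this x
  have φh : ∀ n i, 1 ≤ i → i < n → φ n (gInv _ _ _ n i) = (1 : K) ⊗ₜ[R] h n i := by
    intro n i h1 h2
    rw [gInv_eq, map_add, map_smul, map_smul, map_one, φg _ i h1 h2,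
      ((T n).baseChange (K := K)).h_eq]
  have φc : ∀ n, 1 ≤ n → φ (n + 1) (conjEl _ _ _ n) =
      (1 : K) ⊗ₜ[R] Tuple.conjE (g (n + 1)) (h (n + 1)) (e (n + 1)) n := by
    intro n hn
    rw [one_tmul_conjE, conjEl, Tuple.conjE, Tuple.conjE, map_mul, map_mul, φe _ (by omega),
      map_up (φ (n + 1)) _ _ fun i _ _ => φg _ i (by omega) (by omega),
      map_dn (φ (n + 1)) _ _ fun i _ _ => φh _ i (by omega) (by omega)]
  refine ⟨⟨fun n => scalarExt K (τ n) ∘ₗ (φ n).toLinearMap, fun n => ?_, fun n x y => ?_,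
    fun n y => ?_, fun n hn y z => ?_, fun n hn y z => ?_⟩⟩
  · rw [LinearMap.comp_apply, AlgHom.toLinearMap_apply, map_one,
      Algebra.TensorProduct.one_def, scalarExt_tmul, t_one, map_one, mul_one]
  · rw [LinearMap.comp_apply, LinearMap.comp_apply, AlgHom.toLinearMap_apply,
      AlgHom.toLinearMap_apply, map_mul (φ n), map_mul (φ n), scalarExt_mul_comm _ (t_comm n)]
  · rw [LinearMap.comp_apply, LinearMap.comp_apply, AlgHom.toLinearMap_apply,
      AlgHom.toLinearMap_apply, φι, scalarExt_map _ _ _ (t_incl n)]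
  · rw [LinearMap.comp_apply, LinearMap.comp_apply, AlgHom.toLinearMap_apply,
      AlgHom.toLinearMap_apply, map_mul (φ (n + 1)), map_mul (φ (n + 1)), φι, φι,
      φg _ n hn (by omega), scalarExt_map_mul_mul _ _ _ _ _ (t_g n hn), map_mul (φ n), map_mul,
      div_eq_mul_inv, hd']
  · rw [LinearMap.comp_apply, LinearMap.comp_apply, AlgHom.toLinearMap_apply,
      AlgHom.toLinearMap_apply, map_mul (φ (n + 1)), map_mul (φ (n + 1)), φι, φι,
      φc n hn, scalarExt_map_mul_mul _ _ _ _ _ (t_conj n hn), map_mul (φ n), map_mul, map_mul,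
      div_eq_mul_inv, hd', hq']

end Family

section Subalgebras

variable [Ring B] [Algebra R B] {g h : ℕ → B} {e : B}

open Classical in
variable (R) in
/-- The element `g i` of the subalgebra on `n` strands, for `1 ≤ i < n`. -/
noncomputable def subG (g : ℕ → B) (e : B) (n i : ℕ) : brauerSub R g e n :=
  if hi : 1 ≤ i ∧ i < n then ⟨g i, Algebra.subset_adjoin (Or.inl ⟨i, hi.1, hi.2, rfl⟩)⟩ else 0

open Classical in
variable (R) in
/-- The element `e` of the subalgebra on `n` strands, for `2 ≤ n`. -/
noncomputable def subE (g : ℕ → B) (e : B) (n : ℕ) : brauerSub R g e n :=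
  if hn : 2 ≤ n then ⟨e, e_mem_brauerSub hn⟩ else 0

theorem subG_val {n i : ℕ} (h1 : 1 ≤ i) (h2 : i < n) : (subG R g e n i : B) = g i := by
  rw [subG, dif_pos ⟨h1, h2⟩]

theorem subE_val {n : ℕ} (h : 2 ≤ n) : (subE R g e n : B) = e := by
  rw [subE, dif_pos h]

/-- The inverse of `g i` in the subalgebra on `n` strands, for `1 ≤ i < n`. -/
noncomputable def subH (q' : R) (g : ℕ → B) (e : B) (n i : ℕ) : brauerSub R g e n :=
  q' • subG R g e n i + (q' - 1) • 1

theorem subH_val {n i : ℕ} (T : Tuple q q' r d d' n g h e) (h1 : 1 ≤ i) (h2 : i < n) :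
    (subH q' g e n i : B) = h i := by
  have : (subH q' g e n i : B) = q' • (subG R g e n i : B) + (q' - 1) • 1 := rfl
  rw [this, subG_val h1 h2, T.h_eq]

theorem Tuple.sub {n : ℕ} (T : Tuple q q' r d d' n g h e) :
    Tuple q q' r d d' n (subG R g e n) (subH q' g e n) (subE R g e n) :=
  Tuple.of_eval (ι := Unit) T.qq T.dd T.dq (fun _ => RingHom.id R)
    (fun _ => (brauerSub R g e n).val.toRingHom) (fun _ _ _ => rfl)
    (fun _ _ hxy => Subtype.ext (hxy ()))
    fun _ => T.congr (fun _ h1 h2 => subG_val h1 h2) (fun hn => subE_val hn) fun _ => rfl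

theorem conjE_sub_val {n : ℕ} (hn : 1 ≤ n) (T : Tuple q q' r d d' (n + 1) g h e) :
    ((Tuple.conjE (subG R g e (n + 1)) (subH q' g e (n + 1)) (subE R g e (n + 1)) n :
      brauerSub R g e (n + 1)) : B) =
      Tuple.conjE g h e n := by
  have hv : ∀ x : brauerSub R g e (n + 1), (x : B) = (brauerSub R g e (n + 1)).val x :=
    fun _ => rfl
  rw [Tuple.conjE, hv, map_mul, map_mul,
    map_up _ _ g fun i _ _ => subG_val (by omega) (by omega),
    map_dn _ _ h fun i _ _ => subH_val T (by omega) (by omega), ← hv, subE_val (by omega),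
    Tuple.conjE]

theorem CondExp.nonempty_towerTrace {E : ℕ → B →ₗ[R] B} (hE : CondExp q' r d g h e E)
    (T : ∀ n, Tuple q q' r d d' n g h e) (hR : Function.Injective (algebraMap R B)) :
    Nonempty (TowerTrace (algebraMap R K q) (algebraMap R K r) (algebraMap R K d)) := by
  obtain ⟨τ, hτ⟩ := hE.exists_trace T hR
  refine QBrauer.nonempty_towerTrace (fun n => (T n).sub)
    (fun n => Subalgebra.inclusion (brauerSub_mono n.le_succ)) (fun n i h1 h2 => ?_)
    (fun n hn => ?_) τ (fun n => hR ?_) (fun n x y => hR ?_) (fun n x => hR ?_)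
    (fun n hn x y => hR ?_) (fun n hn x y => hR ?_)
  · refine Subtype.ext ?_
    rw [Subalgebra.coe_inclusion, subG_val h1 h2, subG_val h1 (by omega)]
  · refine Subtype.ext ?_
    rw [Subalgebra.coe_inclusion, subE_val hn, subE_val (by omega)]
  · rw [hτ, map_one, OneMemClass.coe_one]
    exact hE.iter_one T n
  · rw [hτ, hτ, Subalgebra.coe_mul, Subalgebra.coe_mul]
    exact hE.iter_mul_comm T n y y.2 x x.2
  · rw [hτ, hτ, Subalgebra.coe_inclusion]
    exact hE.iter_of_mem T x.2
  · rw [hτ, map_mul, hτ, ← Algebra.smul_def, mul_comm r, Subalgebra.coe_mul, Subalgebra.coe_mul,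
      Subalgebra.coe_mul, Subalgebra.coe_inclusion, Subalgebra.coe_inclusion,
      subG_val hn (by omega)]
    exact hE.iter_mul_g_mul hn x.2 y.2
  · rw [hτ, map_mul, hτ, ← Algebra.smul_def, mul_comm _ d', Subalgebra.coe_mul, Subalgebra.coe_mul,
      Subalgebra.coe_mul, Subalgebra.coe_inclusion, Subalgebra.coe_inclusion,
      conjE_sub_val hn (T (n + 1))]
    exact hE.iter_mul_conjE_mul hn x.2 y.2

end Subalgebras

end BaseChange

end QBrauer

/-! ### Generic parameters, density of the model points and specialization. -/

namespace QBrauer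

section Generic

open Polynomial

/-- Evaluation of integral polynomials in two variables. -/
noncomputable def evPoly {K : Type*} [CommRing K] (x y : K) : ℤ[X][X] →+* K :=
  eval₂RingHom (eval₂RingHom (Int.castRingHom K) x) y

theorem evPoly_C_X {K : Type*} [CommRing K] (x y : K) : evPoly x y (C X) = x := by
  simp [evPoly]

theorem evPoly_X {K : Type*} [CommRing K] (x y : K) : evPoly x y X = y := by
  simp [evPoly]

/-- For fixed `x` the polynomial in `y` has infinitely many roots, so each coefficient vanishes at
every `x ∈ S`, and these are again infinitely many. -/
theorem eq_zero_of_evPoly_eq_zero {K : Type*} [Field K] [CharZero K] {S : Set K} (hS : S.Infinite)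
    {U : K → Set K} (hU : ∀ x ∈ S, (U x).Infinite) {a : ℤ[X][X]}
    (ha : ∀ x ∈ S, ∀ y ∈ U x, evPoly x y a = 0) : a = 0 := by
  have h1 : ∀ x ∈ S, a.map (eval₂RingHom (Int.castRingHom K) x) = 0 := by
    intro x hx
    refine eq_zero_of_infinite_isRoot _ ((hU x hx).mono fun y hy => ?_)
    have := ha x hx y hy
    rwa [evPoly, coe_eval₂RingHom, ← eval_map] at this
  ext1 n
  rw [coeff_zero]
  have h2 : (a.coeff n).map (Int.castRingHom K) = 0 := by
    refine eq_zero_of_infinite_isRoot _ (hS.mono fun x hx => ?_)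
    have := congrArg (fun p => p.coeff n) (h1 x hx)
    simp only [coeff_map, coeff_zero, coe_eval₂RingHom] at this
    rwa [← eval_map] at this
  exact (Polynomial.map_eq_zero_iff (RingHom.injective_int (Int.castRingHom K))).mp h2

/-- The ring of integral Laurent polynomials in two variables, which stand for the parameters
`q` and `δ`. -/
abbrev GenRing : Type := Localization.Away (C X * X : ℤ[X][X])

/-- The generic value of `q`. -/
noncomputable def genQ : GenRing := algebraMap ℤ[X][X] GenRing (C X)

/-- The generic value of `δ`. -/
noncomputable def genD : GenRing := algebraMap ℤ[X][X] GenRing X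

/-- The inverse of `genQ * genD`. -/
noncomputable def genInv : GenRing :=
  IsLocalization.Away.invSelf (S := GenRing) (C X * X : ℤ[X][X])

theorem genQ_mul_genD_mul_genInv : genQ * genD * genInv = 1 := by
  rw [genQ, genD, genInv, ← map_mul, IsLocalization.Away.mul_invSelf]

section Eval

variable {K : Type*} [Field K] {x y : K}

/-- Evaluation of Laurent polynomials at nonzero elements of a field. -/
noncomputable def evGen (hx : x ≠ 0) (hy : y ≠ 0) : GenRing →+* K :=
  IsLocalization.Away.lift (S := GenRing) (C X * X : ℤ[X][X]) (g := evPoly x y)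
    (by rw [map_mul, evPoly_C_X, evPoly_X]; exact (mul_ne_zero hx hy).isUnit)

theorem evGen_algebraMap (hx : x ≠ 0) (hy : y ≠ 0) (a : ℤ[X][X]) :
    evGen hx hy (algebraMap _ _ a) = evPoly x y a :=
  IsLocalization.Away.lift_eq _ _ _

theorem evGen_genQ (hx : x ≠ 0) (hy : y ≠ 0) : evGen hx hy genQ = x := by
  rw [genQ, evGen_algebraMap, evPoly_C_X]

theorem evGen_genD (hx : x ≠ 0) (hy : y ≠ 0) : evGen hx hy genD = y := by
  rw [genD, evGen_algebraMap, evPoly_X]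

end Eval

/-- The points at which the model of the `q`-Brauer algebra is defined. -/
def pt (p : ℕ × ℕ) : ℚ := (p.1 : ℚ) + 1

theorem pt_pos (p : ℕ × ℕ) : 0 < pt p := by unfold pt; positivity

theorem del_pos (p : ℕ × ℕ) : 0 < Model.del (pt p) p.2 := by
  have := pt_pos p
  unfold Model.del
  exact Finset.sum_pos (fun _ _ => by positivity) Finset.univ_nonempty

/-- Evaluation of Laurent polynomials at the parameters of the model. -/
noncomputable def evPt (p : ℕ × ℕ) : GenRing →+* ℚ :=
  evGen (x := pt p ^ 2) (y := Model.del (pt p) p.2) (pow_ne_zero 2 (pt_pos p).ne') (del_pos p).ne'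

/-- After clearing denominators it suffices that the points (q, 1 + q + ⋯ + q^N) with q = (t + 1)²
are Zariski dense: the values of q are infinite in number, and for each q > 0 the second coordinate
increases strictly with N. -/
theorem eq_zero_of_evPt_eq_zero {a : GenRing} (ha : ∀ p, evPt p a = 0) : a = 0 := by
  obtain ⟨⟨b, s⟩, hb⟩ := IsLocalization.surj (Submonoid.powers (C X * X : ℤ[X][X])) a
  have hb0 : b = 0 := by
    have hpos : ∀ t : ℕ, (0 : ℚ) < ((t : ℚ) + 1) ^ 2 := fun t => by positivity
    refine eq_zero_of_evPoly_eq_zero (K := ℚ) (S := Set.range fun t : ℕ => ((t : ℚ) + 1) ^ 2)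
      (U := fun x => Set.range fun N : ℕ => ∑ c : Fin (N + 1), x ^ (c : ℕ))
      (Set.infinite_range_of_injective ?_) ?_ ?_
    · refine (strictMono_nat_of_lt_succ fun t => ?_).injective
      have := t.cast_nonneg (α := ℚ)
      push_cast
      nlinarith
    · rintro _ ⟨t, rfl⟩
      refine Set.infinite_range_of_injective (strictMono_nat_of_lt_succ fun N => ?_).injective
      dsimp only
      rw [Fin.sum_univ_castSucc (n := N + 1)]
      have := pow_pos (hpos t) (N + 1)
      simpa using this
    · rintro _ ⟨t, rfl⟩ _ ⟨N, rfl⟩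
      have h1 := congrArg (evPt (t, N)) hb
      rw [map_mul, ha, zero_mul, evPt, evGen_algebraMap] at h1
      exact h1.symm
  rw [hb0, map_zero] at hb
  exact (IsLocalization.map_units GenRing s).mul_left_eq_zero.mp hb

/-- The product of the algebras of the models at all points. -/
abbrev GenAlg : Type := ∀ p : ℕ × ℕ, Module.End ℚ ((ℕ → Fin (p.2 + 1)) → ℚ)

/-- The embedding of the Laurent polynomials in the product of the models. -/
noncomputable def genHom : GenRing →+* GenAlg :=
  RingHom.pi fun p => (algebraMap ℚ (Module.End ℚ ((ℕ → Fin (p.2 + 1)) → ℚ))).comp (evPt p)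

noncomputable instance : Algebra GenRing GenAlg :=
  genHom.toAlgebra' fun c x => funext fun p => Algebra.commutes (evPt p c) (x p)

theorem gen_smul_apply (c : GenRing) (x : GenAlg) (p : ℕ × ℕ) : (c • x) p = evPt p c • x p :=
  (Algebra.smul_def (evPt p c) (x p)).symm

/-- The reason for taking all models at once: a scalar of `GenAlg` coming from `GenRing` determines
its Laurent polynomial, so the iterated expectations define traces with values in `GenRing`. -/
theorem genHom_injective : Function.Injective (algebraMap GenRing GenAlg) := by
  rw [injective_iff_map_eq_zero]
  intro a ha
  refine eq_zero_of_evPt_eq_zero fun p => ?_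
  have h1 : algebraMap ℚ (Module.End ℚ ((ℕ → Fin (p.2 + 1)) → ℚ)) (evPt p a) = 0 :=
    congrFun ha p
  exact (FaithfulSMul.algebraMap_injective ℚ (Module.End ℚ ((ℕ → Fin (p.2 + 1)) → ℚ)))
    (h1.trans (map_zero _).symm)

/-- The generators `g i` in the product of the models. -/
noncomputable def genG (i : ℕ) : GenAlg := fun p => Model.opG (pt p) p.2 (i - 1)

/-- The inverses of the generators `g i` in the product of the models. -/
noncomputable def genH (i : ℕ) : GenAlg := fun p => Model.opH (pt p) p.2 (i - 1)

/-- The generator `e` in the product of the models. -/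
noncomputable def genE : GenAlg := fun p => Model.opE (pt p) p.2

/-- The partial traces on the product of the models. -/
noncomputable def genEx (n : ℕ) : GenAlg →ₗ[GenRing] GenAlg where
  toFun x p := Model.opEx (pt p) p.2 n (x p)
  map_add' x y := funext fun p => map_add _ _ _
  map_smul' c x := funext fun p => by
    rw [gen_smul_apply, map_smul, RingHom.id_apply, gen_smul_apply]

/-- The generic value of `r`. -/
noncomputable def genR : GenRing := genD * (genQ - 1) + 1

theorem evPt_genQ (p : ℕ × ℕ) : evPt p genQ = pt p ^ 2 := evGen_genQ _ _

theorem evPt_genD (p : ℕ × ℕ) : evPt p genD = Model.del (pt p) p.2 := evGen_genD _ _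

theorem evPt_genR (p : ℕ × ℕ) : evPt p genR = (pt p ^ 2) ^ (p.2 + 1) := by
  rw [genR, map_add, map_mul, map_sub, evPt_genQ, evPt_genD, map_one, Model.del_mul,
    sub_add_cancel]

theorem evPt_genQ_inv (p : ℕ × ℕ) : evPt p (genD * genInv) = (pt p ^ 2)⁻¹ := by
  refine (inv_eq_of_mul_eq_one_right ?_).symm
  rw [← evPt_genQ, ← map_mul, ← mul_assoc, genQ_mul_genD_mul_genInv, map_one]

theorem evPt_genD_inv (p : ℕ × ℕ) : evPt p (genQ * genInv) = (Model.del (pt p) p.2)⁻¹ := by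
  refine (inv_eq_of_mul_eq_one_right ?_).symm
  rw [← evPt_genD, ← map_mul, ← mul_assoc, mul_comm genD, genQ_mul_genD_mul_genInv, map_one]

theorem gen_tuple (n : ℕ) :
    Tuple genQ (genD * genInv) genR genD (genQ * genInv) n genG genH genE := by
  refine Tuple.of_eval (A := fun p : ℕ × ℕ => Module.End ℚ ((ℕ → Fin (p.2 + 1)) → ℚ))
    (by rw [← mul_assoc, genQ_mul_genD_mul_genInv])
    (by rw [← mul_assoc, mul_comm genD, genQ_mul_genD_mul_genInv]) (by rw [genR]; ring)
    evPt (fun p => Pi.evalRingHom _ p) (fun p c b => gen_smul_apply c b p)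
    (fun x y h => funext h) fun p => ?_
  rw [evPt_genQ, evPt_genD, evPt_genR, evPt_genQ_inv, evPt_genD_inv]
  exact Model.tuple (pt_pos p).ne' (del_pos p).ne' n

theorem gen_condExp : CondExp (genD * genInv) genR genD genG genH genE genEx where
  one n hn := funext fun p => by
    rw [gen_smul_apply, evPt_genD]
    exact (Model.condExp (pt_pos p).ne').one n hn
  g_top n hn := funext fun p => by
    rw [gen_smul_apply, evPt_genR]
    exact (Model.condExp (pt_pos p).ne').g_top n hn
  conj n hn := funext fun p => by
    rw [gen_smul_apply, map_mul, evPt_genR, evPt_genQ_inv]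
    refine Eq.trans ?_ ((Model.condExp (pt_pos p).ne').conj n hn)
    have h1 : Tuple.conjE genG genH genE n p = Tuple.conjE (fun i => Model.opG (pt p) p.2 (i - 1))
        (fun i => Model.opH (pt p) p.2 (i - 1)) (Model.opE (pt p) p.2) n := by
      change Pi.evalRingHom (fun i : ℕ × ℕ => Module.End ℚ ((ℕ → Fin (i.2 + 1)) → ℚ)) p
        (dn genH 2 (n - 1) * genE * up genG 2 (n - 1)) = _
      rw [map_mul, map_mul, map_up _ genG _ fun i _ _ => rfl,
        map_dn _ genH _ fun i _ _ => rfl]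
      rfl
    rw [← h1]
    rfl
  g_mul n i x h1 h2 := funext fun p => (Model.condExp (pt_pos p).ne').g_mul n i (x p) h1 h2
  mul_g n i x h1 h2 := funext fun p => (Model.condExp (pt_pos p).ne').mul_g n i (x p) h1 h2
  e_mul n x h := funext fun p => (Model.condExp (pt_pos p).ne').e_mul n (x p) h
  mul_e n x h := funext fun p => (Model.condExp (pt_pos p).ne').mul_e n (x p) h
  swap n x h := funext fun p => (Model.condExp (pt_pos p).ne').swap n (x p) h

/-- Specialization of the generic trace. Taking q and δ as the free parameters, with r = δ(q - 1) +
1, avoids division by q - 1 and so includes q = 1. -/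
theorem nonempty_towerTrace_of_ne_zero {K : Type*} [Field K] {q r δ : K} (hq : q ≠ 0) (hδ : δ ≠ 0)
    (hr : δ * (q - 1) = r - 1) : Nonempty (TowerTrace q r δ) := by
  let : Algebra GenRing K := (evGen hq hδ).toAlgebra
  have h := gen_condExp.nonempty_towerTrace (K := K) gen_tuple genHom_injective
  have h1 : algebraMap GenRing K genQ = q := evGen_genQ hq hδ
  have h2 : algebraMap GenRing K genD = δ := evGen_genD hq hδ
  have h3 : algebraMap GenRing K genR = r := by
    rw [genR, map_add, map_mul, map_sub, h1, h2, map_one, hr, sub_add_cancel]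
  rwa [h1, h2, h3] at h

end Generic

end QBrauer

theorem corollary5p4 {K : Type*} [Field K] [CharZero K] (ρ ξ δ : K)
    (hρ : ρ ≠ 0) (hξ : ξ ≠ 0) (hδ : δ ≠ 0) (hδρξ : δ * (ξ - 1) = ρ - 1) :
    ∃ T : QBrauer.MarkovTrace ξ ρ δ,
      (∀ T' : QBrauer.MarkovTrace ξ ρ δ, T' = T) ∧
      ∀ n : ℕ,
        (∀ a ∈ T.ann n, QBrauer.incl ξ ρ δ n a ∈ T.ann (n + 1)) ∧
        ∃ φ : (QBrauer.Br ξ ρ δ n ⧸ T.ann n) →ₐ[K] (QBrauer.Br ξ ρ δ (n + 1) ⧸ T.ann (n + 1)),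
          Function.Injective φ ∧
          ∀ a : QBrauer.Br ξ ρ δ n,
            φ (Ideal.Quotient.mk (T.ann n) a) =
              Ideal.Quotient.mk (T.ann (n + 1)) (QBrauer.incl ξ ρ δ n a) := by
  obtain ⟨S⟩ := QBrauer.nonempty_towerTrace_of_ne_zero hξ hδ hδρξ
  exact S.exists_markovTrace hξ hδ hδρξ
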